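/- **Setting.** Let $d>4$ be an integer, let $0<\delta<1\wedge\frac{d-4}{4}$ and $\epsilon>\delta$. For each real $L\ge 1$ let $D=D_L:\mathbb Z^d\to[0,\infty)$ and let $f_n(k;z)$ ($n\ge 0$), $g_n(k;z)$, $e_n(k;z)$ ($n\ge1$) be real-valued functions of $k\in[-\pi,\pi]^d$ and $z>0$ (all depending on $L$), with $f_n(\cdot;z)$ measurable and $f_n(\cdot;z)$, $g_n(\cdot;z)$ twice differentiable at $k=0$, such that $f_0=1$ and $$f_{n+1}(k;z)=\sum_{m=1}^{n+1}g_m(k;z)f_{n+1-m}(k;z)+e_{n+1}(k;z)\qquad(n\ge0).$$ Write $\hat D(k)=\sum_{x\in\mathbb Z^d}D(x)e^{ik\cdot x}$, $a(k)=1-\hat D(k)$, $\sigma^2=-\nabla^2\hat D(0)$, $\beta=L^{-d}$, $\|h\|_1=(2\pi)^{-d}\int_{[-\pi,\pi]^d}|h(k)|\,dk$; $\nabla^2$ is the Laplacian in $k$. Assume: * **(S)** For all $n\ge 1$, $z>0$, the functions $f_n(\cdot;z),g_n(\cdot;z),e_n(\cdot;z)$ are invariant under $k_i\mapsto-k_i$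 and under permutations of the components of $k$; for each $n$ (and $L$), $|f_n(k;z)|$ is bounded uniformly in $k\in[-\pi,\pi]^d$ and $z$ in some neighbourhood of $1$. * **(D)** $f_1(k;z)=z\hat D(k)$, $e_1=0$, $\hat D(0)=1$, $\sum_x|x|^{2+2\epsilon}D(x)<\infty$, and there are constants $C,\eta,c_1,c_2>0$ such that for all $L\ge1$: $\|D\|_\infty\le CL^{-d}$, $\sigma^2\le CL^2$, $c_1L^2|k|^2\le a(k)\le c_2L^2|k|^2$ if $\|k\|_\infty\le L^{-1}$, $a(k)>\eta$ if $k\in[-\pi,\pi]^d$ and $\|k\|_\infty\ge L^{-1}$, and $a(k)<2-\eta$ for all $k\in[-\pi,\pi]^d$. * **(E), (G)** For every $K>1$ there are $\alpha\in(0,1)$ and constants $C_e(K),C_g(K)<\infty$, $L_0(K)>0$ such that the following holds for all $L\ge L_0(K)$, all non-degenerate closed intervals $I\subset[1-\alpha,1+\alpha]$ and all $n$. If $$\|\hat D^2f_m(\cdot;z)\|_1\le K\beta m^{-d/2},\qquad|f_m(0;z)|\le K,\qquad|\nabla^2f_m(0;z)|\le K\sigma^2m$$ for all $z\in I$ and $1\le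 m\le n$, then for all $z\in I$, $k\in[-\pi,\pi]^d$ and $2\le m\le n+1$: $|e_m(k;z)|\le C_e\beta m^{-d/2}$, $|e_m(k;z)-e_m(0;z)|\le C_e\,a(k)\beta m^{-(d-2)/2}$; and $|g_m(k;z)|\le C_g\beta m^{-d/2}$, $|\nabla^2g_m(0;z)|\le C_g\sigma^2\beta m^{-(d-2)/2}$, $\partial_zg_m(0;z)$ exists with $|\partial_zg_m(0;z)|\le C_g\beta m^{-(d-2)/2}$, and $|g_m(k;z)-g_m(0;z)-a(k)\sigma^{-2}\nabla^2g_m(0;z)|\le C_g\beta\,a(k)^{1+\epsilon'}m^{-(d-2-2\epsilon')/2}$ for every $\epsilon'\in[0,\epsilon]$. **Statement.** There are $L_0\ge1$, $\gamma>0$ and $C>0$, independent of $L$, such that for every $L\ge L_0$ there are positive numbers $z_c,A,v$ (depending on $L$) for which the following hold. First, they are constants of the Gaussian limit theorem: (a) $f_n\big(\tfrac{k}{\sqrt{v\sigma^2n}};z_c\big)=Ae^{-|k|^2/2d}\,[1+O(|k|^2n^{-\delta})+O(n^{-(d-4)/2})]$ for $n\ge1$, uniformly in those $k\in\mathbb R^d$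 with $k/\sqrt{v\sigma^2n}\in[-\pi,\pi]^d$ and $a(k/\sqrt{v\sigma^2n})\le\gamma n^{-1}\log n$ (the constants in these error terms may depend on $L$); (b) for all $n\ge 1$, $f_n(0;z_c)\ne0$ and $\Big|-\dfrac{\nabla^2f_n(0;z_c)}{f_n(0;z_c)}-v\sigma^2n\Big|\le C\,v\sigma^2n\,\beta n^{-\delta}$; (c) $\|\hat D^2f_n(\cdot;z_c)\|_1\le C\beta n^{-d/2}$ for all $n\ge1$. Second, $\sigma^2>0$, the series below converge absolutely, $\sum_{m\ge1}m\,g_m(0;z_c)>0$, and $$1=\sum_{m=1}^\infty g_m(0;z_c),\qquad A=\frac{1+\sum_{m=1}^\infty e_m(0;z_c)}{\sum_{m=1}^\infty m\,g_m(0;z_c)},\qquad v=-\frac{\sum_{m=1}^\infty\nabla^2g_m(0;z_c)}{\sigma^2\sum_{m=1}^\infty m\,g_m(0;z_c)}.$$ Third, $|z_c-1|\le C\beta$, $|A-1|\le C\beta$ and $|v-1|\le C\beta$. -/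

import Mathlib

open MeasureTheory Filter Topology

noncomputable section

namespace LaceExpansion

/-- The momentum space `ℝ^d`, with its Euclidean norm. -/
abbrev Momentum (d : ℕ) : Type := EuclideanSpace ℝ (Fin d)

/-- The cube `[-π, π]^d`. -/
def cube (d : ℕ) : Set (Momentum d) := {k | ∀ i, |k i| ≤ Real.pi}

/-- The sup norm `‖k‖_∞` (the norm of `Fin d → ℝ` is the sup norm). -/
def supNorm {d : ℕ} (k : Momentum d) : ℝ := ‖WithLp.ofLp k‖

/-- The Euclidean length `|x|` of a lattice point. -/
def latticeNorm {d : ℕ} (x : Fin d → ℤ) : ℝ := Real.sqrt (∑ i, (x i : ℝ) ^ 2)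

/-- The Fourier transform `ĥ(k) = ∑_x h(x) e^{i k·x}` of a function on `ℤ^d`. -/
def fourier {d : ℕ} (h : (Fin d → ℤ) → ℝ) (k : Momentum d) : ℂ :=
  ∑' x : Fin d → ℤ, (h x : ℂ) * Complex.exp (Complex.I * ((∑ i, k i * (x i : ℝ) : ℝ) : ℂ))

/-- `D̂(k)` as a real number; under the assumptions below, `fourier D` is real on the cube. -/
def Dhat {d : ℕ} (D : (Fin d → ℤ) → ℝ) (k : Momentum d) : ℝ := (fourier D k).re

/-- `a(k) = 1 - D̂(k)`. -/
def a {d : ℕ} (D : (Fin d → ℤ) → ℝ) (k : Momentum d) : ℝ := 1 - Dhat D k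

/-- `∇²h(0)`, the Laplacian at the origin. -/
def lap0 {d : ℕ} (h : Momentum d → ℝ) : ℝ := Laplacian.laplacian h 0

/-- `h` is twice (Fréchet) differentiable at the origin, so that `lap0 h` is meaningful. -/
def TwiceDifferentiableAtZero {d : ℕ} (h : Momentum d → ℝ) : Prop :=
  (∀ᶠ k in 𝓝 (0 : Momentum d), DifferentiableAt ℝ h k) ∧ DifferentiableAt ℝ (fderiv ℝ h) 0

/-- `σ² = -∇²D̂(0)`. -/
def sigmaSq {d : ℕ} (D : (Fin d → ℤ) → ℝ) : ℝ := -lap0 (Dhat D)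

/-- The small parameter `β = L^{-d}`. -/
def beta (d : ℕ) (L : ℝ) : ℝ := (L ^ d)⁻¹

/-- Invariance on the cube under `k_i ↦ -k_i` and under permutations of the components. -/
def LatticeSymmetric {d : ℕ} (h : Momentum d → ℝ) : Prop :=
  (∀ k ∈ cube d, ∀ i : Fin d, h (WithLp.toLp 2 (Function.update (WithLp.ofLp k) i (-(k i)))) = h k) ∧
  (∀ k ∈ cube d, ∀ p : Equiv.Perm (Fin d), h (WithLp.toLp 2 (fun i => k (p i))) = h k)

/-- The norm `‖h‖_1 = (2π)^{-d} ∫_{[-π,π]^d} |h(k)| dk`. -/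
def norm1 {d : ℕ} (h : Momentum d → ℝ) : ℝ :=
  ((2 * Real.pi) ^ d)⁻¹ * ∫ k in cube d, |h k|

/-! In the following, a model is a family, indexed by the real parameter `L ≥ 1`, of functions
`D L x`, `f L n k z`, `g L n k z`, `e L n k z` with `x ∈ ℤ^d`, `k ∈ [-π,π]^d` and `z > 0`.
Values at other arguments, and `g L 0`, `e L 0`, play no role. -/

/-- The recursion `f_{n+1} = ∑_{m=1}^{n+1} g_m f_{n+1-m} + e_{n+1}` with `f_0 = 1`. -/
def Recursion (d : ℕ) (f g e : ℝ → ℕ → Momentum d → ℝ → ℝ) : Prop :=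
  ∀ L : ℝ, 1 ≤ L → ∀ k ∈ cube d, ∀ z : ℝ, 0 < z →
    f L 0 k z = 1 ∧
    ∀ n : ℕ, f L (n + 1) k z =
      (∑ m ∈ Finset.Icc 1 (n + 1), g L m k z * f L (n + 1 - m) k z) + e L (n + 1) k z

/-- The regularity in `k` without which the norm `‖D̂² f_n‖_1` and the Laplacians `∇²f_n(0)`,
`∇²g_n(0)` make no sense. -/
def Regularity (d : ℕ) (f g : ℝ → ℕ → Momentum d → ℝ → ℝ) : Prop :=
  ∀ L : ℝ, 1 ≤ L → ∀ n : ℕ, 1 ≤ n → ∀ z : ℝ, 0 < z →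
    AEMeasurable (fun k => f L n k z) (volume.restrict (cube d)) ∧
    TwiceDifferentiableAtZero (fun k => f L n k z) ∧
    TwiceDifferentiableAtZero (fun k => g L n k z)

/-- Assumption S: lattice symmetry, and local boundedness of each `f_n` near `z = 1`. -/
def AssumptionS (d : ℕ) (f g e : ℝ → ℕ → Momentum d → ℝ → ℝ) : Prop :=
  ∀ L : ℝ, 1 ≤ L → ∀ n : ℕ, 1 ≤ n →
    (∀ z : ℝ, 0 < z →
      LatticeSymmetric (fun k => f L n k z) ∧
      LatticeSymmetric (fun k => g L n k z) ∧
      LatticeSymmetric (fun k => e L n k z)) ∧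
    ∃ r : ℝ, 0 < r ∧ ∃ M : ℝ, ∀ z : ℝ, 0 < z → |z - 1| < r →
      ∀ k ∈ cube d, |f L n k z| ≤ M

/-- Assumption D on the underlying random walk step distribution `D_L`. -/
structure AssumptionD (d : ℕ) (ε : ℝ) (D : ℝ → (Fin d → ℤ) → ℝ)
    (f e : ℝ → ℕ → Momentum d → ℝ → ℝ) : Prop where
  nonneg : ∀ L : ℝ, 1 ≤ L → ∀ x, 0 ≤ D L x
  f_one : ∀ L : ℝ, 1 ≤ L → ∀ k ∈ cube d, ∀ z : ℝ, 0 < z →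
    (f L 1 k z : ℂ) = (z : ℂ) * fourier (D L) k
  e_one : ∀ L : ℝ, 1 ≤ L → ∀ k ∈ cube d, ∀ z : ℝ, 0 < z → e L 1 k z = 0
  normalised : ∀ L : ℝ, 1 ≤ L → fourier (D L) 0 = 1
  moments : ∀ L : ℝ, 1 ≤ L → Summable (fun x => latticeNorm x ^ (2 + 2 * ε) * D L x)
  spread : ∃ C : ℝ, ∀ L : ℝ, 1 ≤ L →
    (∀ x, D L x ≤ C * (L ^ d)⁻¹) ∧ sigmaSq (D L) ≤ C * L ^ 2
  fourier_bounds : ∃ η c₁ c₂ : ℝ, 0 < η ∧ 0 < c₁ ∧ 0 < c₂ ∧ ∀ L : ℝ, 1 ≤ L →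
    (∀ k : Momentum d, supNorm k ≤ L⁻¹ →
      c₁ * L ^ 2 * ‖k‖ ^ 2 ≤ a (D L) k ∧ a (D L) k ≤ c₂ * L ^ 2 * ‖k‖ ^ 2) ∧
    (∀ k ∈ cube d, L⁻¹ ≤ supNorm k → η < a (D L) k) ∧
    (∀ k ∈ cube d, a (D L) k < 2 - η)

/-- The bounds on `h = f_m(·; z)` that enter Assumptions E and G:
`‖D̂² h‖_1 ≤ K β m^{-d/2}`, `|h(0)| ≤ K`, `|∇²h(0)| ≤ K σ² m`. -/
def FBounds (d : ℕ) (L K : ℝ) (D : (Fin d → ℤ) → ℝ) (m : ℕ) (h : Momentum d → ℝ) : Prop :=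
  IntegrableOn (fun k => Dhat D k ^ 2 * h k) (cube d) ∧
  norm1 (fun k => Dhat D k ^ 2 * h k) ≤ K * beta d L * (m : ℝ) ^ (-(d : ℝ) / 2) ∧
  |h 0| ≤ K ∧
  |lap0 h| ≤ K * sigmaSq D * m

/-- Assumption E. The constants depend on `K` alone, not on `L`, `n` or the interval. -/
def AssumptionE (d : ℕ) (D : ℝ → (Fin d → ℤ) → ℝ)
    (f e : ℝ → ℕ → Momentum d → ℝ → ℝ) : Prop :=
  ∀ K : ℝ, 1 < K → ∃ α : ℝ, 0 < α ∧ α < 1 ∧ ∃ Ce L₀ : ℝ, 0 < L₀ ∧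
    ∀ L : ℝ, 1 ≤ L → L₀ ≤ L →
    ∀ s t : ℝ, s < t → Set.Icc s t ⊆ Set.Icc (1 - α) (1 + α) →
    ∀ n : ℕ,
    (∀ z ∈ Set.Icc s t, ∀ m : ℕ, 1 ≤ m → m ≤ n → FBounds d L K (D L) m (fun k => f L m k z)) →
    ∀ z ∈ Set.Icc s t, ∀ k ∈ cube d, ∀ m : ℕ, 2 ≤ m → m ≤ n + 1 →
      |e L m k z| ≤ Ce * beta d L * (m : ℝ) ^ (-(d : ℝ) / 2) ∧
      |e L m k z - e L m 0 z| ≤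
        Ce * a (D L) k * beta d L * (m : ℝ) ^ (-((d : ℝ) - 2) / 2)

/-- Assumption G. The constants depend on `K` alone, not on `L`, `n` or the interval; the bound on
`∂_z g_m(0; z)` includes the existence of this derivative. -/
def AssumptionG (d : ℕ) (ε : ℝ) (D : ℝ → (Fin d → ℤ) → ℝ)
    (f g : ℝ → ℕ → Momentum d → ℝ → ℝ) : Prop :=
  ∀ K : ℝ, 1 < K → ∃ α : ℝ, 0 < α ∧ α < 1 ∧ ∃ Cg L₀ : ℝ, 0 < L₀ ∧
    ∀ L : ℝ, 1 ≤ L → L₀ ≤ L →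
    ∀ s t : ℝ, s < t → Set.Icc s t ⊆ Set.Icc (1 - α) (1 + α) →
    ∀ n : ℕ,
    (∀ z ∈ Set.Icc s t, ∀ m : ℕ, 1 ≤ m → m ≤ n → FBounds d L K (D L) m (fun k => f L m k z)) →
    ∀ z ∈ Set.Icc s t, ∀ k ∈ cube d, ∀ m : ℕ, 2 ≤ m → m ≤ n + 1 →
      |g L m k z| ≤ Cg * beta d L * (m : ℝ) ^ (-(d : ℝ) / 2) ∧
      |lap0 (fun q => g L m q z)| ≤
        Cg * sigmaSq (D L) * beta d L * (m : ℝ) ^ (-((d : ℝ) - 2) / 2) ∧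
      DifferentiableAt ℝ (fun w => g L m 0 w) z ∧
      |deriv (fun w => g L m 0 w) z| ≤
        Cg * beta d L * (m : ℝ) ^ (-((d : ℝ) - 2) / 2) ∧
      ∀ ε' : ℝ, 0 ≤ ε' → ε' ≤ ε →
        |g L m k z - g L m 0 z
            - a (D L) k * (sigmaSq (D L))⁻¹ * lap0 (fun q => g L m q z)| ≤
          Cg * beta d L * a (D L) k ^ (1 + ε') * (m : ℝ) ^ (-((d : ℝ) - 2 - 2 * ε') / 2)

/-- The Gaussian asymptotics (a) at `z = zc`, with amplitude `A` and diffusion constant `v σ²`,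
uniformly for `k/√(vσ²n) ∈ [-π,π]^d` with `a(k/√(vσ²n)) ≤ γ n⁻¹ log n`. -/
def GaussianAsymptotics (d : ℕ) (δ γ : ℝ) (D : (Fin d → ℤ) → ℝ)
    (f : ℕ → Momentum d → ℝ → ℝ) (zc A v : ℝ) : Prop :=
  ∃ C : ℝ, ∀ n : ℕ, 1 ≤ n → ∀ k q : Momentum d,
    q = (Real.sqrt (v * sigmaSq D * n))⁻¹ • k → q ∈ cube d →
    a D q ≤ γ * (n : ℝ)⁻¹ * Real.log n →
    |f n q zc - A * Real.exp (-‖k‖ ^ 2 / (2 * d))| ≤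
      A * Real.exp (-‖k‖ ^ 2 / (2 * d)) *
        (C * ‖k‖ ^ 2 * (n : ℝ) ^ (-δ) + C * (n : ℝ) ^ (-((d : ℝ) - 4) / 2))

/-- The diffusive behaviour (b): `-∇²f_n(0;zc) / f_n(0;zc) = v σ² n [1 + O(β n^{-δ})]`,
with constant `C` in the error term. -/
def DiffusiveBehaviour (d : ℕ) (δ L C : ℝ) (D : (Fin d → ℤ) → ℝ)
    (f : ℕ → Momentum d → ℝ → ℝ) (zc v : ℝ) : Prop :=
  ∀ n : ℕ, 1 ≤ n → f n 0 zc ≠ 0 ∧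
    |-(lap0 (fun k => f n k zc)) / f n 0 zc - v * sigmaSq D * n| ≤
      v * sigmaSq D * n * (C * beta d L * (n : ℝ) ^ (-δ))

/-- The bound (c): `‖D̂² f_n(·;zc)‖_1 ≤ C β n^{-d/2}`. -/
def L1Decay (d : ℕ) (L C : ℝ) (D : (Fin d → ℤ) → ℝ)
    (f : ℕ → Momentum d → ℝ → ℝ) (zc : ℝ) : Prop :=
  ∀ n : ℕ, 1 ≤ n →
    IntegrableOn (fun k => Dhat D k ^ 2 * f n k zc) (cube d) ∧
    norm1 (fun k => Dhat D k ^ 2 * f n k zc) ≤ C * beta d L * (n : ℝ) ^ (-(d : ℝ) / 2)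

end LaceExpansion

end

/-! At fixed k the recursion is the identity (1 - G)F = 1 + E of generating series. Since f_1 = zD̂
and e_1 = 0, also g_1 = zD̂, whereas g_m and e_m with m ≥ 2 are of order β and decay like m^{-d/2}
with d/2 > 2. The model is thus a small perturbation of a random walk. Smallness survives products
and inversion of series because the weights χ in use satisfy χ * χ ≤ Cχ.

At k = 0 and at criticality, write 1 - G = (1 - X)T. The coefficients of T are the tails of g, so T
= 1 + O(β), and U = (1 + E)/T has summable coefficients. The f_n(0) are the partial sums of U, hence
converge to A = U(1) = (1 + Σ e_m)/T(1), where T(1) = Σ m g_m (`renewal_asymptotics`). The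
Laplacians satisfy the twice differentiated recursion, and are double partial sums of a series of
the same kind; this yields v (`MomentSeq.asymptotics`).

For k ≠ 0 the kernel has mass ρ with 1 - ρ comparable to a(k). Perturbing around 1/(1 - ρX) gives
|f_n(k)| ≤ C(1 + a n)^{-d} + C b a^{-2} n^{-d/2} with b of order β (`renewal_decay`,
`exists_decay`). After integration against D̂², the first term scales to L^{-d} n^{-d/2}, the
singularity a^{-2} is integrable because d > 4, and Parseval supplies β away from the origin
(`exists_norm1_bound`).

These estimates reproduce the hypotheses of Assumptions E and G with a K that does not depend on C_e
and C_g, once b is small (`exists_fBounds`). The induction therefore closes if K is fixed first,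
then C_e and C_g, then L large. The critical point is the limit of nested intervals
(`exists_critical`): at stage n the partial sum of g_m(0) stays within B psi q n of 1, and one
further coefficient moves it by no more than the amount by which that window shrinks.

The Gaussian asymptotics come from exponential tilting. When a = a(k) ≤ (κ/5) log N / N, there is x
close to va for which the truncated kernel g_m(k) e^{xm} has total mass exactly 1. Then f_N(k)
e^{xN} is a term of a critical sequence, whose amplitude is close to A, so f_N(k) is close to A
e^{-vaN} (`exists_tilt`, `tilted_renewal`, `local_asymptotics`). The moment condition on D finally
replaces a(k) by σ²|k|²/2d (`Walk.exists_exponent_bound`). -/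

noncomputable section
namespace LaceExpansion

open PowerSeries (coeff constantCoeff)

/-! ### Convolution weights -/

/-- A weight `χ` on `ℕ` with `χ * χ ≤ C χ`. -/
structure ConvWeight (χ : ℕ → ℝ) (C : ℝ) : Prop where
  nonneg : ∀ n, 0 ≤ χ n
  conv : ∀ n, ∑ p ∈ Finset.HasAntidiagonal.antidiagonal n, χ p.1 * χ p.2 ≤ C * χ n

/-- The coefficients of `u` up to order `N` are bounded by `θ χ`. -/
def Bd (N : ℕ) (χ : ℕ → ℝ) (θ : ℝ) (u : PowerSeries ℝ) : Prop :=
  ∀ n ≤ N, |coeff n u| ≤ θ * χ n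

/-- In each product χ(i)χ(n - i) one index is at least n/2, so its factor is at most Cd χ(n); the
other factor is summed, which costs S. The factor 2 accounts for which index is large. -/
theorem ConvWeight.of_doubling {χ : ℕ → ℝ} {Cd S : ℝ} (h0 : ∀ n, 0 ≤ χ n) (hCd : 0 ≤ Cd)
    (hd : ∀ m n, m ≤ n → n ≤ 2 * m → χ m ≤ Cd * χ n)
    (hS : ∀ n, ∑ i ∈ Finset.range n, χ i ≤ S) : ConvWeight χ (2 * Cd * S) := by
  refine ⟨h0, fun n => ?_⟩
  have h1 : ∀ p ∈ Finset.HasAntidiagonal.antidiagonal n, χ p.1 * χ p.2 ≤ Cd * χ n * (χ p.1 + χ p.2) := by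
    intro p hp
    rw [Finset.HasAntidiagonal.mem_antidiagonal] at hp
    have e1 := h0 p.1
    have e2 := h0 p.2
    have e3 := h0 n
    rcases le_total p.1 p.2 with h | h
    · have := hd p.2 n (by omega) (by omega)
      nlinarith [mul_le_mul_of_nonneg_left this e1, mul_nonneg (mul_nonneg hCd e3) e2]
    · have := hd p.1 n (by omega) (by omega)
      nlinarith [mul_le_mul_of_nonneg_left this e2, mul_nonneg (mul_nonneg hCd e3) e1]
  have h2 : ∑ p ∈ Finset.HasAntidiagonal.antidiagonal n, χ p.1 = ∑ i ∈ Finset.range (n + 1), χ i :=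
    Finset.Nat.sum_antidiagonal_eq_sum_range_succ (fun i _ => χ i) n
  have h3 : ∑ p ∈ Finset.HasAntidiagonal.antidiagonal n, χ p.2 = ∑ i ∈ Finset.range (n + 1), χ i := by
    rw [← h2, ← Finset.Nat.sum_antidiagonal_swap]
    simp
  calc _ ≤ ∑ p ∈ Finset.HasAntidiagonal.antidiagonal n, Cd * χ n * (χ p.1 + χ p.2) := Finset.sum_le_sum h1
    _ = Cd * χ n * (2 * ∑ i ∈ Finset.range (n + 1), χ i) := by
        rw [← Finset.mul_sum, Finset.sum_add_distrib, h2, h3]; ring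
    _ ≤ Cd * χ n * (2 * S) := by
        have := hS (n + 1)
        have := mul_nonneg hCd (h0 n)
        gcongr
    _ = 2 * Cd * S * χ n := by ring

namespace Bd

variable {N : ℕ} {χ : ℕ → ℝ} {θ θ' C : ℝ} {u v : PowerSeries ℝ}

theorem mono_const (hu : Bd N χ θ u) (h0 : ∀ n, 0 ≤ χ n) (h : θ ≤ θ') : Bd N χ θ' u :=
  fun n hn => (hu n hn).trans (mul_le_mul_of_nonneg_right h (h0 n))

theorem add (hu : Bd N χ θ u) (hv : Bd N χ θ' v) : Bd N χ (θ + θ') (u + v) := by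
  intro n hn
  rw [map_add, add_mul]
  exact (abs_add_le _ _).trans (add_le_add (hu n hn) (hv n hn))

theorem neg (hu : Bd N χ θ u) : Bd N χ θ (-u) := by
  intro n hn
  rw [map_neg, abs_neg]
  exact hu n hn

theorem sub (hu : Bd N χ θ u) (hv : Bd N χ θ' v) : Bd N χ (θ + θ') (u - v) := by
  rw [sub_eq_add_neg]
  exact hu.add hv.neg

theorem mul (hχ : ConvWeight χ C) (hθ : 0 ≤ θ) (hθ' : 0 ≤ θ') (hu : Bd N χ θ u)
    (hv : Bd N χ θ' v) : Bd N χ (C * θ * θ') (u * v) := by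
  intro n hn
  rw [PowerSeries.coeff_mul]
  calc _ ≤ ∑ p ∈ Finset.HasAntidiagonal.antidiagonal n, |coeff p.1 u * coeff p.2 v| :=
        Finset.abs_sum_le_sum_abs _ _
    _ ≤ ∑ p ∈ Finset.HasAntidiagonal.antidiagonal n, θ * θ' * (χ p.1 * χ p.2) := by
        refine Finset.sum_le_sum fun p hp => ?_
        rw [Finset.HasAntidiagonal.mem_antidiagonal] at hp
        rw [abs_mul]
        have e1 := hu p.1 (by omega)
        have e2 := hv p.2 (by omega)
        calc _ ≤ (θ * χ p.1) * (θ' * χ p.2) :=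
              mul_le_mul e1 e2 (abs_nonneg _) (mul_nonneg hθ (hχ.nonneg _))
          _ = _ := by ring
    _ ≤ θ * θ' * (C * χ n) := by
        rw [← Finset.mul_sum]
        exact mul_le_mul_of_nonneg_left (hχ.conv n) (mul_nonneg hθ hθ')
    _ = _ := by ring

/-- Inverting `1 + Y` for small `Y`. -/
theorem inv_one_add {Y U : PowerSeries ℝ} (hχ : ConvWeight χ C) (hθ : 0 ≤ θ)
    (hsmall : 2 * C * θ ≤ 1) (hY : Bd N χ θ Y) (hY0 : constantCoeff Y = 0)
    (hU : (1 + Y) * U = 1) : Bd N χ (2 * θ) (U - 1) := by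
  intro n
  induction n using Nat.strong_induction_on with
  | _ n ih =>
    intro hn
    -- A fixed-point equation. Since Y has no constant term, coefficient n of Y(U - 1) involves only
    -- earlier coefficients of U - 1, so strong induction applies.
    have e : U - 1 = -Y - Y * (U - 1) := by linear_combination hU
    rw [e, map_sub, map_neg, PowerSeries.coeff_mul]
    have h1 : |∑ p ∈ Finset.HasAntidiagonal.antidiagonal n, coeff p.1 Y * coeff p.2 (U - 1)|
        ≤ ∑ p ∈ Finset.HasAntidiagonal.antidiagonal n, θ * (2 * θ) * (χ p.1 * χ p.2) := by
      refine (Finset.abs_sum_le_sum_abs _ _).trans (Finset.sum_le_sum fun p hp => ?_)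
      rw [Finset.HasAntidiagonal.mem_antidiagonal] at hp
      rcases Nat.eq_zero_or_pos p.1 with h | h
      · rw [h, PowerSeries.coeff_zero_eq_constantCoeff_apply, hY0, zero_mul, abs_zero]
        have := hχ.nonneg 0
        have := hχ.nonneg p.2
        positivity
      · rw [abs_mul]
        calc _ ≤ (θ * χ p.1) * (2 * θ * χ p.2) :=
              mul_le_mul (hY p.1 (by omega)) (ih p.2 (by omega) (by omega)) (abs_nonneg _)
                (mul_nonneg hθ (hχ.nonneg _))
          _ = _ := by ring
    rw [← Finset.mul_sum] at h1
    have h2 := mul_le_mul_of_nonneg_left (hχ.conv n) (by positivity : 0 ≤ θ * (2 * θ))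
    have h3 := hY n hn
    have h4 : θ * (2 * θ) * (C * χ n) ≤ θ * χ n := by
      have := mul_le_mul_of_nonneg_right hsmall (mul_nonneg hθ (hχ.nonneg n))
      linarith
    rw [sub_eq_add_neg]
    refine (abs_add_le _ _).trans ?_
    rw [abs_neg, abs_neg]
    linarith

end Bd

/-! ### Polynomial weights -/

/-- The weight `(n+1)^{-r}`. -/
def psi (r : ℝ) (n : ℕ) : ℝ := ((n : ℝ) + 1) ^ (-r)

theorem psi_pos (r : ℝ) (n : ℕ) : 0 < psi r n := Real.rpow_pos_of_pos (by positivity) _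

theorem psi_nonneg (r : ℝ) (n : ℕ) : 0 ≤ psi r n := (psi_pos r n).le

theorem psi_le_one {r : ℝ} (hr : 0 ≤ r) (n : ℕ) : psi r n ≤ 1 :=
  Real.rpow_le_one_of_one_le_of_nonpos (by linarith [n.cast_nonneg (α := ℝ)]) (by linarith)

theorem psi_zero (r : ℝ) : psi r 0 = 1 := by simp [psi]

theorem psi_anti_exp {r s : ℝ} (h : r ≤ s) (n : ℕ) : psi s n ≤ psi r n :=
  Real.rpow_le_rpow_of_exponent_le (by linarith [n.cast_nonneg (α := ℝ)]) (by linarith)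

theorem psi_antitone {r : ℝ} (hr : 0 ≤ r) {m n : ℕ} (h : m ≤ n) : psi r n ≤ psi r m := by
  have : (m : ℝ) ≤ n := by exact_mod_cast h
  exact Real.rpow_le_rpow_of_nonpos (by positivity) (by linarith) (by linarith)

/-- The hypothesis amounts to n + 1 ≤ 2(m + 1), which covers m = n/2 with integer division. -/
theorem psi_doubling {r : ℝ} (hr : 0 ≤ r) {m n : ℕ} (h : n ≤ 2 * m + 1) :
    psi r m ≤ 2 ^ r * psi r n := by
  have h' : (n : ℝ) ≤ 2 * m + 1 := by exact_mod_cast h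
  have e : psi r m = 2 ^ r * (2 * ((m : ℝ) + 1)) ^ (-r) := by
    rw [Real.mul_rpow (by norm_num) (by positivity), psi, Real.rpow_neg (by norm_num : (0:ℝ) ≤ 2)]
    field_simp
  rw [e]
  refine mul_le_mul_of_nonneg_left ?_ (by positivity)
  exact Real.rpow_le_rpow_of_nonpos (by positivity) (by linarith) (by linarith)

theorem psi_mul (r s : ℝ) (n : ℕ) : psi r n * psi s n = psi (r + s) n := by
  rw [psi, psi, psi, ← Real.rpow_add (by positivity)]; congr 1; ring

theorem succ_mul_psi (r : ℝ) (n : ℕ) : ((n : ℝ) + 1) * psi r n = psi (r - 1) n := by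
  have : ((n : ℝ) + 1) = psi (-1) n := by simp [psi]
  rw [this, psi_mul]; congr 1; ring

theorem summable_psi {r : ℝ} (hr : 1 < r) : Summable (psi r) := by
  have := (summable_nat_add_iff 1).2 (Real.summable_nat_rpow.2 (by linarith : -r < -1))
  refine this.congr fun n => ?_
  simp [psi]

/-- The total mass of `psi r`. -/
def psiSum (r : ℝ) : ℝ := ∑' n, psi r n

theorem psiSum_nonneg (r : ℝ) : 0 ≤ psiSum r := tsum_nonneg (psi_nonneg r)

theorem sum_psi_le {r : ℝ} (hr : 1 < r) (s : Finset ℕ) : ∑ i ∈ s, psi r i ≤ psiSum r :=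
  (summable_psi hr).sum_le_tsum s fun i _ => psi_nonneg r i

theorem convWeight_psi {r : ℝ} (hr : 1 < r) : ConvWeight (psi r) (2 * 2 ^ r * psiSum r) :=
  ConvWeight.of_doubling (psi_nonneg r) (by positivity)
    (fun _ _ _ h => psi_doubling (by linarith) (by omega)) fun _ => sum_psi_le hr _

/-- Telescoping bound behind the tail estimates for `psi`. -/
theorem psi_le_telescope {s : ℝ} (hs : 0 < s) (n : ℕ) :
    psi (s + 1) (n + 1) ≤ s⁻¹ * (psi s n - psi s (n + 1)) := by
  have h : s * psi (s + 1) (n + 1) ≤ psi s n - psi s (n + 1) := by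
    -- Mean value theorem for x^{-s} on [n+1, n+2]; the derivative is smallest in size at the right
    -- end.
    obtain ⟨c, hc, hc'⟩ := exists_deriv_eq_slope (fun x : ℝ => x ^ (-s))
      (show ((n : ℝ) + 1) < (n : ℝ) + 2 by linarith)
      (ContinuousOn.rpow_const continuousOn_id fun x hx => Or.inl (by
        have : 0 < x := by have := hx.1; have := n.cast_nonneg (α := ℝ); linarith
        exact this.ne'))
      (fun x hx => by
        have : 0 < x := by have := hx.1; have := n.cast_nonneg (α := ℝ); linarith
        exact (Real.differentiableAt_rpow_const_of_ne _ this.ne').differentiableWithinAt)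
    have hc0 : 0 < c := by have := hc.1; have := n.cast_nonneg (α := ℝ); linarith
    rw [Real.deriv_rpow_const] at hc'
    have e1 : psi s n - psi s (n + 1) = s * c ^ (-s - 1) := by
      rw [psi, psi]
      push_cast
      have : (n : ℝ) + 1 + 1 = n + 2 := by ring
      rw [this]
      have e : (n : ℝ) + 2 - (n + 1) = 1 := by ring
      simp only [e, div_one] at hc'
      linarith
    rw [e1]
    refine mul_le_mul_of_nonneg_left ?_ hs.le
    rw [psi]
    push_cast
    rw [show -(s + 1) = -s - 1 by ring]
    exact Real.rpow_le_rpow_of_nonpos hc0 (by linarith [hc.2]) (by linarith)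
  rw [inv_mul_eq_div, le_div_iff₀ hs]
  linarith

theorem sum_Ioc_psi_le {s : ℝ} (hs : 0 < s) (n N : ℕ) :
    ∑ i ∈ Finset.Ioc n N, psi (s + 1) i ≤ s⁻¹ * psi s n := by
  rcases le_total N n with h | h
  · rw [Finset.Ioc_eq_empty_of_le h, Finset.sum_empty]
    have := psi_nonneg s n
    positivity
  · suffices ∑ i ∈ Finset.Ioc n N, psi (s + 1) i ≤ s⁻¹ * (psi s n - psi s N) by
      refine this.trans (mul_le_mul_of_nonneg_left ?_ (by positivity))
      linarith [psi_nonneg s N]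
    induction N, h using Nat.le_induction with
    | base => simp
    | succ N hN ih =>
      rw [← Finset.insert_Ioc_right_eq_Ioc_add_one hN, Finset.sum_insert (by simp)]
      have := psi_le_telescope hs N
      have e : s⁻¹ * (psi s n - psi s (N + 1)) = s⁻¹ * (psi s N - psi s (N + 1)) +
        s⁻¹ * (psi s n - psi s N) := by ring
      rw [e]
      exact add_le_add this ih

/-- The tail of a sequence dominated by `psi (s+1)`. -/
theorem abs_tsum_sub_sum_le {s B : ℝ} (hs : 0 < s) {u : ℕ → ℝ} {n : ℕ}
    (hu : ∀ i, n < i → |u i| ≤ B * psi (s + 1) i) (hsum : Summable u) :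
    |∑' i, u i - ∑ i ∈ Finset.range (n + 1), u i| ≤ B * s⁻¹ * psi s n := by
  have h1 : Tendsto (fun N => ∑ i ∈ Finset.range (N + 1), u i) atTop (𝓝 (∑' i, u i)) :=
    (tendsto_add_atTop_iff_nat 1).2 hsum.hasSum.tendsto_sum_nat
  have h2 := (h1.sub_const (∑ i ∈ Finset.range (n + 1), u i)).abs
  -- The sign of B is implicit in the bound at index n + 1.
  have hB : 0 ≤ B := by
    have h := (abs_nonneg _).trans (hu (n + 1) (by omega))
    exact nonneg_of_mul_nonneg_left h (psi_pos _ _)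
  refine le_of_tendsto h2 ?_
  filter_upwards [eventually_ge_atTop n] with N hN
  have e : ∑ i ∈ Finset.range (N + 1), u i - ∑ i ∈ Finset.range (n + 1), u i
      = ∑ i ∈ Finset.Ioc n N, u i := by
    rw [← Finset.sum_Ico_eq_sub _ (by omega)]
    congr 1
    ext i
    simp only [Finset.mem_Ico, Finset.mem_Ioc]
    omega
  rw [e]
  calc _ ≤ ∑ i ∈ Finset.Ioc n N, |u i| := Finset.abs_sum_le_sum_abs _ _
    _ ≤ ∑ i ∈ Finset.Ioc n N, B * psi (s + 1) i :=
        Finset.sum_le_sum fun i hi => hu i (Finset.mem_Ioc.1 hi).1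
    _ ≤ B * (s⁻¹ * psi s n) := by
        rw [← Finset.mul_sum]
        exact mul_le_mul_of_nonneg_left (sum_Ioc_psi_le hs n N) hB
    _ = _ := by ring

theorem summable_of_le_psi {r B : ℝ} (hr : 1 < r) {u : ℕ → ℝ} (hu : ∀ i, |u i| ≤ B * psi r i) :
    Summable u :=
  Summable.of_norm_bounded ((summable_psi hr).mul_left B) hu

theorem abs_tsum_le_psiSum {r B : ℝ} (hr : 1 < r) {u : ℕ → ℝ} (hu : ∀ i, |u i| ≤ B * psi r i) :
    |∑' i, u i| ≤ B * psiSum r := by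
  rw [psiSum, ← tsum_mul_left, ← Real.norm_eq_abs]
  exact tsum_of_norm_bounded ((summable_psi hr).mul_left B).hasSum hu

/-! ### Evaluation of power series at `1` -/

/-- The sum of the coefficients of a power series. -/
def evalOne (u : PowerSeries ℝ) : ℝ := ∑' n, coeff n u

/-- The coefficients of `u` are absolutely summable. -/
def AbsSummable (u : PowerSeries ℝ) : Prop := Summable fun n => coeff n u

theorem evalOne_mul {u v : PowerSeries ℝ} (hu : AbsSummable u) (hv : AbsSummable v) :
    evalOne (u * v) = evalOne u * evalOne v := by
  have hu' : Summable fun n => ‖coeff n u‖ := summable_norm_iff.2 hu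
  have hv' : Summable fun n => ‖coeff n v‖ := summable_norm_iff.2 hv
  rw [evalOne, evalOne, evalOne, tsum_mul_tsum_eq_tsum_sum_antidiagonal_of_summable_norm hu' hv']
  simp only [PowerSeries.coeff_mul]

theorem AbsSummable.mul {u v : PowerSeries ℝ} (hu : AbsSummable u) (hv : AbsSummable v) :
    AbsSummable (u * v) := by
  have hu' : Summable fun n => ‖coeff n u‖ := summable_norm_iff.2 hu
  have hv' : Summable fun n => ‖coeff n v‖ := summable_norm_iff.2 hv
  have := summable_norm_sum_mul_antidiagonal_of_summable_norm hu' hv'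
  refine this.of_norm.congr fun n => ?_
  rw [PowerSeries.coeff_mul]

theorem AbsSummable.add {u v : PowerSeries ℝ} (hu : AbsSummable u) (hv : AbsSummable v) :
    AbsSummable (u + v) :=
  (Summable.add hu hv).congr fun n => (map_add (coeff n) u v).symm

theorem AbsSummable.sub {u v : PowerSeries ℝ} (hu : AbsSummable u) (hv : AbsSummable v) :
    AbsSummable (u - v) :=
  (Summable.sub hu hv).congr fun n => (map_sub (coeff n) u v).symm

theorem evalOne_add {u v : PowerSeries ℝ} (hu : AbsSummable u) (hv : AbsSummable v) :
    evalOne (u + v) = evalOne u + evalOne v := by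
  simp only [evalOne, map_add]
  exact Summable.tsum_add hu hv

theorem evalOne_sub {u v : PowerSeries ℝ} (hu : AbsSummable u) (hv : AbsSummable v) :
    evalOne (u - v) = evalOne u - evalOne v := by
  simp only [evalOne, map_sub]
  exact Summable.tsum_sub hu hv

theorem absSummable_one : AbsSummable 1 :=
  summable_of_ne_finset_zero (s := {0}) fun n hn => by
    rw [PowerSeries.coeff_one, if_neg (by simpa using hn)]

theorem evalOne_one : evalOne 1 = 1 := by
  rw [evalOne, tsum_eq_single 0 fun n hn => by rw [PowerSeries.coeff_one, if_neg hn]]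
  simp

theorem absSummable_X : AbsSummable PowerSeries.X :=
  summable_of_ne_finset_zero (s := {1}) fun n hn => by
    rw [PowerSeries.coeff_X, if_neg (by simpa using hn)]

theorem evalOne_X : evalOne PowerSeries.X = 1 := by
  rw [evalOne, tsum_eq_single 1 fun n hn => by rw [PowerSeries.coeff_X, if_neg hn]]
  simp

theorem AbsSummable.of_bd {r θ : ℝ} (hr : 1 < r) {u : PowerSeries ℝ}
    (h : ∀ N, Bd N (psi r) θ u) : AbsSummable u :=
  summable_of_le_psi hr fun i => h i i le_rfl

/-- The geometric series `∑ X^n`. -/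
def geom : PowerSeries ℝ := PowerSeries.mk 1

theorem one_sub_X_mul_geom : (1 - PowerSeries.X) * geom = 1 := by
  rw [mul_comm]; exact PowerSeries.mk_one_mul_one_sub_eq_one ℝ

theorem coeff_geom_mul (u : PowerSeries ℝ) (n : ℕ) :
    coeff n (geom * u) = ∑ j ∈ Finset.range (n + 1), coeff j u := by
  rw [mul_comm, PowerSeries.coeff_mul,
    Finset.Nat.sum_antidiagonal_eq_sum_range_succ (fun i j => coeff i u * coeff j geom)]
  simp [geom]

end LaceExpansion
end

noncomputable section
namespace LaceExpansion

open PowerSeries (coeff constantCoeff)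

/-! ### Renewal sequences at criticality -/

/-- The convolution recursion `f_{n+1} = ∑_{m=1}^{n+1} g_m f_{n+1-m} + e_{n+1}`, `f_0 = 1`, with the
convention `g_0 = e_0 = 0`. -/
structure RenewalSeq (f g e : ℕ → ℝ) : Prop where
  f_zero : f 0 = 1
  g_zero : g 0 = 0
  e_zero : e 0 = 0
  step : ∀ n, f (n + 1) = (∑ m ∈ Finset.Icc 1 (n + 1), g m * f (n + 1 - m)) + e (n + 1)

theorem coeff_mk_mul_mk_of_zero {g h : ℕ → ℝ} (hg : g 0 = 0) (n : ℕ) :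
    coeff n (PowerSeries.mk g * PowerSeries.mk h) = ∑ m ∈ Finset.Icc 1 n, g m * h (n - m) := by
  rw [PowerSeries.coeff_mul, Finset.Nat.sum_antidiagonal_eq_sum_range_succ
    (fun i j => coeff i (PowerSeries.mk g) * coeff j (PowerSeries.mk h))]
  simp only [PowerSeries.coeff_mk]
  rw [Finset.range_eq_Ico, Finset.sum_eq_sum_Ico_succ_bot (by omega), hg, zero_mul, zero_add]
  rfl

theorem RenewalSeq.series {f g e : ℕ → ℝ} (h : RenewalSeq f g e) :
    (1 - PowerSeries.mk g) * PowerSeries.mk f = 1 + PowerSeries.mk e := by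
  ext n
  rw [sub_mul, one_mul, map_sub, map_add, coeff_mk_mul_mk_of_zero h.g_zero]
  cases n with
  | zero => simp [h.f_zero, h.e_zero]
  | succ n => simp [PowerSeries.coeff_one, h.step n]

/-- The series `(1 - G(X)) / (1 - X)`. -/
def tailSeries (g : ℕ → ℝ) : PowerSeries ℝ := geom * (1 - PowerSeries.mk g)

theorem coeff_tailSeries (g : ℕ → ℝ) (n : ℕ) :
    coeff n (tailSeries g) = 1 - ∑ m ∈ Finset.range (n + 1), g m := by
  rw [tailSeries, coeff_geom_mul]
  simp only [map_sub, PowerSeries.coeff_mk, Finset.sum_sub_distrib, PowerSeries.coeff_one]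
  simp

theorem one_sub_X_mul_tailSeries (g : ℕ → ℝ) :
    (1 - PowerSeries.X) * tailSeries g = 1 - PowerSeries.mk g := by
  rw [tailSeries, ← mul_assoc, one_sub_X_mul_geom, one_mul]

theorem constantCoeff_tailSeries {g : ℕ → ℝ} (hg : g 0 = 0) :
    constantCoeff (tailSeries g) = 1 := by
  rw [← PowerSeries.coeff_zero_eq_constantCoeff_apply, coeff_tailSeries]
  simp [hg]

theorem tailSeries_mul_inv {g : ℕ → ℝ} (hg : g 0 = 0) :
    tailSeries g * (tailSeries g)⁻¹ = 1 :=
  PowerSeries.mul_inv_cancel _ (by rw [constantCoeff_tailSeries hg]; exact one_ne_zero)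

/-- The series `U = (1 + E) (1 - X) / (1 - G)`, whose partial sums are the renewal sequence. -/
def renewalSeries (g e : ℕ → ℝ) : PowerSeries ℝ := (1 + PowerSeries.mk e) * (tailSeries g)⁻¹

/-- Substituting 1 - G = (1 - X)T into (1 - G)F = 1 + E gives F = (1 - X)^{-1}(1 + E)/T. All
singular behaviour sits in the factor (1 - X)^{-1}, that is, in taking partial sums. -/
theorem RenewalSeq.series_eq {f g e : ℕ → ℝ} (h : RenewalSeq f g e) :
    PowerSeries.mk f = geom * renewalSeries g e := by
  have h1 := h.series
  have h2 := tailSeries_mul_inv h.g_zero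
  have h3 := one_sub_X_mul_geom
  rw [← one_sub_X_mul_tailSeries] at h1
  rw [renewalSeries]
  linear_combination geom * (tailSeries g)⁻¹ * h1 - PowerSeries.mk f * h2 -
    PowerSeries.mk f * tailSeries g * (tailSeries g)⁻¹ * h3

theorem RenewalSeq.eq_sum {f g e : ℕ → ℝ} (h : RenewalSeq f g e) (n : ℕ) :
    f n = ∑ j ∈ Finset.range (n + 1), coeff j (renewalSeries g e) := by
  rw [← coeff_geom_mul, ← h.series_eq, PowerSeries.coeff_mk]

/-- The convolution constant of the weight `psi r`. -/
def convC (r : ℝ) : ℝ := 2 * 2 ^ r * psiSum r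

theorem one_le_psiSum {r : ℝ} (hr : 1 < r) : 1 ≤ psiSum r := by
  have := sum_psi_le hr {0}
  simpa [psi_zero] using this

theorem one_le_convC {r : ℝ} (hr : 1 < r) : 1 ≤ convC r := by
  have h1 := one_le_psiSum hr
  have h2 : (1 : ℝ) ≤ 2 ^ r := Real.one_le_rpow (by norm_num) (by linarith)
  rw [convC]
  nlinarith

/-- Smallness of the partial tails of `g` and of `e`, up to order `N`. -/
structure NearCritical (r b : ℝ) (N : ℕ) (g e : ℕ → ℝ) : Prop where
  tail : ∀ j, 1 ≤ j → j ≤ N → |1 - ∑ m ∈ Finset.range (j + 1), g m| ≤ b * psi r j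
  err : ∀ j, 1 ≤ j → j ≤ N → |e j| ≤ b * psi r j

section
variable {r b : ℝ} {N : ℕ} {f g e : ℕ → ℝ}

theorem NearCritical.bd_tail (h : NearCritical r b N g e) (hb : 0 ≤ b) (hg : g 0 = 0) :
    Bd N (psi r) b (tailSeries g - 1) := by
  intro n hn
  rw [map_sub, coeff_tailSeries]
  rcases Nat.eq_zero_or_pos n with h0 | h0
  · subst h0
    simp [hg, psi_zero, hb]
  · rw [PowerSeries.coeff_one, if_neg (by omega), sub_zero]
    exact h.tail n h0 hn

theorem NearCritical.bd_err (h : NearCritical r b N g e) (hb : 0 ≤ b) (he : e 0 = 0) :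
    Bd N (psi r) b (PowerSeries.mk e) := by
  intro n hn
  rw [PowerSeries.coeff_mk]
  rcases Nat.eq_zero_or_pos n with h0 | h0
  · subst h0
    simp [he, psi_zero, hb]
  · exact h.err n h0 hn

/-- An elementary form of Wiener's lemma: T has constant coefficient exactly 1 and its other
coefficients are small in the weight `psi r`, so 1/T - 1 is small in the same weight. -/
theorem NearCritical.bd_inv (h : NearCritical r b N g e) (hr : 1 < r) (hb : 0 ≤ b)
    (hsmall : 2 * convC r * b ≤ 1) (hg : g 0 = 0) :
    Bd N (psi r) (2 * b) ((tailSeries g)⁻¹ - 1) := by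
  refine Bd.inv_one_add (Y := tailSeries g - 1) (convWeight_psi hr) hb hsmall (h.bd_tail hb hg) ?_ ?_
  · rw [map_sub, constantCoeff_tailSeries hg]; simp
  · rw [add_sub_cancel, tailSeries_mul_inv hg]

theorem NearCritical.bd_renewal (h : NearCritical r b N g e) (hr : 1 < r) (hb : 0 ≤ b)
    (hsmall : 2 * convC r * b ≤ 1) (hg : g 0 = 0) (he : e 0 = 0) :
    Bd N (psi r) (4 * b) (renewalSeries g e - 1) := by
  have h1 := h.bd_inv hr hb hsmall hg
  have h2 := h.bd_err hb he
  have h3 := Bd.mul (convWeight_psi hr) hb (by positivity) h2 h1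
  have e1 : renewalSeries g e - 1 = ((tailSeries g)⁻¹ - 1) + PowerSeries.mk e +
      PowerSeries.mk e * ((tailSeries g)⁻¹ - 1) := by
    rw [renewalSeries]; ring
  rw [e1]
  refine ((h1.add h2).add h3).mono_const (psi_nonneg r) ?_
  have : 2 * convC r * b * b ≤ 1 * b := mul_le_mul_of_nonneg_right hsmall hb
  rw [convC] at this
  linarith

/-- f n - 1 is a partial sum of the coefficients of U - 1, which are bounded by 4b psi r; only
orders up to n enter. -/
theorem NearCritical.abs_sub_one_le (h : NearCritical r b N g e) (hr : 1 < r) (hb : 0 ≤ b)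
    (hsmall : 2 * convC r * b ≤ 1) (hf : RenewalSeq f g e) {n : ℕ} (hn : n ≤ N) :
    |f n - 1| ≤ 4 * b * psiSum r := by
  have h1 := h.bd_renewal hr hb hsmall hf.g_zero hf.e_zero
  have e1 : f n - 1 = ∑ j ∈ Finset.range (n + 1), coeff j (renewalSeries g e - 1) := by
    rw [hf.eq_sum]
    simp only [map_sub, Finset.sum_sub_distrib, PowerSeries.coeff_one]
    simp
  rw [e1]
  refine (Finset.abs_sum_le_sum_abs _ _).trans ?_
  calc _ ≤ ∑ j ∈ Finset.range (n + 1), 4 * b * psi r j :=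
        Finset.sum_le_sum fun j hj => h1 j (by rw [Finset.mem_range] at hj; omega)
    _ ≤ _ := by
        rw [← Finset.mul_sum]
        exact mul_le_mul_of_nonneg_left (sum_psi_le hr _) (by positivity)

/-- Abel summation: a finite version of T(1) = Σ m g_m with its boundary term kept. -/
theorem sum_tail_eq (g : ℕ → ℝ) (n : ℕ) :
    ∑ j ∈ Finset.range n, (1 - ∑ m ∈ Finset.range (j + 1), g m) =
      (∑ m ∈ Finset.range (n + 1), (m : ℝ) * g m) + n * (1 - ∑ m ∈ Finset.range (n + 1), g m) := by
  induction n with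
  | zero => simp
  | succ n ih =>
    rw [Finset.sum_range_succ, ih, Finset.sum_range_succ _ (n + 1), Finset.sum_range_succ g (n + 1)]
    push_cast
    ring

/-- `T(1) = ∑ m g_m`. -/
theorem evalOne_tailSeries (hr : 1 < r) (h : ∀ N, NearCritical r b N g e) (hb : 0 ≤ b)
    (hg : g 0 = 0) (hs : Summable fun m : ℕ => (m : ℝ) * g m) :
    AbsSummable (tailSeries g) ∧ evalOne (tailSeries g) = ∑' m : ℕ, (m : ℝ) * g m := by
  have h1 : AbsSummable (tailSeries g - 1) := AbsSummable.of_bd hr fun N => (h N).bd_tail hb hg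
  have h2 : AbsSummable (tailSeries g) := by
    have := h1.add absSummable_one
    rwa [sub_add_cancel] at this
  refine ⟨h2, ?_⟩
  have h3 : Tendsto (fun n : ℕ => ∑ j ∈ Finset.range n, coeff j (tailSeries g)) atTop
      (𝓝 (evalOne (tailSeries g))) := h2.hasSum.tendsto_sum_nat
  -- The boundary term is O(n^{1-r}) by the tail bound, and r > 1.
  have h4 : Tendsto (fun n : ℕ => (n : ℝ) * (1 - ∑ m ∈ Finset.range (n + 1), g m)) atTop
      (𝓝 0) := by
    have h5 : Tendsto (fun n : ℕ => b * psi (r - 1) n) atTop (𝓝 (b * 0)) := by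
      refine Tendsto.const_mul _ ?_
      refine (tendsto_rpow_neg_atTop (by linarith : 0 < r - 1)).comp ?_
      exact tendsto_atTop_add_const_right _ _ tendsto_natCast_atTop_atTop
    rw [mul_zero] at h5
    refine squeeze_zero_norm' ?_ h5
    filter_upwards [eventually_ge_atTop 1] with n hn
    rw [Real.norm_eq_abs, abs_mul, Nat.abs_cast, ← succ_mul_psi]
    have := (h n).tail n hn le_rfl
    calc _ ≤ ((n : ℝ) + 1) * (b * psi r n) :=
          mul_le_mul (by linarith) this (abs_nonneg _) (by positivity)
      _ = _ := by ring
  have h6 : Tendsto (fun n : ℕ => ∑ m ∈ Finset.range (n + 1), (m : ℝ) * g m) atTop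
      (𝓝 (∑' m : ℕ, (m : ℝ) * g m)) :=
    (tendsto_add_atTop_iff_nat 1).2 hs.hasSum.tendsto_sum_nat
  have h7 := h6.add h4
  rw [add_zero] at h7
  refine tendsto_nhds_unique h3 (h7.congr fun n => ?_)
  simp only [coeff_tailSeries]
  rw [sum_tail_eq]

/-- Convergence of a critical renewal sequence. -/
theorem renewal_asymptotics (hr : 1 < r) (h : ∀ N, NearCritical r b N g e) (hb : 0 ≤ b)
    (hsmall : 2 * convC r * b ≤ 1) (hf : RenewalSeq f g e)
    (hs : Summable fun m : ℕ => (m : ℝ) * g m) :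
    ∃ A : ℝ, |A - 1| ≤ 4 * b * psiSum r ∧
      A * (∑' m : ℕ, (m : ℝ) * g m) = 1 + ∑' m, e m ∧
      (∀ n, |f n - A| ≤ 4 * b * (r - 1)⁻¹ * psi (r - 1) n) ∧
      A = evalOne (renewalSeries g e) ∧ AbsSummable (renewalSeries g e) := by
  have h1 : ∀ N, Bd N (psi r) (4 * b) (renewalSeries g e - 1) := fun N =>
    (h N).bd_renewal hr hb hsmall hf.g_zero hf.e_zero
  have h2 : AbsSummable (renewalSeries g e - 1) := AbsSummable.of_bd hr h1
  have h3 : AbsSummable (renewalSeries g e) := by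
    have := h2.add absSummable_one
    rwa [sub_add_cancel] at this
  have h4 : AbsSummable (PowerSeries.mk e) :=
    AbsSummable.of_bd hr fun N => (h N).bd_err hb hf.e_zero
  obtain ⟨h5, h6⟩ := evalOne_tailSeries hr h hb hf.g_zero hs
  -- The limit of the partial sums of U is U(1). The identity for A is UT = 1 + E evaluated at 1,
  -- and the rate is the tail of U.
  refine ⟨evalOne (renewalSeries g e), ?_, ?_, ?_, rfl, h3⟩
  · rw [← evalOne_one, ← evalOne_sub h3 absSummable_one]
    exact abs_tsum_le_psiSum hr fun i => h1 i i le_rfl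
  · rw [← h6, ← evalOne_mul h3 h5, renewalSeries, mul_assoc, mul_comm _ (tailSeries g),
      tailSeries_mul_inv hf.g_zero, mul_one, evalOne_add absSummable_one h4, evalOne_one]
    simp [evalOne]
  · intro n
    rw [hf.eq_sum, abs_sub_comm]
    have := abs_tsum_sub_sum_le (s := r - 1) (B := 4 * b) (n := n) (by linarith)
      (u := fun i => coeff i (renewalSeries g e)) ?_ h3
    · exact this
    · intro i hi
      rw [sub_add_cancel]
      have := h1 i i le_rfl
      rw [map_sub, PowerSeries.coeff_one, if_neg (by omega), sub_zero] at this
      exact this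

/-! ### The second moment -/

/-- The recursion satisfied by the (normalised) second derivatives `l` of a renewal sequence. -/
structure MomentSeq (l γ ε f g : ℕ → ℝ) : Prop where
  l_zero : l 0 = 0
  γ_zero : γ 0 = 0
  ε_zero : ε 0 = 0
  step : ∀ n, l (n + 1) = (∑ m ∈ Finset.Icc 1 (n + 1),
    (γ m * f (n + 1 - m) + g m * l (n + 1 - m))) + ε (n + 1)

/-- The series whose double partial sums are the second moments. -/
def momentSeries (γ ε g e : ℕ → ℝ) : PowerSeries ℝ :=
  (tailSeries g)⁻¹ * (PowerSeries.mk γ * renewalSeries g e +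
    (1 - PowerSeries.X) * PowerSeries.mk ε)

variable {l γ ε : ℕ → ℝ}

/-- The recursion for l reads (1 - G)ℓ = ΓF + Ε. With F = U/(1 - X) and 1 - G = (1 - X)T this
becomes ℓ = (1 - X)^{-2} T^{-1}(ΓU + (1 - X)Ε), hence double partial sums. -/
theorem MomentSeq.series_eq (h : MomentSeq l γ ε f g) (hf : RenewalSeq f g e) :
    PowerSeries.mk l = geom * (geom * momentSeries γ ε g e) := by
  have h1 : (1 - PowerSeries.mk g) * PowerSeries.mk l =
      PowerSeries.mk γ * PowerSeries.mk f + PowerSeries.mk ε := by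
    ext n
    rw [sub_mul, one_mul, map_sub, map_add, coeff_mk_mul_mk_of_zero hf.g_zero,
      coeff_mk_mul_mk_of_zero h.γ_zero]
    cases n with
    | zero => simp [h.l_zero, h.ε_zero]
    | succ n => simp only [PowerSeries.coeff_mk, h.step n, Finset.sum_add_distrib]; ring
  rw [hf.series_eq, ← one_sub_X_mul_tailSeries] at h1
  have h2 := tailSeries_mul_inv hf.g_zero
  have h3 := one_sub_X_mul_geom
  rw [momentSeries]
  linear_combination geom * (tailSeries g)⁻¹ * h1 - PowerSeries.mk l * h2 -
    PowerSeries.mk l * tailSeries g * (tailSeries g)⁻¹ * h3 -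
    geom * (tailSeries g)⁻¹ * PowerSeries.mk ε * h3

/-- The constant in the bounds on second moments. -/
def momentC (r : ℝ) : ℝ := 12 * convC r * 2 ^ r + 8

theorem bd_X (r : ℝ) (N : ℕ) : Bd N (psi r) (2 ^ r) PowerSeries.X := by
  intro n _
  rw [PowerSeries.coeff_X]
  split_ifs with h
  · subst h
    rw [abs_one, psi, Nat.cast_one, one_add_one_eq_two, ← Real.rpow_add (by norm_num)]
    simp
  · rw [abs_zero]
    have := psi_nonneg r n
    positivity

/-- To leading order Γ = -X, U = 1, T = 1 and Ε = 0, so the moment series is -X plus terms each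
containing a small factor. -/
theorem bd_moment (h : NearCritical r b N g e) (hr : 1 < r) (hb : 0 ≤ b)
    (hsmall : 2 * convC r * b ≤ 1) (hg : g 0 = 0) (he : e 0 = 0)
    (hγ : Bd N (psi r) b (PowerSeries.mk γ + PowerSeries.X))
    (hε : Bd N (psi r) b (PowerSeries.mk ε)) :
    Bd N (psi r) (momentC r * b) (momentSeries γ ε g e + PowerSeries.X) := by
  have hc := convWeight_psi hr
  change ConvWeight (psi r) (convC r) at hc
  set c := convC r with hcdef
  set x : ℝ := 2 ^ r with hxdef
  have hx : 0 ≤ x := by positivity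
  have hc1 : 1 ≤ c := one_le_convC hr
  have hw := h.bd_inv hr hb hsmall hg
  have hu := h.bd_renewal hr hb hsmall hg he
  have hX := bd_X r N
  set w := (tailSeries g)⁻¹ - 1 with hwdef
  set u := renewalSeries g e - 1 with hudef
  set γ' := PowerSeries.mk γ + PowerSeries.X with hγ'
  have s1 := Bd.mul hc hx (by positivity) hX hu
  have s2 := Bd.mul hc hb (by positivity) hγ hu
  have s3 := Bd.mul hc hx hb hX hε
  have hS : Bd N (psi r) ((5 * c * x + 4) * b)
      (γ' - PowerSeries.X * u + γ' * u + PowerSeries.mk ε -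
        PowerSeries.X * PowerSeries.mk ε) := by
    refine ((((hγ.sub s1).add s2).add hε).sub s3).mono_const (psi_nonneg r) ?_
    have : 2 * c * b * b ≤ 1 * b := mul_le_mul_of_nonneg_right hsmall hb
    linarith
  set S := γ' - PowerSeries.X * u + γ' * u + PowerSeries.mk ε -
        PowerSeries.X * PowerSeries.mk ε with hSdef
  have s4 := Bd.mul hc (by positivity) hx hw hX
  have s5 := Bd.mul hc (by positivity) (by positivity) hw hS
  -- Here 1/T = 1 + w, and the bracket of `momentSeries` equals -X + S; both w and S are of order b.
  have e1 : momentSeries γ ε g e + PowerSeries.X = S - w * PowerSeries.X + w * S := by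
    rw [momentSeries, hSdef, hwdef, hudef, hγ']; ring
  rw [e1]
  refine ((hS.sub s4).add s5).mono_const (psi_nonneg r) ?_
  rw [momentC]
  have h6 : 2 * c * b * ((5 * c * x + 4) * b) ≤ 1 * ((5 * c * x + 4) * b) :=
    mul_le_mul_of_nonneg_right hsmall (by positivity)
  nlinarith

/-- The double partial sums of -X equal -n, which is the main term of random walk; the remaining
coefficients are small and summable. -/
theorem MomentSeq.eq_sum (h : MomentSeq l γ ε f g) (hf : RenewalSeq f g e) (n : ℕ) :
    l n = -n + ∑ i ∈ Finset.range (n + 1), ∑ j ∈ Finset.range (i + 1),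
      coeff j (momentSeries γ ε g e + PowerSeries.X) := by
  have h1 : l n = ∑ i ∈ Finset.range (n + 1), ∑ j ∈ Finset.range (i + 1),
      coeff j (momentSeries γ ε g e) := by
    have := congrArg (coeff n) (h.series_eq hf)
    rw [PowerSeries.coeff_mk, coeff_geom_mul] at this
    simpa only [coeff_geom_mul] using this
  have h2 : ∑ i ∈ Finset.range (n + 1), ∑ j ∈ Finset.range (i + 1),
      coeff j (PowerSeries.X : PowerSeries ℝ) = n := by
    rw [Finset.sum_range_succ']
    have : ∀ i, ∑ j ∈ Finset.range (i + 1 + 1), coeff j (PowerSeries.X : PowerSeries ℝ) = 1 := by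
      intro i
      simp [PowerSeries.coeff_X]
    simp only [this]
    simp [PowerSeries.coeff_X]
  simp only [map_add, Finset.sum_add_distrib, ← h1, h2]
  ring

theorem MomentSeq.abs_le (h : MomentSeq l γ ε f g) (hf : RenewalSeq f g e)
    (hn : NearCritical r b N g e) (hr : 1 < r) (hb : 0 ≤ b)
    (hsmall : 2 * convC r * b ≤ 1)
    (hγ : Bd N (psi r) b (PowerSeries.mk γ + PowerSeries.X))
    (hε : Bd N (psi r) b (PowerSeries.mk ε)) {n : ℕ} (hnN : n ≤ N) :
    |l n| ≤ n + (n + 1) * (momentC r * b * psiSum r) := by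
  have h1 := bd_moment hn hr hb hsmall hf.g_zero hf.e_zero hγ hε
  have hC : 0 ≤ momentC r * b := by
    have := one_le_convC hr
    rw [momentC]; positivity
  rw [h.eq_sum hf]
  refine (abs_add_le _ _).trans ?_
  rw [abs_neg, Nat.abs_cast]
  gcongr
  refine (Finset.abs_sum_le_sum_abs _ _).trans ?_
  calc _ ≤ ∑ i ∈ Finset.range (n + 1), momentC r * b * psiSum r := by
        refine Finset.sum_le_sum fun i hi => ?_
        rw [Finset.mem_range] at hi
        refine (Finset.abs_sum_le_sum_abs _ _).trans ?_
        calc _ ≤ ∑ j ∈ Finset.range (i + 1), momentC r * b * psi r j :=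
              Finset.sum_le_sum fun j hj => h1 j (by rw [Finset.mem_range] at hj; omega)
          _ ≤ _ := by
              rw [← Finset.mul_sum]
              exact mul_le_mul_of_nonneg_left (sum_psi_le hr _) hC
    _ = _ := by rw [Finset.sum_const, Finset.card_range, nsmul_eq_mul]; push_cast; ring

/-- Since r - 1 may be below 1, the weight `psi (r - 1)` need not be summable. Writing it as
(i+1)^{1-δ} psi (r - δ) i leaves a summable weight at the price of n^{1-δ}. -/
theorem sum_psi_sub_one_le {δ : ℝ} (hδ1 : δ ≤ 1) (hrδ : 1 < r - δ) (n : ℕ) :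
    ∑ i ∈ Finset.range (n + 1), psi (r - 1) i ≤ ((n : ℝ) + 1) ^ (1 - δ) * psiSum (r - δ) := by
  calc _ ≤ ∑ i ∈ Finset.range (n + 1), ((n : ℝ) + 1) ^ (1 - δ) * psi (r - δ) i := by
        refine Finset.sum_le_sum fun i hi => ?_
        have hi' : (i : ℝ) ≤ n := by
          rw [Finset.mem_range] at hi
          exact_mod_cast (by omega : i ≤ n)
        have e1 : psi (r - 1) i = ((i : ℝ) + 1) ^ (1 - δ) * psi (r - δ) i := by
          rw [psi, psi, ← Real.rpow_add (by positivity)]; congr 1; ring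
        rw [e1]
        refine mul_le_mul_of_nonneg_right ?_ (psi_nonneg _ _)
        exact Real.rpow_le_rpow (by positivity) (by linarith) (by linarith)
    _ ≤ _ := by
        rw [← Finset.mul_sum]
        exact mul_le_mul_of_nonneg_left (sum_psi_le hrδ _) (by positivity)

/-- V is the value M(1) of the moment series. Evaluating TM = ΓU + (1 - X)Ε at 1 removes the errors,
since 1 - X vanishes there, and leaves V T(1) = A Σ γ_m. The n^{1-δ} correction is the accumulated
sum of the tails of M + X. -/
theorem MomentSeq.asymptotics {δ : ℝ} (hδ1 : δ ≤ 1) (hrδ : 1 < r - δ)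
    (h : MomentSeq l γ ε f g) (hf : RenewalSeq f g e)
    (hn : ∀ N, NearCritical r b N g e) (hr : 1 < r) (hb : 0 ≤ b)
    (hsmall : 2 * convC r * b ≤ 1)
    (hs : Summable fun m : ℕ => (m : ℝ) * g m)
    (hγ : ∀ N, Bd N (psi r) b (PowerSeries.mk γ + PowerSeries.X))
    (hε : ∀ N, Bd N (psi r) b (PowerSeries.mk ε)) {A : ℝ}
    (hA : A = evalOne (renewalSeries g e)) (hU : AbsSummable (renewalSeries g e)) :
    ∃ V : ℝ, V * (∑' m : ℕ, (m : ℝ) * g m) = A * ∑' m, γ m ∧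
      ∀ n : ℕ, |l n - n * V| ≤ momentC r * b *
        (psiSum r + (r - 1)⁻¹ * (((n : ℝ) + 1) ^ (1 - δ) * psiSum (r - δ))) := by
  set M := momentSeries γ ε g e with hM
  have h1 : ∀ N, Bd N (psi r) (momentC r * b) (M + PowerSeries.X) := fun N =>
    bd_moment (hn N) hr hb hsmall hf.g_zero hf.e_zero (hγ N) (hε N)
  have h2 : AbsSummable (M + PowerSeries.X) := AbsSummable.of_bd hr h1
  have hMs : AbsSummable M := by
    have := h2.sub absSummable_X
    rwa [add_sub_cancel_right] at this
  have hγs : AbsSummable (PowerSeries.mk γ) := by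
    have := (AbsSummable.of_bd hr hγ).sub absSummable_X
    rwa [add_sub_cancel_right] at this
  have hεs : AbsSummable (PowerSeries.mk ε) := AbsSummable.of_bd hr hε
  obtain ⟨hT, hT'⟩ := evalOne_tailSeries hr hn hb hf.g_zero hs
  refine ⟨evalOne M, ?_, fun n => ?_⟩
  · have hX : AbsSummable (1 - PowerSeries.X) := absSummable_one.sub absSummable_X
    rw [← hT', ← evalOne_mul hMs hT, hM, momentSeries]
    have e1 : (tailSeries g)⁻¹ * (PowerSeries.mk γ * renewalSeries g e +
        (1 - PowerSeries.X) * PowerSeries.mk ε) * tailSeries g =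
        PowerSeries.mk γ * renewalSeries g e + (1 - PowerSeries.X) * PowerSeries.mk ε := by
      linear_combination (PowerSeries.mk γ * renewalSeries g e +
        (1 - PowerSeries.X) * PowerSeries.mk ε) * tailSeries_mul_inv hf.g_zero
    rw [e1, evalOne_add (hγs.mul hU) (hX.mul hεs), evalOne_mul hγs hU, evalOne_mul hX hεs,
      evalOne_sub absSummable_one absSummable_X, evalOne_one, evalOne_X, hA]
    simp [evalOne, mul_comm]
  · have hC : 0 ≤ momentC r * b := by
      have := one_le_convC hr
      rw [momentC]; positivity
    set R := evalOne (M + PowerSeries.X) with hR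
    have hR1 : R = evalOne M + 1 := by rw [hR, evalOne_add hMs absSummable_X, evalOne_X]
    have hRle : |R| ≤ momentC r * b * psiSum r := abs_tsum_le_psiSum hr fun i => h1 i i le_rfl
    have h3 : ∀ i, |(∑ j ∈ Finset.range (i + 1), coeff j (M + PowerSeries.X)) - R| ≤
        momentC r * b * (r - 1)⁻¹ * psi (r - 1) i := by
      intro i
      rw [abs_sub_comm]
      refine abs_tsum_sub_sum_le (s := r - 1) (by linarith)
        (u := fun i => coeff i (M + PowerSeries.X)) (fun j _ => ?_) h2
      rw [sub_add_cancel]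
      exact h1 j j le_rfl
    -- The n + 1 inner sums all tend to R = M(1) + 1, and (n + 1)R - n = nM(1) + R.
    have e2 : l n - n * evalOne M = R + ∑ i ∈ Finset.range (n + 1),
        ((∑ j ∈ Finset.range (i + 1), coeff j (M + PowerSeries.X)) - R) := by
      rw [h.eq_sum hf, Finset.sum_sub_distrib, Finset.sum_const, Finset.card_range, nsmul_eq_mul]
      push_cast
      rw [hR1]
      ring
    rw [e2]
    refine (abs_add_le _ _).trans ?_
    rw [mul_add]
    refine add_le_add hRle ?_
    refine (Finset.abs_sum_le_sum_abs _ _).trans ((Finset.sum_le_sum fun i _ => h3 i).trans ?_)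
    rw [← Finset.mul_sum, mul_assoc]
    refine mul_le_mul_of_nonneg_left ?_ hC
    exact mul_le_mul_of_nonneg_left (sum_psi_sub_one_le hδ1 hrδ n)
      (inv_nonneg.2 (by linarith))

end

end LaceExpansion
end

noncomputable section
namespace LaceExpansion

open PowerSeries (coeff constantCoeff)

/-! ### Decay of renewal sequences away from criticality -/

/-- The weight `a (1 + a n)^{-p} + (n+1)^{-q} (1 + a n)^{-1}`. -/
def chi (a : ℝ) (p : ℕ) (q : ℝ) (n : ℕ) : ℝ :=
  a / (1 + a * n) ^ p + psi q n / (1 + a * n)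

section
variable {a q c ρ b : ℝ} {p : ℕ}

theorem one_add_pos (ha : 0 ≤ a) (n : ℕ) : 0 < 1 + a * n := by positivity

theorem chi_nonneg (ha : 0 ≤ a) (n : ℕ) : 0 ≤ chi a p q n := by
  have := psi_nonneg q n
  rw [chi]
  positivity

/-- The doubling constant of `chi`. -/
def chiDoubling (p : ℕ) (q : ℝ) : ℝ := 2 ^ p + 2 ^ q * 2

theorem chiDoubling_nonneg (p : ℕ) (q : ℝ) : 0 ≤ chiDoubling p q := by
  rw [chiDoubling]; positivity

theorem inv_pow_doubling (ha : 0 ≤ a) {m n : ℕ} (h : n ≤ 2 * m) :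
    ((1 + a * m) ^ p)⁻¹ ≤ 2 ^ p * ((1 + a * n) ^ p)⁻¹ := by
  have h1 := one_add_pos ha m
  have h2 := one_add_pos ha n
  have h3 : 1 + a * n ≤ 2 * (1 + a * m) := by
    have : (n : ℝ) ≤ 2 * m := by exact_mod_cast h
    nlinarith
  have h4 : (1 + a * n) ^ p ≤ 2 ^ p * (1 + a * m) ^ p := by
    rw [← mul_pow]
    exact pow_le_pow_left₀ h2.le h3 p
  rw [← div_eq_mul_inv, le_div_iff₀ (by positivity), inv_mul_eq_div, div_le_iff₀ (by positivity)]
  exact h4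

theorem chi_doubling (ha : 0 ≤ a) (hq : 0 ≤ q) {m n : ℕ} (h : n ≤ 2 * m) :
    chi a p q m ≤ chiDoubling p q * chi a p q n := by
  have e1 := inv_pow_doubling (p := p) ha h
  have e2 := inv_pow_doubling (p := 1) ha h
  have e3 := psi_doubling hq (by omega : n ≤ 2 * m + 1)
  simp only [pow_one] at e2
  have h1 := one_add_pos ha m
  have h2 := one_add_pos ha n
  have p1 := psi_nonneg q n
  have p2 := psi_nonneg q m
  have h3 : psi q m * (1 + a * m)⁻¹ ≤ (2 ^ q * psi q n) * (2 * (1 + a * n)⁻¹) := by gcongr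
  have h4 : a * ((1 + a * m) ^ p)⁻¹ ≤ a * (2 ^ p * ((1 + a * n) ^ p)⁻¹) := by gcongr
  simp only [chi, chiDoubling, div_eq_mul_inv]
  have h5 : 0 ≤ 2 ^ q * 2 * (a * ((1 + a * n) ^ p)⁻¹) := by positivity
  have h6 : 0 ≤ 2 ^ p * (psi q n * (1 + a * n)⁻¹) := by positivity
  linarith

/-- Comparison with the telescoping differences of 1/(1 + an); the first term is at most 2 and the
rest at most 1. The point is uniformity in a, so that the convolution constant of `chi` does not
degenerate as a tends to 0. -/
theorem sum_inv_pow_le (ha : 0 ≤ a) (ha2 : a ≤ 2) (hp : 2 ≤ p) (n : ℕ) :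
    ∑ i ∈ Finset.range n, a / (1 + a * i) ^ p ≤ 3 := by
  suffices h : ∀ n : ℕ, ∑ i ∈ Finset.range (n + 1), a / (1 + a * i) ^ p ≤
      3 - (1 + a * n)⁻¹ by
    cases n with
    | zero => simp
    | succ n =>
      have := inv_nonneg.2 (one_add_pos ha n).le
      linarith [h n]
  intro n
  induction n with
  | zero => simp; linarith
  | succ n ih =>
    rw [Finset.sum_range_succ]
    have h1 := one_add_pos ha n
    have h2 := one_add_pos ha (n + 1)
    have h3 : a / (1 + a * (n + 1 : ℕ)) ^ p ≤ (1 + a * n)⁻¹ - (1 + a * (n + 1 : ℕ))⁻¹ := by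
      have e1 : (1 + a * (n : ℝ))⁻¹ - (1 + a * (n + 1 : ℕ))⁻¹ =
          a / ((1 + a * n) * (1 + a * (n + 1 : ℕ))) := by
        field_simp
        push_cast
        ring
      rw [e1]
      refine div_le_div_of_nonneg_left ha (by positivity) ?_
      have h4 : (1 : ℝ) + a * n ≤ 1 + a * (n + 1 : ℕ) := by push_cast; linarith
      calc _ ≤ (1 + a * (n + 1 : ℕ)) * (1 + a * (n + 1 : ℕ)) := by gcongr
        _ = (1 + a * (n + 1 : ℕ)) ^ 2 := by ring
        _ ≤ _ := by
            refine pow_le_pow_right₀ ?_ hp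
            have : 0 ≤ a * (n + 1 : ℕ) := by positivity
            linarith
    linarith

theorem sum_chi_le (ha : 0 ≤ a) (ha2 : a ≤ 2) (hp : 2 ≤ p) (hq : 1 < q) (n : ℕ) :
    ∑ i ∈ Finset.range n, chi a p q i ≤ 3 + psiSum q := by
  simp only [chi, Finset.sum_add_distrib]
  refine add_le_add (sum_inv_pow_le ha ha2 hp n) ?_
  refine (Finset.sum_le_sum fun i _ => ?_).trans (sum_psi_le hq (Finset.range n))
  refine div_le_self (psi_nonneg q i) ?_
  have : 0 ≤ a * i := by positivity
  linarith

/-- The convolution constant of `chi`. -/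
def chiC (p : ℕ) (q : ℝ) : ℝ := 2 * chiDoubling p q * (3 + psiSum q)

theorem chiC_nonneg (p : ℕ) (q : ℝ) : 0 ≤ chiC p q := by
  have := chiDoubling_nonneg p q
  have := psiSum_nonneg q
  rw [chiC]; positivity

theorem convWeight_chi (ha : 0 ≤ a) (ha2 : a ≤ 2) (hp : 2 ≤ p) (hq : 1 < q) :
    ConvWeight (chi a p q) (chiC p q) :=
  ConvWeight.of_doubling (chi_nonneg ha) (chiDoubling_nonneg p q)
    (fun _ _ _ h => chi_doubling ha (by linarith) h) (sum_chi_le ha ha2 hp hq)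

/-- |ρ|^n ≤ e^{-can}, and an exponential dominates any fixed power of 1 + an. -/
theorem pow_le_inv_pow (ha : 0 ≤ a) (hc : 0 < c) (hc1 : c ≤ 1) (hρ : |ρ| ≤ 1 - c * a) (n : ℕ)
    (hp : 1 ≤ p) : |ρ| ^ n ≤ (p / c) ^ p * ((1 + a * n) ^ p)⁻¹ := by
  have hp0 : (1 : ℝ) ≤ p := by exact_mod_cast hp
  have h0 := one_add_pos ha n
  have h1 : |ρ| ≤ Real.exp (-(c * a)) := hρ.trans (by linarith [Real.add_one_le_exp (-(c * a))])
  have h2 : |ρ| ^ n ≤ Real.exp (-(c * a * n)) := by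
    calc _ ≤ Real.exp (-(c * a)) ^ n := pow_le_pow_left₀ (abs_nonneg _) h1 n
      _ = _ := by rw [← Real.exp_nat_mul]; congr 1; ring
  have h3 : 1 + a * n ≤ (p / c) * Real.exp (c * a * n / p) := by
    have := Real.add_one_le_exp (c * a * n / p)
    have h4 : (p / c) * (c * a * n / p + 1) ≤ (p / c) * Real.exp (c * a * n / p) := by gcongr
    refine le_trans ?_ h4
    have : (p / c) * (c * a * n / p + 1) = a * n + p / c := by field_simp
    rw [this]
    have : 1 ≤ p / c := by rw [le_div_iff₀ hc]; linarith
    linarith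
  have h5 : (1 + a * n) ^ p ≤ (p / c) ^ p * Real.exp (c * a * n) := by
    calc _ ≤ ((p / c) * Real.exp (c * a * n / p)) ^ p := pow_le_pow_left₀ h0.le h3 p
      _ = _ := by
        rw [mul_pow, ← Real.exp_nat_mul]
        congr 2
        field_simp
  refine h2.trans ?_
  rw [← div_eq_mul_inv, le_div_iff₀ (by positivity), Real.exp_neg, inv_mul_eq_div,
    div_le_iff₀ (Real.exp_pos _)]
  exact h5

/-- The geometric series `∑ ρ^n X^n`. -/
def geomSeries (ρ : ℝ) : PowerSeries ℝ := PowerSeries.mk fun n => ρ ^ n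

theorem one_sub_mul_geomSeries (ρ : ℝ) :
    (1 - PowerSeries.C ρ * PowerSeries.X) * geomSeries ρ = 1 := by
  ext n
  rw [sub_mul, one_mul, mul_assoc, map_sub, PowerSeries.coeff_C_mul]
  cases n with
  | zero => simp [geomSeries]
  | succ n =>
    rw [PowerSeries.coeff_succ_X_mul]
    simp [geomSeries, PowerSeries.coeff_one, pow_succ']

theorem coeff_succ_geomSeries_mul (ρ : ℝ) (u : PowerSeries ℝ) (n : ℕ) :
    coeff (n + 1) (geomSeries ρ * u) = ρ * coeff n (geomSeries ρ * u) + coeff (n + 1) u := by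
  have h : geomSeries ρ * u = PowerSeries.C ρ * (PowerSeries.X * (geomSeries ρ * u)) + u := by
    linear_combination u * one_sub_mul_geomSeries ρ
  conv_lhs => rw [h]
  rw [map_add, PowerSeries.coeff_C_mul, PowerSeries.coeff_succ_X_mul]

theorem coeff_zero_geomSeries_mul (ρ : ℝ) (u : PowerSeries ℝ) :
    coeff 0 (geomSeries ρ * u) = coeff 0 u := by
  simp [geomSeries]

theorem abs_coeff_geomSeries_mul_le (hρ : |ρ| ≤ 1) (u : PowerSeries ℝ) (n : ℕ) :
    |coeff n (geomSeries ρ * u)| ≤ ∑ j ∈ Finset.range (n + 1), |coeff j u| := by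
  induction n with
  | zero => simp [coeff_zero_geomSeries_mul]
  | succ n ih =>
    rw [coeff_succ_geomSeries_mul, Finset.sum_range_succ]
    refine (abs_add_le _ _).trans (add_le_add ?_ le_rfl)
    rw [abs_mul]
    exact (mul_le_of_le_one_left (abs_nonneg _) hρ).trans ih

/-- Splitting the convolution with `ρ^n` at `h`. -/
theorem abs_coeff_geomSeries_mul_split (hρ : |ρ| < 1) (u : PowerSeries ℝ) {h n : ℕ} (hn : h ≤ n)
    {B : ℝ} (hB0 : 0 ≤ B) (hB : ∀ j, h < j → j ≤ n → |coeff j u| ≤ B) :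
    |coeff n (geomSeries ρ * u)| ≤
      |ρ| ^ (n - h) * |coeff h (geomSeries ρ * u)| + B / (1 - |ρ|) := by
  have hpos : 0 < 1 - |ρ| := by linarith
  induction n, hn using Nat.le_induction with
  | base =>
    have : 0 ≤ B / (1 - |ρ|) := by positivity
    simpa using this
  | succ n hn ih =>
    -- The coefficients w_n of the product satisfy w_{n+1} = ρ w_n + u_{n+1}; the increments after h
    -- add up to a geometric series with sum at most B/(1 - |ρ|).
    have h1 := ih fun j hj hj' => hB j hj (by omega)
    have h2 := hB (n + 1) (by omega) le_rfl
    rw [coeff_succ_geomSeries_mul]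
    refine (abs_add_le _ _).trans ?_
    rw [abs_mul, Nat.succ_sub hn, pow_succ]
    have h3 := mul_le_mul_of_nonneg_left h1 (abs_nonneg ρ)
    have h4 : |ρ| * (B / (1 - |ρ|)) + B = B / (1 - |ρ|) := by field_simp; ring
    linarith

variable {N : ℕ} {y : PowerSeries ℝ}

/-- The constant in `bd_geomSeries_mul`. -/
def resolventC (p : ℕ) (q c : ℝ) : ℝ :=
  (p / c) ^ p * 2 ^ p * (2 ^ q + 2 * psiSum q) + 4 * 2 ^ (q + 1) / c + 2 + 2 ^ (p + 1) * psiSum q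

/-- Summation by parts: with Q the series of partial sums of y, one has Ky = K(1 - X)Q, and 1 - X =
(1 - ρX) - (1 - ρ)X. The cancellation in y is thus traded for the small factor 1 - ρ of order a. -/
theorem abs_coeff_resolvent_le (ha : 0 ≤ a) (hb : 0 ≤ b) (hq : 1 < q) (hρ1 : |ρ| ≤ 1)
    (hρ2 : |1 - ρ| ≤ 2 * a) (hQ : Bd N (psi q) b (geom * y)) {n : ℕ} (hn : n ≤ N) :
    |coeff n (geomSeries ρ * y)| ≤ b * psi q n + 2 * a * (b * psiSum q) := by
  have hS := psiSum_nonneg q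
  have e : geomSeries ρ * y = geom * y -
      PowerSeries.C (1 - ρ) * (PowerSeries.X * (geomSeries ρ * (geom * y))) := by
    rw [map_sub, map_one]
    linear_combination (-geomSeries ρ * y) * one_sub_X_mul_geom +
      geom * y * one_sub_mul_geomSeries ρ
  rw [e, map_sub, sub_eq_add_neg]
  refine (abs_add_le _ _).trans (add_le_add (hQ n hn) ?_)
  rw [abs_neg, PowerSeries.coeff_C_mul, abs_mul]
  refine mul_le_mul hρ2 ?_ (abs_nonneg _) (by positivity)
  cases n with
  | zero => simp; positivity
  | succ n =>
    rw [PowerSeries.coeff_succ_X_mul]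
    refine (abs_coeff_geomSeries_mul_le hρ1 _ _).trans ?_
    calc _ ≤ ∑ j ∈ Finset.range (n + 1), b * psi q j :=
          Finset.sum_le_sum fun j hj => hQ j (by rw [Finset.mem_range] at hj; omega)
      _ ≤ _ := by
          rw [← Finset.mul_sum]
          exact mul_le_mul_of_nonneg_left (sum_psi_le hq _) hb

theorem bd_geomSeries_mul (ha : 0 < a) (hb : 0 ≤ b) (hq : 1 < q) (hp : 2 ≤ p) (hc : 0 < c)
    (hc1 : c ≤ 1) (hρ : |ρ| ≤ 1 - c * a) (hρ2 : |1 - ρ| ≤ 2 * a)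
    (hQ : Bd N (psi q) b (geom * y)) (hy : Bd N (psi (q + 1)) (2 * b) y) :
    Bd N (chi a p q) (resolventC p q c * b) (geomSeries ρ * y) := by
  have hca : 0 < c * a := by positivity
  intro n hn
  have hS := psiSum_nonneg q
  have hψ := psi_nonneg q n
  have h0 := one_add_pos ha.le n
  have hpc : (0 : ℝ) ≤ (p / c) ^ p := by positivity
  have h1p : (1 : ℝ) ≤ (1 + a * n) := by
    have : 0 ≤ a * n := by positivity
    linarith
  set u := ((1 + a * n) ^ p)⁻¹ with hu
  set w := (1 + a * n)⁻¹ with hw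
  have hu0 : 0 ≤ u := by positivity
  have hw0 : 0 ≤ w := by positivity
  have huw : u ≤ w := by
    refine inv_anti₀ h0 ?_
    calc 1 + a * n = (1 + a * n) ^ 1 := (pow_one _).symm
      _ ≤ _ := pow_le_pow_right₀ h1p (by omega)
  have hchi : chi a p q n = a * u + psi q n * w := by
    rw [chi, div_eq_mul_inv, div_eq_mul_inv]
  rw [hchi]
  have hX : 0 ≤ a * u := by positivity
  have hZ : 0 ≤ psi q n * w := by positivity
  have hc4 : (0 : ℝ) ≤ 4 * 2 ^ (q + 1) / c := by positivity
  -- The crossover is at n of order 1/a. Below it `chi` is comparable to a + psi q n, which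
  -- summation by parts delivers. Above it the convolution is split at n/2: the early part has
  -- decayed geometrically, the late part is a geometric sum of small coefficients of y.
  rcases lt_or_ge (a * n) 1 with han | han
  · have h1 := abs_coeff_resolvent_le ha.le hb hq (by linarith) hρ2 hQ hn
    have h2 : 1 ≤ 2 * w := by
      rw [hw, ← div_eq_mul_inv, le_div_iff₀ h0]; linarith
    have h3 : 1 ≤ 2 ^ p * u := by
      rw [hu, ← div_eq_mul_inv, le_div_iff₀ (by positivity), one_mul]
      exact pow_le_pow_left₀ h0.le (by linarith) p
    have h4 : psi q n ≤ 2 * (psi q n * w) := by nlinarith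
    have h5 : a ≤ 2 ^ p * (a * u) := by nlinarith
    refine h1.trans ?_
    have h6 : psi q n + 2 * a * psiSum q ≤ (2 + 2 ^ (p + 1) * psiSum q) * (a * u + psi q n * w) := by
      have h7 : 2 * a * psiSum q ≤ 2 * (2 ^ p * (a * u)) * psiSum q := by gcongr
      have h8 : 0 ≤ 2 ^ (p + 1) * psiSum q * (psi q n * w) := by positivity
      rw [pow_succ] at *
      nlinarith
    have h9 : (2 + 2 ^ (p + 1) * psiSum q) ≤ resolventC p q c := by
      rw [resolventC]
      have : 0 ≤ (p / c : ℝ) ^ p * 2 ^ p * (2 ^ q + 2 * psiSum q) := by positivity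
      linarith
    calc _ = b * (psi q n + 2 * a * psiSum q) := by ring
      _ ≤ b * (resolventC p q c * (a * u + psi q n * w)) := by
          refine mul_le_mul_of_nonneg_left (h6.trans ?_) hb
          exact mul_le_mul_of_nonneg_right h9 (by positivity)
      _ = _ := by ring
  · set h := n / 2 with hh
    have hhn : n ≤ 2 * h + 1 := by omega
    have hB : ∀ j, h < j → j ≤ n → |coeff j y| ≤ 2 * b * psi (q + 1) h := fun j hj hj' =>
      (hy j (by omega)).trans (mul_le_mul_of_nonneg_left
        (psi_antitone (by linarith) hj.le) (by positivity))
    have h1 := abs_coeff_geomSeries_mul_split (by linarith : |ρ| < 1) y (by omega : h ≤ n)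
      (mul_nonneg (by positivity) (psi_nonneg (q + 1) h)) hB
    have h2 := abs_coeff_resolvent_le ha.le hb hq (by linarith) hρ2 hQ (by omega : h ≤ N)
    have h3 := pow_le_inv_pow (p := p) ha.le hc hc1 hρ (n - h) (by omega)
    have h4 := inv_pow_doubling (p := p) ha.le (by omega : n ≤ 2 * (n - h))
    have h5 : |ρ| ^ (n - h) ≤ (p / c) ^ p * 2 ^ p * u := by
      refine h3.trans ?_
      rw [mul_assoc]
      exact mul_le_mul_of_nonneg_left h4 hpc
    have h6 : psi q h ≤ 2 ^ q * psi q n := psi_doubling (by linarith) hhn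
    have h7 : psi (q + 1) h ≤ 2 ^ (q + 1) * psi (q + 1) n := psi_doubling (by linarith) hhn
    -- Because an ≥ 1, one has 1 + an ≤ 2a(n + 1). The factor a gained here pays for the division by
    -- 1 - |ρ| ≥ ca.
    have h8 : psi (q + 1) n ≤ 2 * a * (psi q n * w) := by
      have e1 := succ_mul_psi (q + 1) n
      rw [add_sub_cancel_right] at e1
      rw [← e1, hw]
      have : 1 + a * n ≤ 2 * a * ((n : ℝ) + 1) := by nlinarith
      rw [← mul_assoc, ← div_eq_mul_inv, le_div_iff₀ h0]
      have := mul_le_mul_of_nonneg_right this (psi_nonneg (q + 1) n)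
      linarith
    have h9 : 2 * b * psi (q + 1) h / (1 - |ρ|) ≤ b * (4 * 2 ^ (q + 1) / c) * (psi q n * w) := by
      have h10 : 2 * b * psi (q + 1) h ≤ 2 * b * (2 ^ (q + 1) * (2 * a * (psi q n * w))) := by
        have := h7.trans (mul_le_mul_of_nonneg_left h8 (by positivity : (0 : ℝ) ≤ 2 ^ (q + 1)))
        exact mul_le_mul_of_nonneg_left this (by positivity)
      have h11 : 0 ≤ 2 * b * (2 ^ (q + 1) * (2 * a * (psi q n * w))) := by positivity
      calc _ ≤ 2 * b * (2 ^ (q + 1) * (2 * a * (psi q n * w))) / (c * a) :=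
            div_le_div₀ h11 h10 hca (by linarith)
        _ = _ := by field_simp; ring
    have h12 : |ρ| ^ (n - h) * |coeff h (geomSeries ρ * y)| ≤
        ((p / c) ^ p * 2 ^ p * u) * (b * (2 ^ q * psi q n) + 2 * a * (b * psiSum q)) := by
      refine mul_le_mul h5 (h2.trans ?_) (abs_nonneg _) (by positivity)
      gcongr
    refine h1.trans ((add_le_add h12 h9).trans ?_)
    have h13 : u * psi q n ≤ psi q n * w := by
      rw [mul_comm]; exact mul_le_mul_of_nonneg_left huw hψ
    set P : ℝ := (p / c : ℝ) ^ p * 2 ^ p with hP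
    have hP0 : 0 ≤ P := by positivity
    have hq2 : (0 : ℝ) ≤ 2 ^ q := by positivity
    have h14 : P * u * (b * (2 ^ q * psi q n) + 2 * a * (b * psiSum q)) ≤
        b * (P * (2 ^ q + 2 * psiSum q)) * (a * u + psi q n * w) := by
      have e1 : P * u * (b * (2 ^ q * psi q n) + 2 * a * (b * psiSum q)) =
        b * P * 2 ^ q * (u * psi q n) + b * P * (2 * psiSum q) * (a * u) := by ring
      have e2 : b * P * 2 ^ q * (u * psi q n) ≤ b * P * 2 ^ q * (psi q n * w) :=
        mul_le_mul_of_nonneg_left h13 (by positivity)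
      have e3 : 0 ≤ b * P * 2 ^ q * (a * u) := by positivity
      have e4 : 0 ≤ b * P * (2 * psiSum q) * (psi q n * w) := by positivity
      rw [e1]
      linarith
    have h15 : b * (4 * 2 ^ (q + 1) / c) * (psi q n * w) ≤
        b * (4 * 2 ^ (q + 1) / c) * (a * u + psi q n * w) :=
      mul_le_mul_of_nonneg_left (by linarith) (by positivity)
    have h16 : 0 ≤ b * (2 + 2 ^ (p + 1) * psiSum q) * (a * u + psi q n * w) := by positivity
    rw [resolventC]
    linarith

/-- Decay of a renewal sequence whose kernel has mass `ρ` with `1 - ρ` comparable to `a`. -/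
theorem renewal_decay (hq : 1 < q) (hp : 2 ≤ p) (hc : 0 < c) (hc1 : c ≤ 1) :
    ∃ C b₀ : ℝ, 1 ≤ C ∧ 0 < b₀ ∧ ∀ (N : ℕ) (a b ρ : ℝ) (f g e : ℕ → ℝ), 0 < a → a ≤ 2 → 0 ≤ b →
      b ≤ b₀ → |ρ| ≤ 1 - c * a → |1 - ρ| ≤ 2 * a → RenewalSeq f g e →
      (∀ j, 1 ≤ j → j ≤ N → |ρ - ∑ m ∈ Finset.range (j + 1), g m| ≤ b * psi q j) →
      (∀ j, 2 ≤ j → j ≤ N → |g j| ≤ b * psi (q + 1) j) →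
      (∀ j, 1 ≤ j → j ≤ N → |e j| ≤ b * psi (q + 1) j) →
      ∀ n ≤ N, |f n| ≤ C * ((1 + a * n) ^ p)⁻¹ + C * b * (a ^ 2)⁻¹ * psi (q + 1) n := by
  set CY := resolventC p q c with hCY
  set Cχ := chiC p q with hCχ
  set Cd := chiDoubling p q with hCd
  set P : ℝ := (p / c : ℝ) ^ p with hP
  set S := psiSum q with hSdef
  have hS : 0 ≤ S := psiSum_nonneg q
  have hP0 : 0 ≤ P := by positivity
  have hCd0 : 0 ≤ Cd := chiDoubling_nonneg p q
  have hCχ0 : 0 ≤ Cχ := chiC_nonneg p q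
  have hCY0 : 0 ≤ CY := by rw [hCY, resolventC]; positivity
  set Cz := 2 * CY + 4 with hCz
  set C1 := P + P * 2 ^ p * (Cz * (3 + S)) + Cz * Cd / c with hC1
  set C2 := 2 * Cz * Cd / c with hC2
  have hC10 : 0 ≤ C1 := by positivity
  have hC20 : 0 ≤ C2 := by positivity
  -- This threshold ensures both the smallness condition for inverting 1 + Y and b ≤ 1.
  refine ⟨C1 + C2 + 1, (2 * Cχ * CY + 1)⁻¹, by linarith, by positivity, ?_⟩
  intro N a b ρ f g e ha ha2 hb hb0 hρ hρ2 hf hQ hg he n hn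
  have hca : 0 < c * a := by positivity
  have hχ := convWeight_chi (p := p) ha.le ha2 hp hq
  have hbs : 2 * Cχ * (CY * b) ≤ 1 ∧ b ≤ 1 := by
    have hpos : 0 < 2 * Cχ * CY + 1 := by positivity
    have h1 : b * (2 * Cχ * CY + 1) ≤ 1 := by
      calc _ ≤ (2 * Cχ * CY + 1)⁻¹ * (2 * Cχ * CY + 1) := by gcongr
        _ = 1 := inv_mul_cancel₀ hpos.ne'
    have h2 : 0 ≤ b * (2 * Cχ * CY) := by positivity
    constructor <;> linarith
  set K := geomSeries ρ with hK
  -- The reference kernel is a single step of weight ρ: 1 - G = (1 - ρX) + y, so multiplication by K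
  -- = 1/(1 - ρX) turns 1 - G into 1 + Y with Y = Ky. The partial sums of y are the differences ρ -
  -- Σ g.
  set y := PowerSeries.C ρ * PowerSeries.X - PowerSeries.mk g with hy
  have hcy : ∀ j, coeff j y = (if j = 1 then ρ else 0) - g j := by
    intro j
    rw [hy, map_sub, PowerSeries.coeff_C_mul, PowerSeries.coeff_X, PowerSeries.coeff_mk]
    split_ifs <;> simp
  have hQy : ∀ j, 1 ≤ j → coeff j (geom * y) = ρ - ∑ m ∈ Finset.range (j + 1), g m := by
    intro j hj
    rw [coeff_geom_mul]
    simp only [hcy, Finset.sum_sub_distrib]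
    congr 1
    rw [Finset.sum_ite_eq' (Finset.range (j + 1)) 1]
    rw [if_pos (by rw [Finset.mem_range]; omega)]
  have hQ' : Bd N (psi q) b (geom * y) := by
    intro j hj
    rcases Nat.eq_zero_or_pos j with h0 | h0
    · subst h0
      rw [coeff_geom_mul]
      simp [hcy, hf.g_zero, psi_zero, hb]
    · rw [hQy j h0]; exact hQ j h0 hj
  -- The factor 2 comes from m = 1, where no bound on g_1 is given and the tail hypothesis is used
  -- instead; psi q 1 = 2 psi (q + 1) 1.
  have hy' : Bd N (psi (q + 1)) (2 * b) y := by
    intro j hj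
    have hψ := psi_nonneg (q + 1) j
    rcases Nat.lt_or_ge j 2 with h | h
    · rcases Nat.eq_zero_or_pos j with h0 | h0
      · subst h0
        simp [hcy, hf.g_zero, psi_zero, hb]
      · have h1 : j = 1 := by omega
        subst h1
        have h2 := hQ 1 le_rfl hj
        have h3 := succ_mul_psi (q + 1) 1
        rw [add_sub_cancel_right] at h3
        rw [Finset.sum_range_succ, Finset.sum_range_one, hf.g_zero, zero_add] at h2
        rw [hcy, if_pos rfl]
        refine h2.trans (le_of_eq ?_)
        rw [← h3]
        push_cast
        ring
    · rw [hcy, if_neg (by omega), zero_sub, abs_neg]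
      refine (hg j h hj).trans ?_
      nlinarith
  have hY := bd_geomSeries_mul (p := p) ha hb hq hp hc hc1 hρ hρ2 hQ' hy'
  rw [← hCY] at hY
  set Y := K * y with hYdef
  have hY0 : constantCoeff Y = 0 := by
    rw [← PowerSeries.coeff_zero_eq_constantCoeff_apply, hYdef, hK, coeff_zero_geomSeries_mul, hcy,
      hf.g_zero]
    simp
  have hK1 := one_sub_mul_geomSeries ρ
  rw [← hK] at hK1
  have hUinv : (1 + Y) * (1 + Y)⁻¹ = 1 := PowerSeries.mul_inv_cancel _ (by
    rw [map_add, hY0]; simp)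
  set W := (1 + Y)⁻¹ with hW
  have hw := Bd.inv_one_add hχ (by positivity : 0 ≤ CY * b) hbs.1 hY hY0 hUinv
  have hE : Bd N (chi a p q) (2 * b) (PowerSeries.mk e) := by
    intro j hj
    rw [PowerSeries.coeff_mk]
    rcases Nat.eq_zero_or_pos j with h0 | h0
    · subst h0
      rw [hf.e_zero, abs_zero]
      exact mul_nonneg (by positivity) (chi_nonneg ha.le 0)
    · refine (he j h0 hj).trans ?_
      have e1 := succ_mul_psi (q + 1) j
      rw [add_sub_cancel_right] at e1
      have e2 : psi (q + 1) j ≤ 2 * (psi q j / (1 + a * j)) := by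
        rw [← e1, ← mul_div_assoc, le_div_iff₀ (one_add_pos ha.le j)]
        have h3 : 1 + a * j ≤ 2 * ((j : ℝ) + 1) := by
          have := mul_le_mul_of_nonneg_right ha2 (Nat.cast_nonneg (α := ℝ) j)
          linarith
        have := mul_le_mul_of_nonneg_right h3 (psi_nonneg (q + 1) j)
        linarith
      have e3 : psi q j / (1 + a * j) ≤ chi a p q j := by
        rw [chi]
        have := one_add_pos ha.le j
        have : 0 ≤ a / (1 + a * j) ^ p := by positivity
        linarith
      have := mul_le_mul_of_nonneg_left (e2.trans (mul_le_mul_of_nonneg_left e3 two_pos.le)) hb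
      linarith
  have hEw := Bd.mul hχ (by positivity) (by positivity) hE hw
  set z := W * (1 + PowerSeries.mk e) - 1 with hz
  have hzB : Bd N (chi a p q) (Cz * b) z := by
    have e1 : z = (W - 1) + PowerSeries.mk e + PowerSeries.mk e * (W - 1) := by rw [hz]; ring
    rw [e1]
    refine ((hw.add hE).add hEw).mono_const (chi_nonneg ha.le) ?_
    have : 2 * Cχ * (CY * b) * (2 * b) ≤ 1 * (2 * b) :=
      mul_le_mul_of_nonneg_right hbs.1 (by positivity)
    rw [hCz]
    linarith
  -- F = K(1 + Y)^{-1}(1 + E) = K(1 + z): the pure power ρ^n plus its convolution with the small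
  -- series z.
  have hF : PowerSeries.mk f = K + K * z := by
    have h1 := hf.series
    rw [hz]
    have h2 : K * (1 - PowerSeries.mk g) = 1 + Y := by
      rw [hYdef, hy]
      linear_combination hK1
    linear_combination (K * W) * h1 - (PowerSeries.mk f * W) * h2 - PowerSeries.mk f * hUinv
  have hfn : f n = ρ ^ n + coeff n (K * z) := by
    have := congrArg (coeff n) hF
    rw [PowerSeries.coeff_mk, map_add] at this
    rw [this, hK, geomSeries, PowerSeries.coeff_mk]
  set h := n / 2 with hh
  set u := ((1 + a * n) ^ p)⁻¹ with hu
  have h0 := one_add_pos ha.le n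
  have hu0 : 0 ≤ u := by positivity
  have hχn := chi_nonneg (p := p) (q := q) ha.le n
  have hB : ∀ j, h < j → j ≤ n → |coeff j z| ≤ Cz * b * (Cd * chi a p q n) := fun j hj hj' =>
    (hzB j (by omega)).trans (mul_le_mul_of_nonneg_left
      (chi_doubling ha.le (by linarith) (by omega)) (by positivity))
  have h1 := abs_coeff_geomSeries_mul_split (by linarith : |ρ| < 1) z (by omega : h ≤ n)
      (by positivity) hB
  have h2 : |coeff h (K * z)| ≤ Cz * (3 + S) := by
    refine (abs_coeff_geomSeries_mul_le (by linarith) z h).trans ?_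
    calc _ ≤ ∑ j ∈ Finset.range (h + 1), Cz * b * chi a p q j :=
          Finset.sum_le_sum fun j hj => hzB j (by rw [Finset.mem_range] at hj; omega)
      _ ≤ Cz * b * (3 + S) := by
          rw [← Finset.mul_sum]
          exact mul_le_mul_of_nonneg_left (sum_chi_le ha.le ha2 hp hq _) (by positivity)
      _ ≤ Cz * 1 * (3 + S) := by gcongr; exact hbs.2
      _ = _ := by ring
  have h3 := pow_le_inv_pow (p := p) ha.le hc hc1 hρ (n - h) (by omega)
  have h4 := inv_pow_doubling (p := p) ha.le (by omega : n ≤ 2 * (n - h))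
  have h5 : |ρ| ^ (n - h) ≤ P * 2 ^ p * u := by
    refine h3.trans ?_
    rw [mul_assoc]
    exact mul_le_mul_of_nonneg_left h4 hP0
  have h6 : |ρ ^ n| ≤ P * u := by
    rw [abs_pow]
    exact pow_le_inv_pow (p := p) ha.le hc hc1 hρ n (by omega)
  -- The second part of `chi` loses one factor 1/a when rewritten with the weight `psi (q + 1)`;
  -- dividing by 1 - |ρ| ≥ ca costs another, whence a^{-2}.
  have h7 : chi a p q n ≤ a * u + 2 * (a⁻¹ * psi (q + 1) n) := by
    rw [chi, div_eq_mul_inv, ← hu]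
    refine add_le_add le_rfl ?_
    have e1 := succ_mul_psi (q + 1) n
    rw [add_sub_cancel_right] at e1
    rw [← e1, div_le_iff₀ h0]
    have h8 : (n : ℝ) + 1 ≤ 2 * a⁻¹ * (1 + a * n) := by
      have : 2 * a⁻¹ * (1 + a * n) = 2 * a⁻¹ + 2 * n := by field_simp
      rw [this]
      have : 1 ≤ 2 * a⁻¹ := by
        rw [← div_eq_mul_inv, le_div_iff₀ ha]; linarith
      have := n.cast_nonneg (α := ℝ)
      linarith
    have := mul_le_mul_of_nonneg_right h8 (psi_nonneg (q + 1) n)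
    linarith
  have h9 : Cz * b * (Cd * chi a p q n) / (1 - |ρ|) ≤
      Cz * Cd / c * u + C2 * b * (a ^ 2)⁻¹ * psi (q + 1) n := by
    have hψ := psi_nonneg (q + 1) n
    calc _ ≤ Cz * b * (Cd * (a * u + 2 * (a⁻¹ * psi (q + 1) n))) / (c * a) := by
          refine div_le_div₀ (by positivity) ?_ hca (by linarith)
          gcongr
      _ = Cz * Cd / c * (b * u) + C2 * b * (a ^ 2)⁻¹ * psi (q + 1) n := by
          rw [hC2]; field_simp
      _ ≤ _ := by
          have : b * u ≤ u := mul_le_of_le_one_left hu0 hbs.2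
          gcongr
  have h10 : |ρ| ^ (n - h) * |coeff h (K * z)| ≤ (P * 2 ^ p * u) * (Cz * (3 + S)) :=
    mul_le_mul h5 h2 (abs_nonneg _) (by positivity)
  rw [hfn]
  refine (abs_add_le _ _).trans ((add_le_add h6 (h1.trans (add_le_add h10 h9))).trans ?_)
  have hψ := psi_nonneg (q + 1) n
  have h11 : 0 ≤ (C2 + 1) * u := by positivity
  have h12 : 0 ≤ (C1 + 1) * b * (a ^ 2)⁻¹ * psi (q + 1) n := by positivity
  rw [hC1] at h12 ⊢
  linarith

end

end LaceExpansion
end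

noncomputable section
namespace LaceExpansion

open PowerSeries (coeff constantCoeff)

/-! ### Local asymptotics by exponential tilting -/

/-- Needed for kernels that are modified by hand (tilted and truncated): (1 + E)/(1 - G) always
exists as a formal series. -/
theorem exists_renewalSeq {g e : ℕ → ℝ} (hg : g 0 = 0) (he : e 0 = 0) :
    ∃ f, RenewalSeq f g e := by
  have h1 : (1 - PowerSeries.mk g) * (1 - PowerSeries.mk g)⁻¹ = 1 :=
    PowerSeries.mul_inv_cancel _ (by
      rw [map_sub, ← PowerSeries.coeff_zero_eq_constantCoeff_apply,
        ← PowerSeries.coeff_zero_eq_constantCoeff_apply, PowerSeries.coeff_mk, hg]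
      simp)
  set F := (1 + PowerSeries.mk e) * (1 - PowerSeries.mk g)⁻¹ with hF
  have hmk : PowerSeries.mk (fun n => coeff n F) = F := by ext n; simp
  have h2 : ∀ n, coeff n F - ∑ m ∈ Finset.Icc 1 n, g m * coeff (n - m) F =
      coeff n (1 + PowerSeries.mk e) := by
    intro n
    rw [← coeff_mk_mul_mk_of_zero hg (h := fun n => coeff n F), hmk, ← map_sub]
    congr 1
    rw [hF]
    linear_combination (1 + PowerSeries.mk e) * h1
  refine ⟨fun n => coeff n F, ?_, hg, he, fun n => ?_⟩
  · have := h2 0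
    simpa [he] using this
  · have := h2 (n + 1)
    rw [map_add, PowerSeries.coeff_one, if_neg (by omega), PowerSeries.coeff_mk, zero_add] at this
    linarith

/-- Causality: f_n only sees coefficients of index at most n, so truncating the kernel beyond N
leaves f_N unchanged. -/
theorem RenewalSeq.eq_of_agree {f g e f' g' e' : ℕ → ℝ} {N : ℕ} (h : RenewalSeq f g e)
    (h' : RenewalSeq f' g' e') (hg : ∀ m ≤ N, g m = g' m) (he : ∀ m ≤ N, e m = e' m) :
    ∀ n ≤ N, f n = f' n := by
  intro n
  induction n using Nat.strong_induction_on with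
  | _ n ih =>
    intro hn
    cases n with
    | zero => rw [h.f_zero, h'.f_zero]
    | succ n =>
      rw [h.step, h'.step, he _ hn]
      congr 1
      refine Finset.sum_congr rfl fun m hm => ?_
      rw [Finset.mem_Icc] at hm
      rw [hg m (by omega), ih (n + 1 - m) (by omega) (by omega)]

theorem abs_exp_sub_one_le (y : ℝ) : |Real.exp y - 1| ≤ |y| * Real.exp |y| := by
  have h1 := Real.add_one_le_exp y
  have h2 := Real.add_one_le_exp (-y)
  have h3 := Real.exp_pos y
  have h4 : Real.exp y - 1 ≤ y * Real.exp y := by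
    have := mul_le_mul_of_nonneg_left h2 h3.le
    rw [← Real.exp_add, add_neg_cancel, Real.exp_zero] at this
    linarith
  have h5 : y * Real.exp y ≤ |y| * Real.exp |y| :=
    mul_le_mul (le_abs_self y) (Real.exp_le_exp.2 (le_abs_self y)) h3.le (abs_nonneg y)
  have h6 : |y| ≤ |y| * Real.exp |y| :=
    le_mul_of_one_le_right (abs_nonneg y) (Real.one_le_exp (abs_nonneg y))
  have h7 := neg_abs_le y
  rw [abs_le]
  constructor <;> linarith

theorem abs_exp_sub_one_sub_le (y : ℝ) : |Real.exp y - 1 - y| ≤ y ^ 2 * Real.exp |y| := by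
  have h1 := Real.add_one_le_exp y
  have h2 := Real.add_one_le_exp (-y)
  have h3 := Real.exp_pos y
  have h4 : Real.exp y - 1 ≤ y * Real.exp y := by
    have := mul_le_mul_of_nonneg_left h2 h3.le
    rw [← Real.exp_add, add_neg_cancel, Real.exp_zero] at this
    linarith
  have h5 : y * (Real.exp y - 1) ≤ |y| * (|y| * Real.exp |y|) := by
    calc _ ≤ |y * (Real.exp y - 1)| := le_abs_self _
      _ = |y| * |Real.exp y - 1| := abs_mul _ _
      _ ≤ _ := mul_le_mul_of_nonneg_left (abs_exp_sub_one_le y) (abs_nonneg y)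
  rw [abs_of_nonneg (by linarith), ← sq_abs y]
  nlinarith

/-- The limiting data of a critical kernel: `g₀`, `e₀` are the kernel and error sequences at `k = 0`
and `γ` the normalised second derivatives of the kernel. -/
structure LimitData (q B : ℝ) (g₀ e₀ γ : ℕ → ℝ) (T A v : ℝ) : Prop where
  e_zero : e₀ 0 = 0
  g_le : ∀ m, |g₀ m| ≤ B * psi (q + 1) m
  e_le : ∀ m, |e₀ m| ≤ B * psi (q + 1) m
  γ_le : ∀ m, |γ m| ≤ B * psi q m
  sum_g : HasSum g₀ 1
  T_eq : T = ∑' m : ℕ, (m : ℝ) * g₀ m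
  A_eq : A * T = 1 + ∑' m, e₀ m
  v_eq : ∑' m, γ m = -(v * T)

/-- A kernel close to a critical one, at distance `a`. -/
structure LocalData (q δ' B b a : ℝ) (g₀ e₀ γ f g e : ℕ → ℝ) : Prop where
  renewal : RenewalSeq f g e
  g_le : ∀ m, |g m| ≤ B * psi (q + 1) m
  g_small : ∀ m, 2 ≤ m → |g m| ≤ b * psi (q + 1) m
  e_small : ∀ m, |e m| ≤ b * psi (q + 1) m
  g_sub : ∀ m, |g m - g₀ m| ≤ B * a * psi q m
  e_sub : ∀ m, |e m - e₀ m| ≤ B * a * psi q m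
  g_taylor : ∀ m, |g m - g₀ m - a * γ m| ≤ B * a ^ (1 + δ') * psi (q - δ') m

theorem psiSum_anti {r s : ℝ} (hr : 1 < r) (h : r ≤ s) : psiSum s ≤ psiSum r :=
  (summable_psi (by linarith)).tsum_le_tsum (psi_anti_exp h) (summable_psi hr)

theorem cast_le_psi_neg_one (m : ℕ) : (m : ℝ) ≤ psi (-1) m := by
  simp [psi]

section
variable {q δ δ' κ B b a X x : ℝ} {N : ℕ}

/-- Effect of tilting on first moments. -/
theorem sum_tilt_le (hκ : 0 ≤ κ) (hδ'1 : δ' ≤ 1) (hqκ : 1 < q - κ - δ') (hB : 0 ≤ B) (ha : 0 ≤ a)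
    (hX : |x| ≤ X) (hexp : ∀ m ≤ N, Real.exp (X * m) ≤ 3 * psi (-κ) m) {u u₀ : ℕ → ℝ}
    (hu : ∀ m, |u m| ≤ B * psi (q + 1) m) (hsub : ∀ m, |u m - u₀ m| ≤ B * a * psi q m) :
    ∑ m ∈ Finset.range (N + 1), (m : ℝ) * |u m * Real.exp (x * m) - u₀ m| ≤
      3 * B * psiSum (q - κ - δ') * ((X + a) * ((N : ℝ) + 1) ^ (1 - δ')) := by
  have hX0 : 0 ≤ X := (abs_nonneg x).trans hX
  have h1 : ∀ m ∈ Finset.range (N + 1), (m : ℝ) * |u m * Real.exp (x * m) - u₀ m| ≤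
      3 * B * (X + a) * psi (q - κ - 1) m := by
    intro m hm
    have hm' : m ≤ N := by rw [Finset.mem_range] at hm; omega
    have e1 : u m * Real.exp (x * m) - u₀ m = u m * (Real.exp (x * m) - 1) + (u m - u₀ m) := by
      ring
    have e2 : |Real.exp (x * m) - 1| ≤ X * psi (-1) m * (3 * psi (-κ) m) := by
      have e3 : |x * m| ≤ X * m := by
        rw [abs_mul, Nat.abs_cast]
        exact mul_le_mul_of_nonneg_right hX m.cast_nonneg
      refine (abs_exp_sub_one_le _).trans ?_
      refine mul_le_mul (e3.trans (mul_le_mul_of_nonneg_left (cast_le_psi_neg_one m) hX0))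
        ((Real.exp_le_exp.2 e3).trans (hexp m hm')) (Real.exp_pos _).le
        (mul_nonneg hX0 (psi_nonneg _ _))
    have e4 : |u m * Real.exp (x * m) - u₀ m| ≤
        (B * psi (q + 1) m) * (X * psi (-1) m * (3 * psi (-κ) m)) + B * a * psi q m := by
      rw [e1]
      refine (abs_add_le _ _).trans (add_le_add ?_ (hsub m))
      rw [abs_mul]
      exact mul_le_mul (hu m) e2 (abs_nonneg _) (mul_nonneg hB (psi_nonneg _ _))
    have e5 : (B * psi (q + 1) m) * (X * psi (-1) m * (3 * psi (-κ) m)) =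
        3 * B * X * psi (q - κ) m := by
      have : psi (q - κ) m = psi (q + 1) m * psi (-1) m * psi (-κ) m := by
        rw [psi_mul, psi_mul]; congr 1; ring
      rw [this]; ring
    have e6 : psi q m ≤ psi (q - κ) m := psi_anti_exp (by linarith) m
    have e7 : B * a * psi q m ≤ 3 * B * a * psi (q - κ) m := by
      have : 0 ≤ B * a := by positivity
      have := mul_le_mul_of_nonneg_left e6 this
      have : 0 ≤ B * a * psi (q - κ) m := mul_nonneg (by positivity) (psi_nonneg _ _)
      linarith
    calc _ ≤ psi (-1) m * (3 * B * (X + a) * psi (q - κ) m) := by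
          refine mul_le_mul (cast_le_psi_neg_one m) ?_ (abs_nonneg _) (psi_nonneg _ _)
          rw [e5] at e4
          linarith
      _ = _ := by
          have : psi (q - κ - 1) m = psi (-1) m * psi (q - κ) m := by
            rw [psi_mul]; congr 1; ring
          rw [this]; ring
  refine (Finset.sum_le_sum h1).trans ?_
  rw [← Finset.mul_sum]
  have h2 := sum_psi_sub_one_le (r := q - κ) hδ'1 hqκ N
  have := mul_le_mul_of_nonneg_left h2 (by positivity : 0 ≤ 3 * B * (X + a))
  linarith

theorem tail_first_moment_le (hq : 1 < q) {u₀ : ℕ → ℝ}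
    (hu : ∀ m, |u₀ m| ≤ B * psi (q + 1) m) (N : ℕ) :
    |∑' m : ℕ, (m : ℝ) * u₀ m - ∑ m ∈ Finset.range (N + 1), (m : ℝ) * u₀ m| ≤
      B * (q - 1)⁻¹ * psi (q - 1) N := by
  have h : ∀ m : ℕ, |(m : ℝ) * u₀ m| ≤ B * psi q m := by
    intro m
    rw [abs_mul, Nat.abs_cast]
    have e1 := succ_mul_psi (q + 1) m
    rw [add_sub_cancel_right] at e1
    calc _ ≤ ((m : ℝ) + 1) * (B * psi (q + 1) m) :=
          mul_le_mul (by linarith) (hu m) (abs_nonneg _) (by positivity)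
      _ = _ := by rw [← e1]; ring
  refine abs_tsum_sub_sum_le (s := q - 1) (by linarith) (fun i _ => ?_) (summable_of_le_psi hq h)
  rw [sub_add_cancel]
  exact h i

variable {g₀ e₀ γ f g e : ℕ → ℝ} {T A v : ℝ}

theorem abs_mul_sum_le {B : ℝ} {s : Finset ℕ} {u w : ℕ → ℝ} (h : ∀ m ∈ s, |u m| ≤ B * w m) :
    |∑ m ∈ s, u m| ≤ B * ∑ m ∈ s, w m := by
  rw [Finset.mul_sum]
  exact (Finset.abs_sum_le_sum_abs _ _).trans (Finset.sum_le_sum h)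

/-- The remainder in the linearisation of the tilted mass. -/
theorem tilted_mass_linearise (hκ : 0 ≤ κ) (hδ'1 : δ' ≤ 1) (hδ'0 : 0 ≤ δ')
    (hqκ : 1 < q - κ - δ') (hB : 0 ≤ B) (ha : 0 ≤ a) (hX : |x| ≤ X)
    (hexp : ∀ m ≤ N, Real.exp (X * m) ≤ 3 * psi (-κ) m)
    (hL : LimitData q B g₀ e₀ γ T A v) (h : LocalData q δ' B b a g₀ e₀ γ f g e) :
    |(∑ m ∈ Finset.range (N + 1), g m * Real.exp (x * m)) - 1 - (x - v * a) * T| ≤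
      3 * B * psiSum (q - κ - δ') * X * ((X + a) * ((N : ℝ) + 1) ^ (1 - δ')) +
      X * (B * (q - 1)⁻¹ * psi (q - 1) N) + B * a ^ (1 + δ') * psiSum (q - κ - δ') +
      a * (B * (q - 1)⁻¹ * psi (q - 1) N) + B * q⁻¹ * psi q N := by
  have hX0 : 0 ≤ X := (abs_nonneg x).trans hX
  have hq : 1 < q := by linarith
  set S := psiSum (q - κ - δ') with hS
  set P := ((N : ℝ) + 1) ^ (1 - δ') with hP
  have hS0 : 0 ≤ S := psiSum_nonneg _
  have hP0 : 0 ≤ P := by positivity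
  have t1 : |∑ m ∈ Finset.range (N + 1), g m * (Real.exp (x * m) - 1 - x * m)| ≤
      3 * B * X ^ 2 * (P * S) := by
    refine (abs_mul_sum_le (w := fun m => psi (q - κ - 1) m) (B := 3 * B * X ^ 2) ?_).trans ?_
    · intro m hm
      have hm' : m ≤ N := by rw [Finset.mem_range] at hm; omega
      rw [abs_mul]
      have e3 : |x * m| ≤ X * m := by
        rw [abs_mul, Nat.abs_cast]
        exact mul_le_mul_of_nonneg_right hX m.cast_nonneg
      have e4 : (x * m) ^ 2 ≤ X ^ 2 * psi (-1) m ^ 2 := by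
        rw [← sq_abs, ← mul_pow]
        exact pow_le_pow_left₀ (abs_nonneg _)
          (e3.trans (mul_le_mul_of_nonneg_left (cast_le_psi_neg_one m) hX0)) 2
      have e5 := (abs_exp_sub_one_sub_le (x * m)).trans
        (mul_le_mul e4 ((Real.exp_le_exp.2 e3).trans (hexp m hm')) (Real.exp_pos _).le
          (by positivity))
      refine (mul_le_mul (h.g_le m) e5 (abs_nonneg _)
        (mul_nonneg hB (psi_nonneg _ _))).trans (le_of_eq ?_)
      have : psi (q - κ - 1) m = psi (q + 1) m * (psi (-1) m * psi (-1) m * psi (-κ) m) := by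
        rw [psi_mul, psi_mul, psi_mul]; congr 1; ring
      rw [this]; ring
    · exact mul_le_mul_of_nonneg_left (sum_psi_sub_one_le (r := q - κ) hδ'1 hqκ N) (by positivity)
  have t2 : |∑ m ∈ Finset.range (N + 1), (m : ℝ) * (g m - g₀ m)| ≤ B * a * (P * S) := by
    refine (abs_mul_sum_le (w := fun m => psi (q - κ - 1) m) (B := B * a) ?_).trans ?_
    · intro m _
      rw [abs_mul, Nat.abs_cast]
      have e1 : psi (q - 1) m ≤ psi (q - κ - 1) m := psi_anti_exp (by linarith) m
      calc _ ≤ psi (-1) m * (B * a * psi q m) :=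
            mul_le_mul (cast_le_psi_neg_one m) (h.g_sub m) (abs_nonneg _) (psi_nonneg _ _)
        _ = B * a * psi (q - 1) m := by
            have : psi (q - 1) m = psi (-1) m * psi q m := by rw [psi_mul]; congr 1; ring
            rw [this]; ring
        _ ≤ _ := mul_le_mul_of_nonneg_left e1 (by positivity)
    · exact mul_le_mul_of_nonneg_left (sum_psi_sub_one_le (r := q - κ) hδ'1 hqκ N) (by positivity)
  have t3 := tail_first_moment_le hq hL.g_le N
  rw [← hL.T_eq] at t3
  have t4 : |∑ m ∈ Finset.range (N + 1), (g m - g₀ m - a * γ m)| ≤ B * a ^ (1 + δ') * S := by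
    refine (abs_mul_sum_le fun m _ => h.g_taylor m).trans ?_
    refine mul_le_mul_of_nonneg_left ?_ (by positivity)
    refine (sum_psi_le (by linarith) _).trans (psiSum_anti hqκ (by linarith))
  have t5 : |∑' m, γ m - ∑ m ∈ Finset.range (N + 1), γ m| ≤ B * (q - 1)⁻¹ * psi (q - 1) N := by
    refine abs_tsum_sub_sum_le (by linarith) (fun i _ => ?_) (summable_of_le_psi hq hL.γ_le)
    rw [sub_add_cancel]; exact hL.γ_le i
  have t6 : |1 - ∑ m ∈ Finset.range (N + 1), g₀ m| ≤ B * q⁻¹ * psi q N := by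
    have := abs_tsum_sub_sum_le (by linarith) (fun i _ => hL.g_le i) hL.sum_g.summable (n := N)
    rwa [hL.sum_g.tsum_eq] at this
  rw [hL.v_eq] at t5
  -- Six sources of error, in order: the second-order remainder of the exponential; the change of
  -- the first moment when g₀ is replaced by g; the truncated first moment; the Taylor remainder of
  -- g in a; the truncated sum of γ; the truncated mass of g₀.
  have id : (∑ m ∈ Finset.range (N + 1), g m * Real.exp (x * m)) - 1 - (x - v * a) * T =
      (∑ m ∈ Finset.range (N + 1), g m * (Real.exp (x * m) - 1 - x * m)) +
      x * (∑ m ∈ Finset.range (N + 1), (m : ℝ) * (g m - g₀ m)) -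
      x * (T - ∑ m ∈ Finset.range (N + 1), (m : ℝ) * g₀ m) +
      (∑ m ∈ Finset.range (N + 1), (g m - g₀ m - a * γ m)) -
      a * (-(v * T) - ∑ m ∈ Finset.range (N + 1), γ m) -
      (1 - ∑ m ∈ Finset.range (N + 1), g₀ m) := by
    have e1 : (∑ m ∈ Finset.range (N + 1), g m * (Real.exp (x * m) - 1 - x * m)) =
        (∑ m ∈ Finset.range (N + 1), g m * Real.exp (x * m)) -
        (∑ m ∈ Finset.range (N + 1), g m) - x * ∑ m ∈ Finset.range (N + 1), (m : ℝ) * g m := by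
      rw [Finset.mul_sum, ← Finset.sum_sub_distrib, ← Finset.sum_sub_distrib]
      exact Finset.sum_congr rfl fun m _ => by ring
    have e2 : (∑ m ∈ Finset.range (N + 1), (m : ℝ) * (g m - g₀ m)) =
        (∑ m ∈ Finset.range (N + 1), (m : ℝ) * g m) -
        ∑ m ∈ Finset.range (N + 1), (m : ℝ) * g₀ m := by
      rw [← Finset.sum_sub_distrib]
      exact Finset.sum_congr rfl fun m _ => by ring
    have e3 : (∑ m ∈ Finset.range (N + 1), (g m - g₀ m - a * γ m)) =
        (∑ m ∈ Finset.range (N + 1), g m) - (∑ m ∈ Finset.range (N + 1), g₀ m) -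
        a * ∑ m ∈ Finset.range (N + 1), γ m := by
      rw [Finset.mul_sum, ← Finset.sum_sub_distrib, ← Finset.sum_sub_distrib]
    rw [e1, e2, e3]
    ring
  rw [id]
  set s1 := ∑ m ∈ Finset.range (N + 1), g m * (Real.exp (x * m) - 1 - x * m)
  set s2 := ∑ m ∈ Finset.range (N + 1), (m : ℝ) * (g m - g₀ m)
  set s3 := T - ∑ m ∈ Finset.range (N + 1), (m : ℝ) * g₀ m
  set s4 := ∑ m ∈ Finset.range (N + 1), (g m - g₀ m - a * γ m)
  set s5 := -(v * T) - ∑ m ∈ Finset.range (N + 1), γ m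
  set s6 := 1 - ∑ m ∈ Finset.range (N + 1), g₀ m
  have m2 : |x * s2| ≤ X * (B * a * (P * S)) := by
    rw [abs_mul]; exact mul_le_mul hX t2 (abs_nonneg _) hX0
  have m3 : |x * s3| ≤ X * (B * (q - 1)⁻¹ * psi (q - 1) N) := by
    rw [abs_mul]; exact mul_le_mul hX t3 (abs_nonneg _) hX0
  have m5 : |a * s5| ≤ a * (B * (q - 1)⁻¹ * psi (q - 1) N) := by
    rw [abs_mul, abs_of_nonneg ha]; exact mul_le_mul_of_nonneg_left t5 ha
  have hXa : X * (B * a * (P * S)) ≤ 3 * B * S * X * (a * P) := by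
    have : 0 ≤ X * (B * a * (P * S)) := by positivity
    linarith
  rw [abs_le] at *
  constructor <;> linarith [t1.1, t1.2, t4.1, t4.2, t6.1, t6.2, m2.1, m2.2, m3.1, m3.2, m5.1, m5.2]

end
end LaceExpansion
end

/-! ### Windows of size log N / N, and renewal sequences after tilting -/

noncomputable section
namespace LaceExpansion

open PowerSeries (coeff constantCoeff)

theorem tendsto_psi {s : ℝ} (hs : 0 < s) : Tendsto (psi s) atTop (𝓝 0) :=
  (tendsto_rpow_neg_atTop hs).comp
    (tendsto_atTop_add_const_right _ _ tendsto_natCast_atTop_atTop)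

/-- A logarithm costs an arbitrarily small power. -/
theorem log_mul_psi_le {s t : ℝ} (h : t < s) (N : ℕ) :
    Real.log N * psi s N ≤ (s - t)⁻¹ * psi t N := by
  have h1 : Real.log N ≤ (s - t)⁻¹ * psi (-(s - t)) N := by
    have h2 : Real.log N ≤ Real.log ((N : ℝ) + 1) := by
      rcases Nat.eq_zero_or_pos N with h0 | h0
      · subst h0; simp
      · exact Real.log_le_log (by exact_mod_cast h0) (by linarith)
    have h3 := Real.log_le_rpow_div (by positivity : (0 : ℝ) ≤ (N : ℝ) + 1) (sub_pos.2 h)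
    refine h2.trans (h3.trans (le_of_eq ?_))
    rw [psi, neg_neg]; ring
  refine (mul_le_mul_of_nonneg_right h1 (psi_nonneg s N)).trans (le_of_eq ?_)
  rw [mul_assoc, psi_mul]
  congr 2
  ring

/-- The gap between δ and δ' absorbs the logarithm in (log N / N)^{δ'}. This is why slightly more
regularity than δ is carried throughout. -/
theorem inv_log_rpow_le {δ δ' : ℝ} (hδ : 0 < δ) (h : δ < δ') {N : ℕ} (hN : 1 ≤ N) :
    ((N : ℝ)⁻¹ * Real.log N) ^ δ' ≤ (2 * (1 - δ / δ')⁻¹) ^ δ' * psi δ N := by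
  have hδ' : 0 < δ' := hδ.trans h
  have hN0 : (1 : ℝ) ≤ N := by exact_mod_cast hN
  have hlog : 0 ≤ Real.log N := Real.log_nonneg hN0
  have h1 := log_mul_psi_le (s := 1) (t := δ / δ') (by rwa [div_lt_one hδ']) N
  have h2 : (N : ℝ)⁻¹ ≤ 2 * psi 1 N := by
    rw [psi, Real.rpow_neg_one, ← div_eq_mul_inv, le_div_iff₀ (by positivity),
      inv_mul_le_iff₀ (by linarith)]
    linarith
  have h3 : (N : ℝ)⁻¹ * Real.log N ≤ 2 * (1 - δ / δ')⁻¹ * psi (δ / δ') N := by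
    have := mul_le_mul_of_nonneg_right h2 hlog
    linarith
  have h4 : 0 ≤ (1 - δ / δ')⁻¹ := by
    rw [inv_nonneg, sub_nonneg, div_le_one hδ']; exact h.le
  refine (Real.rpow_le_rpow (by positivity) h3 hδ'.le).trans (le_of_eq ?_)
  rw [Real.mul_rpow (by positivity) (psi_nonneg _ _)]
  congr 1
  rw [psi, psi, ← Real.rpow_mul (by positivity)]
  congr 1
  field_simp

/-- For m ≤ N, m log N / N = (m/N) log m + (m/N) log(N/m) ≤ log m + 1. A tilt within κ log N / N
therefore costs only the polynomial factor e(m+1)^κ, uniformly in N, and e < 3. -/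
theorem exp_mul_le_psi {κ X : ℝ} (hκ : 0 ≤ κ) (hκ1 : κ ≤ 1) {N : ℕ}
    (hX : X ≤ κ * ((N : ℝ)⁻¹ * Real.log N)) {m : ℕ} (hm : m ≤ N) :
    Real.exp (X * m) ≤ 3 * psi (-κ) m := by
  rcases Nat.eq_zero_or_pos m with h0 | h0
  · subst h0; simp [psi_zero]
  · have hm0 : (1 : ℝ) ≤ m := by exact_mod_cast h0
    have hmN : (m : ℝ) ≤ N := by exact_mod_cast hm
    have hN0 : (0 : ℝ) < N := by linarith
    have h1 : (N : ℝ)⁻¹ * Real.log N * m ≤ Real.log m + 1 := by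
      have e1 : Real.log N = Real.log m + Real.log (N / m) := by
        rw [Real.log_div (by positivity) (by positivity)]; ring
      have e2 := Real.log_le_sub_one_of_pos (by positivity : (0 : ℝ) < N / m)
      have e3 : (0 : ℝ) ≤ (N : ℝ)⁻¹ * m := by positivity
      have e4 : (N : ℝ)⁻¹ * m ≤ 1 := by rw [inv_mul_le_iff₀ hN0]; linarith
      have e5 : (N : ℝ)⁻¹ * m * Real.log (N / m) ≤ 1 := by
        calc _ ≤ (N : ℝ)⁻¹ * m * (N / m) := mul_le_mul_of_nonneg_left (by linarith) e3
          _ = 1 := by field_simp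
      have e6 := mul_le_mul_of_nonneg_right e4 (Real.log_nonneg hm0)
      rw [e1]
      linarith
    have h2 : X * m ≤ κ * Real.log ((m : ℝ) + 1) + 1 := by
      have e1 := mul_le_mul_of_nonneg_right hX m.cast_nonneg (α := ℝ)
      have e2 := mul_le_mul_of_nonneg_left h1 hκ
      have e3 : Real.log m ≤ Real.log ((m : ℝ) + 1) := Real.log_le_log (by linarith) (by linarith)
      have e4 := mul_le_mul_of_nonneg_left e3 hκ
      linarith
    refine (Real.exp_le_exp.2 h2).trans ?_
    rw [Real.exp_add, psi, neg_neg, Real.rpow_def_of_pos (by positivity), mul_comm 3,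
      mul_comm κ]
    refine mul_le_mul_of_nonneg_left ?_ (Real.exp_pos _).le
    linarith [Real.exp_one_lt_d9]

section
variable {q δ δ' κ B b a X x : ℝ} {N : ℕ} {g₀ e₀ γ f g e : ℕ → ℝ} {T A v : ℝ}

/-- Asymptotics of a renewal sequence whose kernel becomes critical after tilting by `x`. -/
theorem tilted_renewal {M : ℝ} (hb : 0 ≤ b) (hM : 0 ≤ M) (hr : 1 < q - κ)
    (hsmall : 2 * convC (q - κ) * (M * b) ≤ 1) (hX : |x| ≤ X)
    (hexp : ∀ m ≤ N, Real.exp (X * m) ≤ M * psi (-κ) m) (hf : RenewalSeq f g e)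
    (hg : ∀ m, 2 ≤ m → |g m| ≤ b * psi (q + 1) m) (he : ∀ m, |e m| ≤ b * psi (q + 1) m)
    (hroot : ∑ m ∈ Finset.range (N + 1), g m * Real.exp (x * m) = 1) :
    ∃ A' : ℝ, |A' - 1| ≤ 4 * (M * b) * psiSum (q - κ) ∧
      A' * (∑ m ∈ Finset.range (N + 1), (m : ℝ) * (g m * Real.exp (x * m))) =
        1 + ∑ m ∈ Finset.range (N + 1), e m * Real.exp (x * m) ∧
      |f N * Real.exp (x * N) - A'| ≤ 4 * (M * b) * (q - κ - 1)⁻¹ * psi (q - κ - 1) N := by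
  -- Truncation at N makes the tilted kernel exactly critical by `hroot`, and makes every series
  -- finite.
  set g' : ℕ → ℝ := fun m => if m ≤ N then g m * Real.exp (x * m) else 0 with hg'
  set e' : ℕ → ℝ := fun m => if m ≤ N then e m * Real.exp (x * m) else 0 with he'
  have hg0 : g' 0 = 0 := by simp [hg', hf.g_zero]
  have he0 : e' 0 = 0 := by simp [he', hf.e_zero]
  obtain ⟨f', hf'⟩ := exists_renewalSeq hg0 he0
  have hMb : 0 ≤ M * b := by positivity
  have htilt : ∀ m ≤ N, ∀ w : ℝ, |w| ≤ b * psi (q + 1) m →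
      |w * Real.exp (x * m)| ≤ M * b * psi (q - κ + 1) m := by
    intro m hm w hw
    rw [abs_mul, Real.abs_exp]
    have e1 : x * m ≤ X * m :=
      mul_le_mul_of_nonneg_right ((le_abs_self x).trans hX) m.cast_nonneg
    refine (mul_le_mul hw ((Real.exp_le_exp.2 e1).trans (hexp m hm)) (Real.exp_pos _).le
      (mul_nonneg hb (psi_nonneg _ _))).trans (le_of_eq ?_)
    have : psi (q - κ + 1) m = psi (q + 1) m * psi (-κ) m := by
      rw [psi_mul]; congr 1; ring
    rw [this]; ring
  have hsumg : ∀ j, j ≤ N → ∑ m ∈ Finset.range (j + 1), g' m =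
      ∑ m ∈ Finset.range (j + 1), g m * Real.exp (x * m) := by
    intro j hj
    refine Finset.sum_congr rfl fun m hm => ?_
    rw [Finset.mem_range] at hm
    rw [hg']
    exact if_pos (by omega)
  have hfin : ∀ (u : ℕ → ℝ) (c : ℕ → ℝ), (∀ m, ¬ m ≤ N → u m = 0) →
      Summable (fun m => c m * u m) ∧
      ∑' m, c m * u m = ∑ m ∈ Finset.range (N + 1), c m * u m := by
    intro u c hu
    have h0 : ∀ m ∉ Finset.range (N + 1), c m * u m = 0 := fun m hm => by
      rw [hu m (by rw [Finset.mem_range] at hm; omega), mul_zero]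
    exact ⟨summable_of_ne_finset_zero h0, tsum_eq_sum h0⟩
  have hsumgz : ∀ m, ¬ m ≤ N → g' m = 0 := fun m hm => if_neg hm
  have hsumez : ∀ m, ¬ m ≤ N → e' m = 0 := fun m hm => if_neg hm
  have hnc : ∀ N', NearCritical (q - κ) (M * b) N' g' e' := by
    intro N'
    refine ⟨fun j hj _ => ?_, fun j hj _ => ?_⟩
    · have e1 : 1 - ∑ m ∈ Finset.range (j + 1), g' m = ∑ m ∈ Finset.Ioc j N, g' m := by
        rcases le_total j N with h | h
        · rw [← hroot, ← hsumg N le_rfl, ← Finset.sum_Ico_eq_sub _ (by omega)]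
          refine Finset.sum_congr ?_ fun _ _ => rfl
          ext i
          simp only [Finset.mem_Ico, Finset.mem_Ioc]
          omega
        · rw [Finset.Ioc_eq_empty_of_le h, Finset.sum_empty, sub_eq_zero, ← hroot,
            ← hsumg N le_rfl]
          refine Finset.sum_subset (Finset.range_subset_range.2 (by omega)) fun m _ hm => ?_
          rw [Finset.mem_range] at hm
          exact hsumgz m (by omega)
      rw [e1]
      refine (abs_mul_sum_le (w := psi (q - κ + 1)) (B := M * b) ?_).trans ?_
      · intro m hm
        rw [Finset.mem_Ioc] at hm
        rw [hg']
        simp only [if_pos hm.2]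
        exact htilt m hm.2 _ (hg m (by omega))
      · refine mul_le_mul_of_nonneg_left ?_ hMb
        refine (sum_Ioc_psi_le (by linarith) j N).trans ?_
        refine mul_le_of_le_one_left (psi_nonneg _ _) (inv_le_one_of_one_le₀ hr.le)
    · rw [he']
      simp only
      split_ifs with h
      · refine (htilt j h _ (he j)).trans ?_
        exact mul_le_mul_of_nonneg_left (psi_anti_exp (by linarith) j) hMb
      · rw [abs_zero]
        exact mul_nonneg hMb (psi_nonneg _ _)
  obtain ⟨A', h1, h2, h3, -, -⟩ := renewal_asymptotics hr hnc hMb hsmall hf'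
    (hfin g' (fun m => (m : ℝ)) hsumgz).1
  refine ⟨A', h1, ?_, ?_⟩
  · rw [(hfin g' (fun m => (m : ℝ)) hsumgz).2] at h2
    have h4 := (hfin e' (fun _ => 1) hsumez).2
    simp only [one_mul] at h4
    rw [h4] at h2
    have e1 : ∑ m ∈ Finset.range (N + 1), (m : ℝ) * g' m =
        ∑ m ∈ Finset.range (N + 1), (m : ℝ) * (g m * Real.exp (x * m)) := by
      refine Finset.sum_congr rfl fun m hm => ?_
      rw [Finset.mem_range] at hm
      simp only [hg', if_pos (by omega : m ≤ N)]
    have e2 : ∑ m ∈ Finset.range (N + 1), e' m =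
        ∑ m ∈ Finset.range (N + 1), e m * Real.exp (x * m) := by
      refine Finset.sum_congr rfl fun m hm => ?_
      rw [Finset.mem_range] at hm
      simp only [he', if_pos (by omega : m ≤ N)]
    rw [← e1, ← e2]
    exact h2
  -- Tilting f, g and e by the same exponential preserves the recursion.
  · have hft : RenewalSeq (fun n => f n * Real.exp (x * n)) (fun n => g n * Real.exp (x * n))
        (fun n => e n * Real.exp (x * n)) := by
      refine ⟨by simp [hf.f_zero], by simp [hf.g_zero], by simp [hf.e_zero], fun n => ?_⟩
      rw [hf.step, add_mul, Finset.sum_mul]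
      congr 1
      refine Finset.sum_congr rfl fun m hm => ?_
      rw [Finset.mem_Icc] at hm
      have : Real.exp (x * (n + 1 : ℕ)) = Real.exp (x * m) * Real.exp (x * (n + 1 - m : ℕ)) := by
        rw [← Real.exp_add]
        congr 1
        rw [Nat.cast_sub hm.2]
        ring
      rw [this]; ring
    have := hft.eq_of_agree hf' (N := N) (fun m hm => by simp only [hg', if_pos hm])
      (fun m hm => by simp only [he', if_pos hm]) N le_rfl
    rw [this]
    exact h3 N

end
end LaceExpansion
end

/-! ### Existence of the critical tilt and local asymptotics -/

noncomputable section
namespace LaceExpansion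

section
variable {q δ δ' κ B b a X x : ℝ} {N : ℕ} {g₀ e₀ γ f g e : ℕ → ℝ} {T A v : ℝ}

/-- Multiplying the window log N / N by N^{1-δ'} gives N^{-δ'} log N, which is O(N^{-δ}). -/
theorem tilt_window_le (hκ : κ ≤ 1) (hδδ' : δ < δ') (hN : 1 ≤ N)
    (hX : X ≤ κ * ((N : ℝ)⁻¹ * Real.log N)) (ha : a ≤ κ * ((N : ℝ)⁻¹ * Real.log N)) :
    (X + a) * ((N : ℝ) + 1) ^ (1 - δ') ≤ 4 * ((δ' - δ)⁻¹ * psi δ N) := by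
  have hN0 : (1 : ℝ) ≤ N := by exact_mod_cast hN
  have hlog : 0 ≤ Real.log N := Real.log_nonneg hN0
  have h1 : X + a ≤ 2 * ((N : ℝ)⁻¹ * Real.log N) := by
    have : 0 ≤ (N : ℝ)⁻¹ * Real.log N := by positivity
    have := mul_le_mul_of_nonneg_right hκ this
    linarith
  have h2 : ((N : ℝ) + 1) ^ (1 - δ') = ((N : ℝ) + 1) * psi δ' N := by
    rw [succ_mul_psi, psi]; congr 1; ring
  have h3 : (N : ℝ)⁻¹ * ((N : ℝ) + 1) ≤ 2 := by
    rw [inv_mul_le_iff₀ (by linarith)]; linarith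
  have h4 := log_mul_psi_le hδδ' N
  have hψ := psi_nonneg δ' N
  rw [h2]
  calc _ ≤ 2 * ((N : ℝ)⁻¹ * Real.log N) * (((N : ℝ) + 1) * psi δ' N) :=
        mul_le_mul_of_nonneg_right h1 (by positivity)
    _ = 2 * ((N : ℝ)⁻¹ * ((N : ℝ) + 1)) * (Real.log N * psi δ' N) := by ring
    _ ≤ 2 * 2 * (Real.log N * psi δ' N) := by gcongr
    _ ≤ _ := by linarith

/-- The tilted mass minus 1 is (x - va)T up to an error of at most ΔT for |x| ≤ va + Δ. It is
therefore nonpositive at va - Δ and nonnegative at va + Δ, and the intermediate value theorem gives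
a root. The bound κ/5 on the window ensures va + Δ ≤ 3a + (κ/5)ℓ ≤ κℓ with ℓ = log N / N, as v ≤ 2.
-/
theorem exists_tilt (hδ : 0 < δ) (hδδ' : δ < δ') (hδ'1 : δ' ≤ 1) (hκ : 0 < κ) (hκ1 : κ ≤ 1)
    (hqκ : 1 < q - κ - δ') (hB : 0 ≤ B) (hT : 0 < T) (hv : 0 ≤ v) (hv2 : v ≤ 2)
    (hL : LimitData q B g₀ e₀ γ T A v) :
    ∃ C : ℝ, 0 ≤ C ∧ ∃ n₀ : ℕ, ∀ N ≥ n₀, 2 ≤ N ∧ C * psi δ N ≤ 1 ∧ C * psi (q - 1) N ≤ 1 ∧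
      ∀ a, 0 ≤ a → a ≤ κ / 5 * ((N : ℝ)⁻¹ * Real.log N) →
      ∀ f g e, LocalData q δ' B b a g₀ e₀ γ f g e →
      (v * a + C * (a * psi δ N + psi q N) ≤ κ * ((N : ℝ)⁻¹ * Real.log N)) ∧
      ∃ x, |x - v * a| ≤ C * (a * psi δ N + psi q N) ∧
        ∑ m ∈ Finset.range (N + 1), g m * Real.exp (x * m) = 1 := by
  set S := psiSum (q - κ - δ') with hS
  set cL := (δ' - δ)⁻¹ with hcL
  set cP := (2 * (1 - δ / δ')⁻¹) ^ δ' with hcP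
  have hδ' : 0 < δ' := hδ.trans hδδ'
  have hq : 1 < q := by linarith
  have hS0 : 0 ≤ S := psiSum_nonneg _
  have hcL0 : 0 ≤ cL := inv_nonneg.2 (by linarith)
  have hcP0 : 0 ≤ cP := by
    refine Real.rpow_nonneg (mul_nonneg two_pos.le ?_) _
    rw [inv_nonneg, sub_nonneg, div_le_one hδ']; exact hδδ'.le
  have hq1 : 0 ≤ (q - 1)⁻¹ := inv_nonneg.2 (by linarith)
  have hq0 : 0 ≤ q⁻¹ := inv_nonneg.2 (by linarith)
  set C3 := 12 * B * S * cL + B * (q - 1)⁻¹ + B * S * cP + B * q⁻¹ with hC3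
  have hC30 : 0 ≤ C3 := by positivity
  -- The error is at most C3 times Xψ + aψ + psi q N with ψ = psi δ N; Xψ ≤ 3aψ + psi q N turns this
  -- into a multiple 4 of aψ + psi q N.
  set C := 4 * C3 / T with hC
  have hC0 : 0 ≤ C := by positivity
  have hlog2 : 0 < Real.log 2 := Real.log_pos (by norm_num)
  have ev1 : ∀ᶠ N in atTop, C * psi δ N ≤ 1 := by
    have := (tendsto_psi hδ).const_mul C
    rw [mul_zero] at this
    exact this.eventually_le_const one_pos
  -- The bound involving log 2 makes C psi q N ≤ (κ/5) log N / N, since psi q N ≤ psi (q - 1) N / N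
  -- and N ≥ 2.
  have ev2 : ∀ᶠ N in atTop, C * psi (q - 1) N ≤ min 1 (κ / 5 * Real.log 2) := by
    have := (tendsto_psi (by linarith : 0 < q - 1)).const_mul C
    rw [mul_zero] at this
    exact this.eventually_le_const (lt_min one_pos (by positivity))
  obtain ⟨n₀, hn₀⟩ := eventually_atTop.1 (ev1.and (ev2.and (eventually_ge_atTop 2)))
  refine ⟨C, hC0, n₀, fun N hN => ?_⟩
  obtain ⟨h1, h2, h3⟩ := hn₀ N hN
  refine ⟨h3, h1, h2.trans (min_le_left _ _), ?_⟩
  intro a ha0 ha f g e h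
  have hN0 : (2 : ℝ) ≤ N := by exact_mod_cast h3
  have hlogN : Real.log 2 ≤ Real.log N := Real.log_le_log (by norm_num) hN0
  set ℓ := (N : ℝ)⁻¹ * Real.log N with hℓ
  have hℓ0 : 0 ≤ ℓ := mul_nonneg (by positivity) (by linarith)
  have hψq : C * psi q N ≤ κ / 5 * ℓ := by
    have e1 : psi q N ≤ (N : ℝ)⁻¹ * psi (q - 1) N := by
      rw [← succ_mul_psi, ← mul_assoc]
      refine le_mul_of_one_le_left (psi_nonneg _ _) ?_
      rw [inv_mul_eq_div, one_le_div (by linarith)]; linarith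
    calc _ ≤ C * ((N : ℝ)⁻¹ * psi (q - 1) N) := mul_le_mul_of_nonneg_left e1 hC0
      _ = (N : ℝ)⁻¹ * (C * psi (q - 1) N) := by ring
      _ ≤ (N : ℝ)⁻¹ * (κ / 5 * Real.log 2) :=
          mul_le_mul_of_nonneg_left (h2.trans (min_le_right _ _)) (by positivity)
      _ ≤ (N : ℝ)⁻¹ * (κ / 5 * Real.log N) := by gcongr
      _ = _ := by rw [hℓ]; ring
  have hψδ := psi_nonneg δ N
  have hψq0 := psi_nonneg q N
  set Δ := C * (a * psi δ N + psi q N) with hΔ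
  have hΔ0 : 0 ≤ Δ := by positivity
  have hva : 0 ≤ v * a := by positivity
  have hva2 : v * a ≤ 2 * a := mul_le_mul_of_nonneg_right hv2 ha0
  have hΔle : Δ ≤ a + C * psi q N := by
    have := mul_le_mul_of_nonneg_left h1 ha0
    rw [hΔ]; linarith
  set X := v * a + Δ with hX
  have hXle : X ≤ 3 * a + C * psi q N := by linarith
  have hXκ : X ≤ κ * ℓ := by
    have : 0 ≤ κ * ℓ := by positivity
    linarith
  refine ⟨hXκ, ?_⟩
  have hexp : ∀ m ≤ N, Real.exp (X * m) ≤ 3 * psi (-κ) m := fun m hm =>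
    exp_mul_le_psi hκ.le hκ1 hXκ hm
  have haκ : a ≤ κ * ℓ := by
    have : 0 ≤ κ * ℓ := by positivity
    linarith
  have hw := tilt_window_le hκ1 hδδ' (by omega) hXκ haκ
  have hψ1 : psi (q - 1) N ≤ psi δ N := psi_anti_exp (by linarith) N
  have hapow : a ^ (1 + δ') ≤ a * (cP * psi δ N) := by
    rw [Real.rpow_add_of_nonneg ha0 one_pos.le hδ'.le, Real.rpow_one]
    refine mul_le_mul_of_nonneg_left ?_ ha0
    refine (Real.rpow_le_rpow ha0 ?_ hδ'.le).trans (inv_log_rpow_le hδ hδδ' (by omega))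
    have : κ * ℓ ≤ 1 * ℓ := mul_le_mul_of_nonneg_right hκ1 hℓ0
    rw [← hℓ]; linarith
  have hX0 : 0 ≤ X := by positivity
  have hR : ∀ x, |x| ≤ X → |(∑ m ∈ Finset.range (N + 1), g m * Real.exp (x * m)) - 1 -
      (x - v * a) * T| ≤ Δ * T := by
    intro x hx
    refine (tilted_mass_linearise hκ.le hδ'1 hδ'.le hqκ hB ha0 hx hexp hL h).trans ?_
    rw [← hS]
    have t1 : 3 * B * S * X * ((X + a) * ((N : ℝ) + 1) ^ (1 - δ')) ≤
        12 * B * S * cL * (X * psi δ N) := by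
      have := mul_le_mul_of_nonneg_left hw (by positivity : 0 ≤ 3 * B * S * X)
      linarith
    have t2 : X * (B * (q - 1)⁻¹ * psi (q - 1) N) ≤ B * (q - 1)⁻¹ * (X * psi δ N) := by
      have := mul_le_mul_of_nonneg_left hψ1 (by positivity : 0 ≤ X * (B * (q - 1)⁻¹))
      linarith
    have t3 : B * a ^ (1 + δ') * S ≤ B * S * cP * (a * psi δ N) := by
      have := mul_le_mul_of_nonneg_left hapow (by positivity : 0 ≤ B * S)
      linarith
    have t4 : a * (B * (q - 1)⁻¹ * psi (q - 1) N) ≤ B * (q - 1)⁻¹ * (a * psi δ N) := by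
      have := mul_le_mul_of_nonneg_left hψ1 (by positivity : 0 ≤ a * (B * (q - 1)⁻¹))
      linarith
    have hXψ : X * psi δ N ≤ 3 * (a * psi δ N) + psi q N := by
      have e1 := mul_le_mul_of_nonneg_right hXle hψδ
      have e2 := mul_le_mul_of_nonneg_right h1 hψq0
      linarith
    have hTΔ : Δ * T = 4 * C3 * (a * psi δ N + psi q N) := by
      rw [hΔ, hC]; field_simp
    rw [hTΔ]
    set α := a * psi δ N with hα
    set ω := X * psi δ N with hω
    have hα0 : 0 ≤ α := by positivity
    have hω0 : 0 ≤ ω := by positivity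
    set k1 := 12 * B * S * cL with hk1
    set k2 := B * (q - 1)⁻¹ with hk2
    set k3 := B * S * cP with hk3
    set k4 := B * q⁻¹ with hk4
    have p1 : 0 ≤ k1 := by positivity
    have p2 : 0 ≤ k2 := by positivity
    have p3 : 0 ≤ k3 := by positivity
    have p4 : 0 ≤ k4 := by positivity
    have r1 := mul_le_mul_of_nonneg_left hXψ p1
    have r2 := mul_le_mul_of_nonneg_left hXψ p2
    have r3 := mul_nonneg p1 hα0
    have r4 := mul_nonneg p2 hα0
    have r5 := mul_nonneg p3 hα0
    have r6 := mul_nonneg p4 hα0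
    have r7 := mul_nonneg p1 hψq0
    have r8 := mul_nonneg p2 hψq0
    have r9 := mul_nonneg p3 hψq0
    have r10 := mul_nonneg p4 hψq0
    rw [hC3]
    linarith
  have hcont : ContinuousOn (fun x : ℝ => ∑ m ∈ Finset.range (N + 1), g m * Real.exp (x * m))
      (Set.Icc (v * a - Δ) (v * a + Δ)) := by
    fun_prop
  have hlo := hR (v * a - Δ) (by rw [abs_le]; constructor <;> linarith)
  have hhi := hR (v * a + Δ) (by rw [abs_le]; constructor <;> linarith)
  rw [abs_le] at hlo hhi
  have hmem : (1 : ℝ) ∈ Set.Icc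
      (∑ m ∈ Finset.range (N + 1), g m * Real.exp ((v * a - Δ) * m))
      (∑ m ∈ Finset.range (N + 1), g m * Real.exp ((v * a + Δ) * m)) :=
    ⟨by linarith [hlo.2], by linarith [hhi.1]⟩
  obtain ⟨x, hx, hx1⟩ := intermediate_value_Icc (by linarith) hcont hmem
  exact ⟨x, by rw [abs_le]; constructor <;> linarith [hx.1, hx.2], hx1⟩

set_option maxHeartbeats 1000000 in
/-- Local asymptotics `f_N ≈ A e^{-N v a}` for kernels near a critical one. -/
theorem local_asymptotics (hδ : 0 < δ) (hδδ' : δ < δ') (hδ'1 : δ' ≤ 1) (hκ : 0 < κ) (hκ1 : κ ≤ 1)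
    (hqκ : 1 < q - κ - δ') (hb : 0 ≤ b) (hbB : b ≤ B)
    (hs1 : 2 * convC q * (60 * b) ≤ 1) (hs2 : 2 * convC (q - κ) * (60 * b) ≤ 1)
    (hT : 0 < T) (hv : 0 ≤ v) (hv2 : v ≤ 2) (hL : LimitData q B g₀ e₀ γ T A v) :
    ∃ C : ℝ, 0 ≤ C ∧ ∃ n₀ : ℕ, ∀ N ≥ n₀, ∀ a, 0 ≤ a → a ≤ κ / 5 * ((N : ℝ)⁻¹ * Real.log N) →
      ∀ f g e, LocalData q δ' B b a g₀ e₀ γ f g e →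
      |f N - A * Real.exp (-(v * a * N))| ≤
        C * Real.exp (-(v * a * N)) * (N * a * psi δ N + psi (q - 1) N) := by
  have hB : 0 ≤ B := hb.trans hbB
  obtain ⟨C2, hC20, n₀, hn₀⟩ := exists_tilt (b := b) hδ hδδ' hδ'1 hκ hκ1 hqκ hB hT hv hv2 hL
  have hδ' : 0 < δ' := hδ.trans hδδ'
  have hq : 1 < q := by linarith
  set S := psiSum (q - κ - δ') with hS
  have hS0 : 0 ≤ S := psiSum_nonneg _
  have hq1 : 0 ≤ (q - 1)⁻¹ := inv_nonneg.2 (by linarith)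
  have hqκ1 : 0 ≤ (q - κ - 1)⁻¹ := inv_nonneg.2 (by linarith)
  have hq0 : 0 ≤ q⁻¹ := inv_nonneg.2 (by linarith)
  have hSκ := psiSum_nonneg (q - κ)
  set CA := 1 + 4 * (60 * b) * psiSum (q - κ) with hCA
  set c1 := 3 * B * S * (8 + C2) + B * (q - 1)⁻¹ with hc1
  set c2 := 3 * B * S * (8 + C2) + B * q⁻¹ with hc2
  set c3 := 4 * (60 * b) * ((q - 1)⁻¹ + (q - κ - 1)⁻¹) with hc3
  have hCA0 : 0 ≤ CA := by positivity
  have hc10 : 0 ≤ c1 := by positivity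
  have hc20 : 0 ≤ c2 := by positivity
  have hc30 : 0 ≤ c3 := by positivity
  set C6 := c3 + (c2 + CA * c1) / T with hC6
  have hC60 : 0 ≤ C6 := by positivity
  set Em := δ⁻¹ + 1 with hEm
  refine ⟨Real.exp (C2 * Em) * (|A| * C2 + C6), by positivity, n₀, ?_⟩
  intro N hN a ha0 ha f g e h
  obtain ⟨h2N, hCδ, hCq, hN'⟩ := hn₀ N hN
  obtain ⟨hXκ, x, hx, hroot⟩ := hN' a ha0 ha f g e h
  have hN0 : (2 : ℝ) ≤ N := by exact_mod_cast h2N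
  set ℓ := (N : ℝ)⁻¹ * Real.log N with hℓ
  have hlogN : 0 ≤ Real.log N := Real.log_nonneg (by linarith)
  have hℓ0 : 0 ≤ ℓ := by positivity
  have hψδ := psi_nonneg δ N
  have hψq0 := psi_nonneg q N
  have hψq1 := psi_nonneg (q - 1) N
  set Δ := C2 * (a * psi δ N + psi q N) with hΔ
  have hΔ0 : 0 ≤ Δ := by positivity
  have hva : 0 ≤ v * a := by positivity
  have hva2 : v * a ≤ 2 * a := mul_le_mul_of_nonneg_right hv2 ha0
  have hΔle : Δ ≤ a + C2 * psi q N := by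
    have := mul_le_mul_of_nonneg_left hCδ ha0
    rw [hΔ]; linarith
  set X := v * a + Δ with hX
  have hXle : X ≤ 3 * a + C2 * psi q N := by linarith
  have hxX : |x| ≤ X := by
    rw [abs_le] at hx ⊢
    constructor <;> linarith [hx.1, hx.2]
  have hX0 : 0 ≤ X := by positivity
  set E2 := N * a * psi δ N + psi (q - 1) N with hE2
  have hE20 : 0 ≤ E2 := by positivity
  have hNψ : ((N : ℝ) + 1) * psi q N = psi (q - 1) N := succ_mul_psi q N
  have hNΔ : N * Δ ≤ C2 * E2 := by
    have : (N : ℝ) * psi q N ≤ psi (q - 1) N := by rw [← hNψ]; linarith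
    have := mul_le_mul_of_nonneg_left this hC20
    rw [hΔ, hE2]; linarith
  -- In the window Na ≤ log N, and log N · N^{-δ} is bounded. Hence the exponent va N - xN stays
  -- bounded, and e^{-xN} may be replaced by e^{-vaN} at the cost of a constant.
  have hE2m : E2 ≤ Em := by
    have e1 := log_mul_psi_le hδ N
    rw [sub_zero] at e1
    have e2 : psi 0 N = 1 := by simp [psi]
    have e3 : N * a ≤ Real.log N := by
      have e4 : N * ℓ = Real.log N := by rw [hℓ]; field_simp
      have e5 : a ≤ ℓ := ha.trans (mul_le_of_le_one_left hℓ0 (by linarith))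
      calc _ ≤ N * ℓ := by gcongr
        _ = _ := e4
    have e6 := mul_le_mul_of_nonneg_right e3 hψδ
    have e7 : psi (q - 1) N ≤ 1 := psi_le_one (by linarith) N
    rw [hE2, hEm]
    rw [e2, mul_one] at e1
    linarith
  have hexp : ∀ m ≤ N, Real.exp (X * m) ≤ 3 * psi (-κ) m := fun m hm =>
    exp_mul_le_psi hκ.le hκ1 hXκ hm
  have hη : (X + a) * ((N : ℝ) + 1) ^ (1 - δ') ≤ (8 + C2) * E2 := by
    have e1 : ((N : ℝ) + 1) ^ (1 - δ') ≤ ((N : ℝ) + 1) * psi δ N := by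
      have e2 : ((N : ℝ) + 1) ^ (1 - δ') = ((N : ℝ) + 1) * psi δ' N := by
        rw [succ_mul_psi, psi]; congr 1; ring
      rw [e2]
      exact mul_le_mul_of_nonneg_left (psi_anti_exp hδδ'.le N) (by positivity)
    have hψ1 : psi δ N ≤ 1 := psi_le_one hδ.le N
    calc _ ≤ (4 * a + C2 * psi q N) * (((N : ℝ) + 1) * psi δ N) := by
          refine mul_le_mul (by linarith) e1 (by positivity) (by positivity)
      _ = 4 * (((N : ℝ) + 1) * a * psi δ N) + C2 * (((N : ℝ) + 1) * psi q N) * psi δ N := by ring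
      _ ≤ 4 * (2 * N * a * psi δ N) + C2 * psi (q - 1) N * 1 := by
          rw [hNψ]
          have : (N : ℝ) + 1 ≤ 2 * N := by linarith
          gcongr
      _ ≤ _ := by
          have : 0 ≤ N * a * psi δ N := by positivity
          have := mul_nonneg hC20 this
          rw [hE2]; linarith
  have he_le : ∀ m, |e m| ≤ B * psi (q + 1) m := fun m =>
    (h.e_small m).trans (mul_le_mul_of_nonneg_right hbB (psi_nonneg _ _))
  have hψqE : psi (q - 1) N ≤ E2 := by
    have : 0 ≤ N * a * psi δ N := by positivity
    linarith
  -- the tilted first moment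
  have hT' : |T - ∑ m ∈ Finset.range (N + 1), (m : ℝ) * (g m * Real.exp (x * m))| ≤ c1 * E2 := by
    have s1 := sum_tilt_le hκ.le hδ'1 hqκ hB ha0 hxX hexp h.g_le h.g_sub
    have s2 := tail_first_moment_le hq hL.g_le N
    rw [← hL.T_eq] at s2
    have e1 : T - ∑ m ∈ Finset.range (N + 1), (m : ℝ) * (g m * Real.exp (x * m)) =
        (T - ∑ m ∈ Finset.range (N + 1), (m : ℝ) * g₀ m) -
        ∑ m ∈ Finset.range (N + 1), (m : ℝ) * (g m * Real.exp (x * m) - g₀ m) := by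
      rw [sub_sub, ← Finset.sum_add_distrib]
      congr 1
      exact Finset.sum_congr rfl fun m _ => by ring
    have s3 : |∑ m ∈ Finset.range (N + 1), (m : ℝ) * (g m * Real.exp (x * m) - g₀ m)| ≤
        ∑ m ∈ Finset.range (N + 1), (m : ℝ) * |g m * Real.exp (x * m) - g₀ m| := by
      refine (Finset.abs_sum_le_sum_abs _ _).trans (le_of_eq ?_)
      exact Finset.sum_congr rfl fun m _ => by rw [abs_mul, Nat.abs_cast]
    rw [e1]
    refine (abs_sub _ _).trans ?_
    have s4 := mul_le_mul_of_nonneg_left hη (by positivity : 0 ≤ 3 * B * S)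
    have s5 := mul_le_mul_of_nonneg_left hψqE (by positivity : 0 ≤ B * (q - 1)⁻¹)
    rw [hc1]
    linarith
  have hE' : |(∑ m ∈ Finset.range (N + 1), e m * Real.exp (x * m)) - ∑' m, e₀ m| ≤ c2 * E2 := by
    have s1 := sum_tilt_le hκ.le hδ'1 hqκ hB ha0 hxX hexp he_le h.e_sub
    have s2 : |∑' m, e₀ m - ∑ m ∈ Finset.range (N + 1), e₀ m| ≤ B * q⁻¹ * psi q N :=
      abs_tsum_sub_sum_le (by linarith) (fun i _ => hL.e_le i)
        (summable_of_le_psi (by linarith) hL.e_le)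
    have e1 : (∑ m ∈ Finset.range (N + 1), e m * Real.exp (x * m)) - ∑' m, e₀ m =
        ∑ m ∈ Finset.range (N + 1), (e m * Real.exp (x * m) - e₀ m) -
        (∑' m, e₀ m - ∑ m ∈ Finset.range (N + 1), e₀ m) := by
      rw [Finset.sum_sub_distrib]; ring
    have s3 : |∑ m ∈ Finset.range (N + 1), (e m * Real.exp (x * m) - e₀ m)| ≤
        ∑ m ∈ Finset.range (N + 1), (m : ℝ) * |e m * Real.exp (x * m) - e₀ m| := by
      refine (Finset.abs_sum_le_sum_abs _ _).trans (Finset.sum_le_sum fun m _ => ?_)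
      rcases Nat.eq_zero_or_pos m with h0 | h0
      · subst h0; simp [h.renewal.e_zero, hL.e_zero]
      · exact le_mul_of_one_le_left (abs_nonneg _) (by exact_mod_cast h0)
    rw [e1]
    refine (abs_sub _ _).trans ?_
    have s4 := mul_le_mul_of_nonneg_left hη (by positivity : 0 ≤ 3 * B * S)
    have s6 : psi q N ≤ E2 := (psi_anti_exp (by linarith) N).trans hψqE
    have s5 := mul_le_mul_of_nonneg_left s6 (by positivity : 0 ≤ B * q⁻¹)
    rw [hc2]
    linarith
  -- the tilted amplitude
  have key : ∃ A' : ℝ, |A'| ≤ CA ∧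
      A' * (∑ m ∈ Finset.range (N + 1), (m : ℝ) * (g m * Real.exp (x * m))) =
        1 + ∑ m ∈ Finset.range (N + 1), e m * Real.exp (x * m) ∧
      |f N * Real.exp (x * N) - A'| ≤ c3 * E2 := by
    have habs : ∀ A' s : ℝ, |A' - 1| ≤ 4 * (60 * b) * s → s ≤ psiSum (q - κ) → |A'| ≤ CA := by
      intro A' s h1 h2
      have h3 := mul_le_mul_of_nonneg_left h2 (by positivity : 0 ≤ 4 * (60 * b))
      rw [hCA]
      rw [abs_le] at h1 ⊢
      constructor <;> linarith [h1.1, h1.2]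
    -- The convergence rate N^{-(q-κ-1)} of the tilted sequence is too weak when a is tiny. If Na ≤
    -- 1 the tilting factor is at most e^4 < 60, so no exponent is lost (κ = 0). If Na ≥ 1 the
    -- weaker rate is still at most psi δ N ≤ Na psi δ N.
    rcases le_total (N * a) 1 with hNa | hNa
    · have hexp' : ∀ m ≤ N, Real.exp (X * m) ≤ 60 * psi (-0) m := by
        intro m hm
        have e0 : psi (-0) m = 1 := by simp [psi]
        have hm' : (m : ℝ) ≤ N := by exact_mod_cast hm
        have e1 : X * m ≤ 4 := by
          have e2 : C2 * ((N : ℝ) * psi q N) ≤ 1 := by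
            refine le_trans (mul_le_mul_of_nonneg_left ?_ hC20) hCq
            rw [← hNψ]; linarith
          calc X * m ≤ X * N := mul_le_mul_of_nonneg_left hm' hX0
            _ ≤ (3 * a + C2 * psi q N) * N := mul_le_mul_of_nonneg_right hXle (by linarith)
            _ ≤ 4 := by linarith
        rw [e0, mul_one]
        refine (Real.exp_le_exp.2 e1).trans ?_
        have e3 : Real.exp 4 = Real.exp 1 ^ 4 := by rw [← Real.exp_nat_mul]; norm_num
        rw [e3]
        calc _ ≤ (2.7182818286 : ℝ) ^ 4 :=
              pow_le_pow_left₀ (Real.exp_pos _).le Real.exp_one_lt_d9.le 4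
          _ ≤ 60 := by norm_num
      obtain ⟨A', k1, k2, k3⟩ := tilted_renewal (κ := 0) (M := 60) hb (by norm_num)
        (by linarith : 1 < q - 0) (by rwa [sub_zero]) hxX hexp' h.renewal h.g_small h.e_small hroot
      refine ⟨A', habs A' _ k1 (psiSum_anti (by linarith) (by linarith)), k2, k3.trans ?_⟩
      rw [sub_zero, hc3]
      have e1 := mul_le_mul_of_nonneg_left hψqE (by positivity : 0 ≤ 4 * (60 * b) * (q - 1)⁻¹)
      have e2 : 0 ≤ 4 * (60 * b) * (q - κ - 1)⁻¹ * E2 := by positivity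
      linarith
    · have hexp' : ∀ m ≤ N, Real.exp (X * m) ≤ 60 * psi (-κ) m := fun m hm =>
        (hexp m hm).trans (mul_le_mul_of_nonneg_right (by norm_num) (psi_nonneg _ _))
      obtain ⟨A', k1, k2, k3⟩ := tilted_renewal (κ := κ) (M := 60) hb (by norm_num)
        (by linarith : 1 < q - κ) hs2 hxX hexp' h.renewal h.g_small h.e_small hroot
      refine ⟨A', habs A' _ k1 le_rfl, k2, k3.trans ?_⟩
      have e0 : psi (q - κ - 1) N ≤ E2 := by
        have e3 : psi (q - κ - 1) N ≤ psi δ N := psi_anti_exp (by linarith) N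
        have e4 := mul_le_mul_of_nonneg_right hNa hψδ
        rw [hE2]; linarith
      rw [hc3]
      have e1 := mul_le_mul_of_nonneg_left e0 (by positivity : 0 ≤ 4 * (60 * b) * (q - κ - 1)⁻¹)
      have e2 : 0 ≤ 4 * (60 * b) * (q - 1)⁻¹ * E2 := by positivity
      linarith
  obtain ⟨A', hA', hA'T, hfA'⟩ := key
  -- Both amplitudes are quotients with numerators 1 + Σe and first moments as denominators; the
  -- numerators and the moments have just been compared.
  have hAA' : |A' - A| ≤ (c2 + CA * c1) / T * E2 := by
    have e1 : (A' - A) * T = ((∑ m ∈ Finset.range (N + 1), e m * Real.exp (x * m)) - ∑' m, e₀ m) +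
        A' * (T - ∑ m ∈ Finset.range (N + 1), (m : ℝ) * (g m * Real.exp (x * m))) := by
      linear_combination (-1 : ℝ) * hL.A_eq + hA'T
    have e2 : |A' - A| * T ≤ (c2 + CA * c1) * E2 := by
      have e3 : |A' - A| * T = |(A' - A) * T| := by rw [abs_mul, abs_of_pos hT]
      rw [e3, e1]
      refine (abs_add_le _ _).trans ?_
      rw [abs_mul]
      have := mul_le_mul hA' hT' (abs_nonneg _) hCA0
      linarith
    rw [div_mul_eq_mul_div, le_div_iff₀ hT]
    exact e2
  set θ := f N * Real.exp (x * N) - A with hθ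
  have hθle : |θ| ≤ C6 * E2 := by
    have e1 : θ = (f N * Real.exp (x * N) - A') + (A' - A) := by rw [hθ]; ring
    rw [e1]
    refine (abs_add_le _ _).trans ?_
    rw [hC6, add_mul]
    exact add_le_add hfA' hAA'
  set y := v * a * N - x * N with hy
  have hyle : |y| ≤ C2 * E2 := by
    have e1 : y = -((x - v * a) * N) := by rw [hy]; ring
    rw [e1, abs_neg, abs_mul, Nat.abs_cast]
    have := mul_le_mul_of_nonneg_right hx (by linarith : (0 : ℝ) ≤ N)
    linarith
  have hyexp : Real.exp |y| ≤ Real.exp (C2 * Em) :=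
    Real.exp_le_exp.2 (hyle.trans (mul_le_mul_of_nonneg_left hE2m hC20))
  have id : f N - A * Real.exp (-(v * a * N)) =
      Real.exp (-(v * a * N)) * (A * (Real.exp y - 1) + Real.exp y * θ) := by
    have e1 : Real.exp (-(v * a * N)) * Real.exp y = Real.exp (-(x * N)) := by
      rw [← Real.exp_add]; congr 1; rw [hy]; ring
    have e2 : Real.exp (-(x * N)) * Real.exp (x * N) = 1 := by
      rw [← Real.exp_add, neg_add_cancel, Real.exp_zero]
    rw [hθ]
    linear_combination (-(f N * Real.exp (x * N))) * e1 - f N * e2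
  rw [id, abs_mul, Real.abs_exp]
  have hfin : |A * (Real.exp y - 1) + Real.exp y * θ| ≤
      Real.exp (C2 * Em) * (|A| * C2 + C6) * E2 := by
    refine (abs_add_le _ _).trans ?_
    rw [abs_mul, abs_mul, Real.abs_exp]
    have e1 : |Real.exp y - 1| ≤ C2 * E2 * Real.exp (C2 * Em) :=
      (abs_exp_sub_one_le y).trans (mul_le_mul hyle hyexp (Real.exp_pos _).le (by positivity))
    have e2 : Real.exp y * |θ| ≤ Real.exp (C2 * Em) * (C6 * E2) :=
      mul_le_mul ((Real.exp_le_exp.2 (le_abs_self y)).trans hyexp) hθle (abs_nonneg _)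
        (Real.exp_pos _).le
    have e3 := mul_le_mul_of_nonneg_left e1 (abs_nonneg A)
    linarith
  calc _ ≤ Real.exp (-(v * a * N)) * (Real.exp (C2 * Em) * (|A| * C2 + C6) * E2) :=
        mul_le_mul_of_nonneg_left hfin (Real.exp_pos _).le
    _ = _ := by ring

end
end LaceExpansion
end

noncomputable section
namespace LaceExpansion

/-! ### The Laplacian at the origin of a lattice-symmetric function -/

section
variable {d : ℕ}

/-- The vector `t e_i`. -/
def axis (i : Fin d) (t : ℝ) : Momentum d := EuclideanSpace.single i t

theorem axis_apply (i j : Fin d) (t : ℝ) : axis i t j = if j = i then t else 0 := by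
  simp [axis]

theorem axis_zero (i : Fin d) : axis i 0 = 0 := by
  ext j; simp [axis_apply]

theorem axis_eq_smul (i : Fin d) (t : ℝ) : axis i t = t • axis i 1 := by
  ext j; simp [axis_apply]

theorem norm_axis (i : Fin d) (t : ℝ) : ‖axis i t‖ = |t| := by
  simp [axis]

theorem axis_mem_cube (i : Fin d) {t : ℝ} (ht : |t| ≤ Real.pi) : axis i t ∈ cube d := by
  intro j
  rw [axis_apply]
  split_ifs
  · exact ht
  · rw [abs_zero]; exact Real.pi_pos.le

theorem zero_mem_cube : (0 : Momentum d) ∈ cube d := fun i => by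
  simp [Real.pi_pos.le]

theorem cube_mem_nhds : cube d ∈ 𝓝 (0 : Momentum d) := by
  refine Filter.mem_of_superset (Metric.ball_mem_nhds 0 Real.pi_pos) fun k hk i => ?_
  rw [mem_ball_zero_iff] at hk
  have := PiLp.norm_apply_le k i
  rw [Real.norm_eq_abs] at this
  linarith

theorem continuous_axis (i : Fin d) : Continuous (axis i) := by
  have : axis i = fun t => t • axis i 1 := funext fun t => axis_eq_smul i t
  rw [this]
  fun_prop

theorem LatticeSymmetric.axis_neg {h : Momentum d → ℝ} (hs : LatticeSymmetric h) (i : Fin d) {t : ℝ}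
    (ht : |t| ≤ Real.pi) : h (axis i (-t)) = h (axis i t) := by
  rw [← hs.1 _ (axis_mem_cube i ht) i]
  congr 1
  ext j
  simp only [axis_apply, Function.update_apply]
  split_ifs <;> simp_all

theorem LatticeSymmetric.axis_swap {h : Momentum d → ℝ} (hs : LatticeSymmetric h) (i j : Fin d)
    {t : ℝ} (ht : |t| ≤ Real.pi) : h (axis j t) = h (axis i t) := by
  rw [← hs.2 _ (axis_mem_cube i ht) (Equiv.swap i j)]
  congr 1
  ext l
  simp only [axis_apply]
  by_cases h1 : l = j
  · subst h1; simp
  · by_cases h2 : l = i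
    · subst h2
      rw [Equiv.swap_apply_left, if_neg h1, if_neg (Ne.symm h1)]
    · rw [Equiv.swap_apply_of_ne_of_ne h2 h1, if_neg h1, if_neg h2]

theorem eventually_abs_le_pi : ∀ᶠ t in 𝓝[>] (0 : ℝ), |t| ≤ Real.pi := by
  filter_upwards [Ioc_mem_nhdsGT Real.pi_pos] with t ht
  rw [abs_of_pos ht.1]; exact ht.2

/-- Second-order behaviour along a coordinate axis. -/
theorem tendsto_axis_diff {h : Momentum d → ℝ} (hd : TwiceDifferentiableAtZero h)
    (hs : LatticeSymmetric h) (i : Fin d) :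
    Tendsto (fun t : ℝ => (h (axis i t) - h 0) / t ^ 2) (𝓝[>] 0)
      (𝓝 (fderiv ℝ (fderiv ℝ h) 0 (axis i 1) (axis i 1) / 2)) := by
  obtain ⟨h1, h2⟩ := hd
  have hax : ∀ t, HasDerivAt (axis i) (axis i 1) t := by
    intro t
    have : axis i = fun t => t • axis i 1 := funext fun t => axis_eq_smul i t
    rw [this]
    simpa using (hasDerivAt_id t).smul_const (axis i 1)
  have hcont : Tendsto (axis i) (𝓝 0) (𝓝 0) := by
    have := (continuous_axis i).tendsto 0
    rwa [axis_zero] at this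
  set φ' : ℝ → ℝ := fun t => fderiv ℝ h (axis i t) (axis i 1) with hφ'
  have hφ : ∀ᶠ t in 𝓝 (0 : ℝ), HasDerivAt (fun t => h (axis i t)) (φ' t) t := by
    filter_upwards [hcont.eventually h1] with t ht
    exact ht.hasFDerivAt.comp_hasDerivAt t (hax t)
  have hφ0 : HasDerivAt (fun t => h (axis i t)) (φ' 0) 0 := hφ.self_of_nhds
  -- Reflection symmetry makes h even along the axis.
  have hzero : φ' 0 = 0 := by
    have hneg : HasDerivAt (fun t => h (axis i (-t))) (-φ' 0) 0 := by
      have h3 : HasDerivAt (fun t => h (axis i t)) (φ' 0) (-0) := by rwa [neg_zero]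
      have := h3.comp (0 : ℝ) (hasDerivAt_neg 0)
      rw [mul_neg_one] at this
      exact this
    have heq : (fun t => h (axis i (-t))) =ᶠ[𝓝 0] fun t => h (axis i t) := by
      have : ∀ᶠ t in 𝓝 (0 : ℝ), |t| < Real.pi := by
        have := (continuous_abs.tendsto (0 : ℝ)).eventually_lt_const
          (by rw [abs_zero]; exact Real.pi_pos)
        exact this
      filter_upwards [this] with t ht
      exact hs.axis_neg i ht.le
    have := (hneg.congr_of_eventuallyEq heq.symm).unique hφ0
    linarith
  have hφ'' : HasDerivAt φ' (fderiv ℝ (fderiv ℝ h) 0 (axis i 1) (axis i 1)) 0 := by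
    have h3 : HasFDerivAt (fderiv ℝ h) (fderiv ℝ (fderiv ℝ h) 0) (axis i 0) := by
      rw [axis_zero]; exact h2.hasFDerivAt
    have h4 := h3.comp_hasDerivAt (0 : ℝ) (hax 0)
    have h5 := h4.clm_apply (hasDerivAt_const (0 : ℝ) (axis i 1))
    simpa using h5
  -- One application of l'Hôpital's rule suffices: the derivative quotient is a difference quotient
  -- of φ' at 0, so only differentiability of φ' at the origin is needed.
  refine HasDerivAt.lhopital_zero_nhdsGT (f' := φ') (g' := fun t => 2 * t) ?_ ?_ ?_ ?_ ?_ ?_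
  · exact (hφ.filter_mono nhdsWithin_le_nhds).mono fun t ht => ht.sub_const _
  · filter_upwards with t
    simpa using hasDerivAt_pow 2 t
  · filter_upwards [self_mem_nhdsWithin] with t ht
    have : (0 : ℝ) < t := ht
    positivity
  · have := hφ0.continuousAt.tendsto.sub_const (h 0)
    simp only [axis_zero, sub_self] at this
    exact this.mono_left nhdsWithin_le_nhds
  · have : Tendsto (fun t : ℝ => t ^ 2) (𝓝 0) (𝓝 (0 ^ 2)) := (continuous_pow 2).tendsto 0
    rw [zero_pow two_ne_zero] at this
    exact this.mono_left nhdsWithin_le_nhds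
  · have h6 := (hasDerivAt_iff_tendsto_slope.1 hφ'').mono_left
      (nhdsWithin_mono 0 (s := Set.Ioi (0 : ℝ)) (t := {0}ᶜ) fun t ht => (ne_of_gt ht : t ≠ 0))
    have h7 := h6.div_const 2
    refine h7.congr fun t => ?_
    rw [slope_def_field, hzero]
    ring_nf

/-- The Laplacian at the origin of a lattice-symmetric function is a limit of second differences
along one axis. -/
theorem tendsto_lap0 {h : Momentum d → ℝ} (hd : TwiceDifferentiableAtZero h)
    (hs : LatticeSymmetric h) (i : Fin d) :
    Tendsto (fun t : ℝ => 2 * d * ((h (axis i t) - h 0) / t ^ 2)) (𝓝[>] 0) (𝓝 (lap0 h)) := by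
  -- Permutation symmetry makes all pure second derivatives at 0 equal, hence the factor d.
  have hall : ∀ j, fderiv ℝ (fderiv ℝ h) 0 (axis j 1) (axis j 1) =
      fderiv ℝ (fderiv ℝ h) 0 (axis i 1) (axis i 1) := by
    intro j
    have h1 := tendsto_axis_diff hd hs i
    have h2 := tendsto_axis_diff hd hs j
    have h3 := tendsto_nhds_unique_of_eventuallyEq h2 h1 (by
      filter_upwards [eventually_abs_le_pi] with t ht
      rw [hs.axis_swap i j ht])
    linarith
  have hlap : lap0 h = d * fderiv ℝ (fderiv ℝ h) 0 (axis i 1) (axis i 1) := by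
    rw [lap0, InnerProductSpace.laplacian_eq_iteratedFDeriv_orthonormalBasis h
      (EuclideanSpace.basisFun (Fin d) ℝ)]
    have : ∀ j, iteratedFDeriv ℝ 2 h 0 ![EuclideanSpace.basisFun (Fin d) ℝ j,
        EuclideanSpace.basisFun (Fin d) ℝ j] =
        fderiv ℝ (fderiv ℝ h) 0 (axis i 1) (axis i 1) := by
      intro j
      rw [iteratedFDeriv_two_apply, ← hall j]
      simp [axis]
    simp only [this]
    simp
  rw [hlap]
  have := (tendsto_axis_diff hd hs i).const_mul (2 * d : ℝ)
  convert this using 2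
  ring

/-- The identities of the model hold only on the cube; it is a neighbourhood of 0, which suffices
for derivatives there. -/
theorem lap0_congr {h h' : Momentum d → ℝ} (hh : ∀ k ∈ cube d, h k = h' k) : lap0 h = lap0 h' := by
  rw [lap0, lap0]
  exact (InnerProductSpace.laplacian_congr_nhds
    (Filter.eventuallyEq_of_mem cube_mem_nhds hh)).self_of_nhds

theorem TwiceDifferentiableAtZero.congr {h h' : Momentum d → ℝ} (hd : TwiceDifferentiableAtZero h)
    (hh : ∀ k ∈ cube d, h k = h' k) : TwiceDifferentiableAtZero h' := by
  have h1 : h =ᶠ[𝓝 0] h' := Filter.eventuallyEq_of_mem cube_mem_nhds hh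
  refine ⟨?_, ?_⟩
  · filter_upwards [h1.eventuallyEq_nhds, hd.1] with k hk hk'
    exact hk'.congr_of_eventuallyEq hk.symm
  · exact hd.2.congr_of_eventuallyEq h1.symm.fderiv

end
end LaceExpansion
end

noncomputable section
namespace LaceExpansion

/-! ### The Fourier transform of the step distribution -/

section
variable {d : ℕ} {D : (Fin d → ℤ) → ℝ}

/-- The inner product `k · x`. -/
def phase (k : Momentum d) (x : Fin d → ℤ) : ℝ := ∑ i, k i * (x i : ℝ)

theorem fourier_term_norm (h : (Fin d → ℤ) → ℝ) (k : Momentum d) (x : Fin d → ℤ) :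
    ‖(h x : ℂ) * Complex.exp (Complex.I * ((∑ i, k i * (x i : ℝ) : ℝ) : ℂ))‖ = |h x| := by
  rw [norm_mul, Complex.norm_exp_I_mul_ofReal, mul_one, Complex.norm_real, Real.norm_eq_abs]

theorem summable_of_fourier_zero (h : fourier D 0 = 1) : Summable D ∧ ∑' x, D x = 1 := by
  have e : ∀ x, (D x : ℂ) * Complex.exp (Complex.I * ((∑ i, (0 : Momentum d) i * (x i : ℝ) : ℝ) : ℂ))
      = (D x : ℂ) := fun x => by simp
  rw [fourier] at h
  simp only [e] at h
  have hs : Summable fun x => (D x : ℂ) := by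
    -- A divergent `tsum` has value 0, so the normalisation D̂(0) = 1 already forces summability.
    by_contra hn
    rw [tsum_eq_zero_of_not_summable hn] at h
    exact zero_ne_one h
  have hs' : Summable D := Complex.summable_ofReal.1 hs
  refine ⟨hs', ?_⟩
  rw [← Complex.ofReal_tsum] at h
  exact_mod_cast h

theorem summable_mul_of_abs_le_one {c : (Fin d → ℤ) → ℝ} (hD : ∀ x, 0 ≤ D x) (hs : Summable D)
    (hc : ∀ x, |c x| ≤ 1) : Summable fun x => D x * c x := by
  refine Summable.of_norm_bounded hs fun x => ?_
  rw [Real.norm_eq_abs, abs_mul, abs_of_nonneg (hD x)]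
  exact mul_le_of_le_one_right (hD x) (hc x)

theorem Dhat_eq (hs : Summable D) (k : Momentum d) :
    Dhat D k = ∑' x, D x * Real.cos (phase k x) := by
  have hsum : Summable fun x : Fin d → ℤ =>
      (D x : ℂ) * Complex.exp (Complex.I * ((∑ i, k i * (x i : ℝ) : ℝ) : ℂ)) := by
    refine Summable.of_norm ?_
    simp only [fourier_term_norm]
    exact hs.abs
  rw [Dhat, fourier, Complex.re_tsum hsum]
  refine tsum_congr fun x => ?_
  rw [Complex.re_ofReal_mul, mul_comm Complex.I, Complex.exp_ofReal_mul_I_re, phase]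

theorem abs_Dhat_le_one (hD : ∀ x, 0 ≤ D x) (h : fourier D 0 = 1) (k : Momentum d) :
    |Dhat D k| ≤ 1 := by
  obtain ⟨hs, h1⟩ := summable_of_fourier_zero h
  rw [Dhat_eq hs, ← h1, ← Real.norm_eq_abs]
  refine tsum_of_norm_bounded hs.hasSum fun x => ?_
  rw [Real.norm_eq_abs, abs_mul, abs_of_nonneg (hD x)]
  exact mul_le_of_le_one_right (hD x) (Real.abs_cos_le_one _)

theorem a_eq (hD : ∀ x, 0 ≤ D x) (h : fourier D 0 = 1) (k : Momentum d) :
    a D k = ∑' x, D x * (1 - Real.cos (phase k x)) := by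
  obtain ⟨hs, h1⟩ := summable_of_fourier_zero h
  rw [a, Dhat_eq hs]
  conv_lhs => rw [← h1]
  rw [← Summable.tsum_sub hs (summable_mul_of_abs_le_one hD hs fun x => Real.abs_cos_le_one _)]
  exact tsum_congr fun x => by ring

theorem Dhat_zero (h : fourier D 0 = 1) : Dhat D 0 = 1 := by rw [Dhat, h]; rfl

theorem a_zero (h : fourier D 0 = 1) : a D 0 = 0 := by rw [a, Dhat_zero h, sub_self]

theorem a_nonneg (hD : ∀ x, 0 ≤ D x) (h : fourier D 0 = 1) (k : Momentum d) : 0 ≤ a D k := by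
  have := (abs_le.1 (abs_Dhat_le_one hD h k)).2
  rw [a]; linarith

/-! #### Parseval -/

theorem integral_exp_int_mul (n : ℤ) :
    ∫ t in Set.Icc (-Real.pi) Real.pi, Complex.exp (Complex.I * ((t * (n : ℝ) : ℝ) : ℂ)) =
      if n = 0 then ((2 * Real.pi : ℝ) : ℂ) else 0 := by
  rw [integral_Icc_eq_integral_Ioc, ← intervalIntegral.integral_of_le (by linarith [Real.pi_pos])]
  split_ifs with h
  · subst h
    simp
    ring
  · have hc : Complex.I * (n : ℂ) ≠ 0 := mul_ne_zero Complex.I_ne_zero (by exact_mod_cast h)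
    have e : ∀ t : ℝ, Complex.exp (Complex.I * ((t * (n : ℝ) : ℝ) : ℂ)) =
        Complex.exp (Complex.I * (n : ℂ) * t) := fun t => by
      congr 1; push_cast; ring
    simp only [e]
    rw [integral_exp_mul_complex hc]
    have e2 : Complex.exp (Complex.I * (n : ℂ) * (Real.pi : ℝ)) =
        Complex.exp (Complex.I * (n : ℂ) * ((-Real.pi : ℝ) : ℂ)) := by
      rw [Complex.exp_eq_exp_iff_exists_int]
      exact ⟨n, by push_cast; ring⟩
    rw [e2, sub_self, zero_div]

theorem cube_eq_preimage : cube d = (WithLp.ofLp : Momentum d → Fin d → ℝ) ⁻¹'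
    (Set.univ.pi fun _ => Set.Icc (-Real.pi) Real.pi) := by
  ext k
  simp only [cube, Set.mem_ofPred_eq, Set.mem_preimage, Set.mem_univ_pi, Set.mem_Icc, abs_le]

theorem measurableSet_cube : MeasurableSet (cube d) := by
  rw [cube_eq_preimage]
  exact (PiLp.volume_preserving_ofLp (Fin d)).measurable
    (MeasurableSet.univ_pi fun _ => measurableSet_Icc)

theorem isCompact_cube : IsCompact (cube d) := by
  have h : IsCompact (Set.univ.pi fun _ : Fin d => Set.Icc (-Real.pi) Real.pi) :=
    isCompact_univ_pi fun _ => isCompact_Icc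
  have := (PiLp.homeomorph 2 (fun _ : Fin d => ℝ)).symm.isCompact_image.2 h
  convert this using 1
  rw [cube_eq_preimage, ← Homeomorph.preimage_symm, Homeomorph.symm_symm]
  rfl

theorem integral_cube_exp (x : Fin d → ℤ) :
    ∫ k in cube d, Complex.exp (Complex.I * ((phase k x : ℝ) : ℂ)) =
      if x = 0 then (((2 * Real.pi) ^ d : ℝ) : ℂ) else 0 := by
  have h1 : ∫ k in cube d, Complex.exp (Complex.I * ((phase k x : ℝ) : ℂ)) =
      ∫ y in Set.univ.pi fun _ : Fin d => Set.Icc (-Real.pi) Real.pi,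
        ∏ i, Complex.exp (Complex.I * ((y i * (x i : ℝ) : ℝ) : ℂ)) := by
    rw [cube_eq_preimage]
    have := (PiLp.volume_preserving_ofLp (Fin d)).setIntegral_preimage_emb
      (MeasurableEquiv.toLp 2 (Fin d → ℝ)).symm.measurableEmbedding
      (fun y : Fin d → ℝ => ∏ i, Complex.exp (Complex.I * ((y i * (x i : ℝ) : ℝ) : ℂ)))
      (Set.univ.pi fun _ : Fin d => Set.Icc (-Real.pi) Real.pi)
    rw [← this]
    congr 1
    funext k
    rw [← Complex.exp_sum, ← Finset.mul_sum, phase]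
    push_cast
    rfl
  rw [h1, volume_pi, Measure.restrict_pi_pi, integral_fintype_prod_eq_prod
    (fun i (t : ℝ) => Complex.exp (Complex.I * ((t * (x i : ℝ) : ℝ) : ℂ)))]
  simp only [integral_exp_int_mul]
  split_ifs with h
  · subst h
    simp
  · obtain ⟨i, hi⟩ := Function.ne_iff.1 h
    exact Finset.prod_eq_zero (Finset.mem_univ i) (if_neg hi)

theorem continuous_phase (x : Fin d → ℤ) : Continuous fun k : Momentum d => phase k x := by
  unfold phase
  fun_prop

theorem integral_cube_cos (x : Fin d → ℤ) :
    ∫ k in cube d, Real.cos (phase k x) = if x = 0 then (2 * Real.pi) ^ d else 0 := by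
  have h := integral_cube_exp (d := d) x
  have hint : IntegrableOn (fun k : Momentum d => Complex.exp (Complex.I * ((phase k x : ℝ) : ℂ)))
      (cube d) := by
    refine ContinuousOn.integrableOn_compact isCompact_cube ?_
    have := continuous_phase (d := d) x
    fun_prop
  have h2 := congrArg Complex.re h
  have h3 := integral_re hint
  simp only [RCLike.re_to_complex] at h3
  rw [← h3] at h2
  have e : ∀ k : Momentum d, (Complex.exp (Complex.I * ((phase k x : ℝ) : ℂ))).re =
      Real.cos (phase k x) := fun k => by
    rw [mul_comm, Complex.exp_ofReal_mul_I_re]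
  simp only [e] at h2
  rw [h2]
  split_ifs
  · rw [Complex.ofReal_re]
  · rfl

theorem phase_add (k : Momentum d) (x y : Fin d → ℤ) : phase k (x + y) = phase k x + phase k y := by
  simp only [phase, Pi.add_apply, Int.cast_add, mul_add, Finset.sum_add_distrib]

theorem phase_neg (k : Momentum d) (x : Fin d → ℤ) : phase k (-x) = -phase k x := by
  simp only [phase, Pi.neg_apply, Int.cast_neg, mul_neg, Finset.sum_neg_distrib]

theorem volume_cube_lt_top : volume (cube d) < ⊤ := isCompact_cube.measure_lt_top

theorem integrableOn_cube_of_continuous {h : Momentum d → ℝ} (hc : Continuous h) :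
    IntegrableOn h (cube d) :=
  hc.continuousOn.integrableOn_compact isCompact_cube

theorem continuous_Dhat (hD : ∀ x, 0 ≤ D x) (hs : Summable D) : Continuous (Dhat D) := by
  have : Dhat D = fun k => ∑' x, D x * Real.cos (phase k x) := funext fun k => Dhat_eq hs k
  rw [this]
  refine continuous_tsum (fun x => ?_) hs fun x k => ?_
  · have := continuous_phase (d := d) x
    fun_prop
  · rw [Real.norm_eq_abs, abs_mul, abs_of_nonneg (hD x)]
    exact mul_le_of_le_one_right (hD x) (Real.abs_cos_le_one _)

/-- Integration of a uniformly convergent Fourier series against a bounded function. -/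
theorem hasSum_integral_cube (hD : ∀ x, 0 ≤ D x) (hs : Summable D) {w : Momentum d → ℝ}
    (hw : Continuous w) (hw1 : ∀ k, |w k| ≤ 1) :
    HasSum (fun x => D x * ∫ k in cube d, w k * Real.cos (phase k x))
      (∫ k in cube d, w k * Dhat D k) := by
  have hF : ∀ x, Integrable (fun k : Momentum d => D x * (w k * Real.cos (phase k x)))
      (volume.restrict (cube d)) := fun x => by
    have := continuous_phase (d := d) x
    exact integrableOn_cube_of_continuous (by fun_prop)
  have hb : ∀ x, ∀ k : Momentum d, ‖D x * (w k * Real.cos (phase k x))‖ ≤ D x := fun x k => by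
    rw [Real.norm_eq_abs, abs_mul, abs_of_nonneg (hD x), abs_mul]
    refine mul_le_of_le_one_right (hD x) ?_
    exact mul_le_one₀ (hw1 k) (abs_nonneg _) (Real.abs_cos_le_one _)
  have hsn : Summable fun x => ∫ k in cube d, ‖D x * (w k * Real.cos (phase k x))‖ := by
    refine Summable.of_nonneg_of_le (fun x => integral_nonneg fun k => norm_nonneg _) (fun x => ?_)
      (hs.mul_right (volume.real (cube d)))
    calc _ ≤ ∫ k in cube d, D x := by
          refine setIntegral_mono (hF x).norm (integrableOn_const volume_cube_lt_top.ne) (hb x)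
      _ = _ := by rw [setIntegral_const, smul_eq_mul, mul_comm]
  have := hasSum_integral_of_summable_integral_norm hF hsn
  have e : ∀ k, ∑' x, D x * (w k * Real.cos (phase k x)) = w k * Dhat D k := by
    intro k
    rw [Dhat_eq hs, ← tsum_mul_left]
    exact tsum_congr fun x => by ring
  simp only [e, integral_const_mul] at this
  exact this

/-- By orthogonality the integral equals (2π)^d (D(x) + D(-x))/2, so no symmetry of D is required.
-/
theorem integral_Dhat_mul_cos (hD : ∀ x, 0 ≤ D x) (hs : Summable D) {M : ℝ} (hM : ∀ x, D x ≤ M)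
    (x : Fin d → ℤ) :
    ∫ k in cube d, Dhat D k * Real.cos (phase k x) ≤ (2 * Real.pi) ^ d * M := by
  have hP : (0 : ℝ) ≤ (2 * Real.pi) ^ d := by have := Real.pi_pos; positivity
  have hx := continuous_phase (d := d) x
  have h := hasSum_integral_cube hD hs (w := fun k => Real.cos (phase k x)) (by fun_prop)
    fun k => Real.abs_cos_le_one _
  have e1 : ∀ y, ∫ k in cube d, Real.cos (phase k x) * Real.cos (phase k y) =
      (2 * Real.pi) ^ d / 2 * ((if y = x then 1 else 0) + (if y = -x then 1 else 0)) := by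
    intro y
    have e2 : ∀ k : Momentum d, Real.cos (phase k x) * Real.cos (phase k y) =
        1 / 2 * Real.cos (phase k (x + -y)) + 1 / 2 * Real.cos (phase k (x + y)) := fun k => by
      rw [phase_add, phase_add, phase_neg, Real.cos_add, Real.cos_add, Real.cos_neg, Real.sin_neg]
      ring
    simp only [e2]
    have c1 := continuous_phase (d := d) (x + -y)
    have c2 := continuous_phase (d := d) (x + y)
    rw [integral_add (integrableOn_cube_of_continuous (by fun_prop))
      (integrableOn_cube_of_continuous (by fun_prop)), integral_const_mul, integral_const_mul,
      integral_cube_cos, integral_cube_cos]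
    have i1 : (x + -y = 0) ↔ y = x := by rw [← sub_eq_add_neg, sub_eq_zero, eq_comm]
    have i2 : (x + y = 0) ↔ y = -x := by rw [add_comm, add_eq_zero_iff_eq_neg]
    simp only [i1, i2]
    split_ifs <;> ring
  simp only [e1] at h
  have h2 : HasSum (fun y => D y * ((2 * Real.pi) ^ d / 2 *
      ((if y = x then (1 : ℝ) else 0) + (if y = -x then 1 else 0))))
      ((2 * Real.pi) ^ d / 2 * (D x + D (-x))) := by
    have s1 := (hasSum_ite_eq x (D x)).add (hasSum_ite_eq (-x) (D (-x)))
    have s2 := s1.mul_left ((2 * Real.pi) ^ d / 2)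
    refine s2.congr_fun fun y => ?_
    by_cases a1 : y = x
    · by_cases a2 : y = -x
      · rw [if_pos a1, if_pos a2, if_pos a1, if_pos a2, ← a2, ← a1]; ring
      · rw [if_pos a1, if_neg a2, if_pos a1, if_neg a2, ← a1]; ring
    · by_cases a2 : y = -x
      · rw [if_neg a1, if_pos a2, if_neg a1, if_pos a2, ← a2]; ring
      · rw [if_neg a1, if_neg a2, if_neg a1, if_neg a2]; ring
  have h3 := h.unique h2
  simp only [mul_comm (Dhat D _)]
  rw [h3]
  nlinarith [hM x, hM (-x)]

/-- Parseval's bound `∫ D̂² ≤ (2π)^d ‖D‖_∞`. -/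
theorem integral_Dhat_sq_le (hD : ∀ x, 0 ≤ D x) (h : fourier D 0 = 1) {M : ℝ}
    (hM : ∀ x, D x ≤ M) : ∫ k in cube d, Dhat D k ^ 2 ≤ (2 * Real.pi) ^ d * M := by
  obtain ⟨hs, h1⟩ := summable_of_fourier_zero h
  -- Only one factor D̂ is expanded; each coefficient D(x) meets an integral of at most (2π)^d M,
  -- and D has total mass 1.
  have h2 := hasSum_integral_cube hD hs (continuous_Dhat hD hs) (abs_Dhat_le_one hD h)
  simp only [pow_two]
  have h3 := hs.hasSum.mul_right ((2 * Real.pi) ^ d * M)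
  rw [h1, one_mul] at h3
  refine hasSum_le (fun x => ?_) h2 h3
  exact mul_le_mul_of_nonneg_left (integral_Dhat_mul_cos hD hs hM x) (hD x)

end
end LaceExpansion
end

noncomputable section
namespace LaceExpansion

/-! ### Expansion of `a(k)` at the origin -/

section
variable {d : ℕ} {D : (Fin d → ℤ) → ℝ}

/-- Interpolation between the quartic remainder for |t| ≤ 1 and the trivial quadratic bound for |t|
≥ 1; it uses exactly a moment of order 2 + 2s. -/
theorem abs_one_sub_cos_sub_le {s : ℝ} (hs0 : 0 ≤ s) (hs1 : s ≤ 1) (t : ℝ) :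
    |1 - Real.cos t - t ^ 2 / 2| ≤ |t| ^ (2 + 2 * s) := by
  rcases le_total |t| 1 with h | h
  · have h1 := Real.cos_bound h
    have e : 1 - Real.cos t - t ^ 2 / 2 = -(Real.cos t - (1 - t ^ 2 / 2)) := by ring
    rw [e, abs_neg]
    refine h1.trans ?_
    have h2 : |t| ^ 4 ≤ |t| ^ (2 + 2 * s) := by
      rcases eq_or_lt_of_le (abs_nonneg t) with h0 | h0
      · rw [← h0, Real.zero_rpow (by linarith)]; norm_num
      · rw [← Real.rpow_natCast |t| 4]
        exact Real.rpow_le_rpow_of_exponent_ge h0 h (by push_cast; linarith)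
    have : 0 ≤ |t| ^ 4 := by positivity
    linarith
  · have h1 := Real.one_sub_sq_div_two_le_cos (x := t)
    have h2 := Real.cos_le_one t
    have h3 : t ^ 2 ≤ |t| ^ (2 + 2 * s) := by
      rw [← sq_abs, ← Real.rpow_natCast |t| 2]
      exact Real.rpow_le_rpow_of_exponent_le h (by push_cast; linarith)
    rw [abs_le]
    constructor <;> linarith [sq_nonneg t]

theorem latticeNorm_nonneg (x : Fin d → ℤ) : 0 ≤ latticeNorm x := Real.sqrt_nonneg _

theorem abs_phase_le (k : Momentum d) (x : Fin d → ℤ) : |phase k x| ≤ ‖k‖ * latticeNorm x := by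
  have h := Finset.sum_mul_sq_le_sq_mul_sq Finset.univ (fun i => k i) (fun i => (x i : ℝ))
  have e1 : ‖k‖ ^ 2 = ∑ i, k i ^ 2 := by
    rw [EuclideanSpace.norm_sq_eq]; simp
  have e2 : latticeNorm x ^ 2 = ∑ i, (x i : ℝ) ^ 2 :=
    Real.sq_sqrt (Finset.sum_nonneg fun i _ => sq_nonneg _)
  rw [← e1, ← e2, ← mul_pow] at h
  exact abs_le_of_sq_le_sq h (mul_nonneg (norm_nonneg _) (latticeNorm_nonneg x))

theorem abs_coord_le_latticeNorm (x : Fin d → ℤ) (i : Fin d) : |(x i : ℝ)| ≤ latticeNorm x := by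
  refine Real.abs_le_sqrt ?_
  exact Finset.single_le_sum (f := fun i => (x i : ℝ) ^ 2) (fun i _ => sq_nonneg _)
    (Finset.mem_univ i)

theorem summable_moment_of_le {p r : ℝ} (hp : 0 ≤ p) (hpr : p ≤ r) (hD : ∀ x, 0 ≤ D x)
    (hs : Summable D) (hm : Summable fun x => latticeNorm x ^ r * D x) :
    Summable fun x => latticeNorm x ^ p * D x := by
  refine Summable.of_nonneg_of_le (fun x => mul_nonneg (Real.rpow_nonneg (latticeNorm_nonneg x) _)
    (hD x)) (fun x => ?_) (hs.add hm)
  have h : latticeNorm x ^ p ≤ 1 + latticeNorm x ^ r := by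
    have h0 := latticeNorm_nonneg x
    rcases le_total (latticeNorm x) 1 with h | h
    · have := Real.rpow_le_one h0 h hp
      have := Real.rpow_nonneg h0 r
      linarith
    · have := Real.rpow_le_rpow_of_exponent_le h hpr
      linarith
  have := mul_le_mul_of_nonneg_right h (hD x)
  linarith

/-- The covariance form `∑_x D(x) (k·x)²`. -/
def covForm (D : (Fin d → ℤ) → ℝ) (k : Momentum d) : ℝ := ∑' x, D x * phase k x ^ 2

theorem summable_covForm (hD : ∀ x, 0 ≤ D x)
    (h2 : Summable fun x => latticeNorm x ^ (2 : ℝ) * D x) (k : Momentum d) :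
    Summable fun x => D x * phase k x ^ 2 := by
  refine Summable.of_nonneg_of_le (fun x => mul_nonneg (hD x) (sq_nonneg _)) (fun x => ?_)
    (h2.mul_left (‖k‖ ^ 2))
  have h := pow_le_pow_left₀ (abs_nonneg _) (abs_phase_le k x) 2
  rw [sq_abs, mul_pow] at h
  have e : latticeNorm x ^ (2 : ℝ) = latticeNorm x ^ 2 := by
    rw [← Real.rpow_natCast]; norm_num
  rw [e]
  have := mul_le_mul_of_nonneg_left h (hD x)
  linarith

theorem abs_a_sub_covForm_le {s : ℝ} (hs0 : 0 ≤ s) (hs1 : s ≤ 1) (hD : ∀ x, 0 ≤ D x)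
    (h : fourier D 0 = 1) (hm : Summable fun x => latticeNorm x ^ (2 + 2 * s) * D x)
    (k : Momentum d) :
    |a D k - covForm D k / 2| ≤
      (∑' x, latticeNorm x ^ (2 + 2 * s) * D x) * ‖k‖ ^ (2 + 2 * s) := by
  obtain ⟨hs, h1⟩ := summable_of_fourier_zero h
  have h2 := summable_moment_of_le (by norm_num) (by linarith : (2 : ℝ) ≤ 2 + 2 * s) hD hs hm
  have s1 : Summable fun x => D x * (1 - Real.cos (phase k x)) := by
    have := hs.sub (summable_mul_of_abs_le_one hD hs fun x => Real.abs_cos_le_one (phase k x))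
    exact this.congr fun x => by ring
  have s2 := (summable_covForm hD h2 k).div_const 2
  rw [a_eq hD h, covForm, ← tsum_div_const, ← Summable.tsum_sub s1 s2, ← tsum_mul_right,
    ← Real.norm_eq_abs]
  refine tsum_of_norm_bounded (hm.mul_right _).hasSum fun x => ?_
  have e : D x * (1 - Real.cos (phase k x)) - D x * phase k x ^ 2 / 2 =
      D x * (1 - Real.cos (phase k x) - phase k x ^ 2 / 2) := by ring
  rw [e, Real.norm_eq_abs, abs_mul, abs_of_nonneg (hD x)]
  have h3 := (abs_one_sub_cos_sub_le hs0 hs1 (phase k x)).trans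
    (Real.rpow_le_rpow (abs_nonneg _) (abs_phase_le k x) (by linarith))
  rw [Real.mul_rpow (norm_nonneg _) (latticeNorm_nonneg x)] at h3
  have := mul_le_mul_of_nonneg_left h3 (hD x)
  linarith

theorem phase_smul (t : ℝ) (k : Momentum d) (x : Fin d → ℤ) : phase (t • k) x = t * phase k x := by
  simp only [phase, PiLp.smul_apply, smul_eq_mul, Finset.mul_sum, mul_assoc]

theorem covForm_smul (t : ℝ) (k : Momentum d) : covForm D (t • k) = t ^ 2 * covForm D k := by
  rw [covForm, covForm, ← tsum_mul_left]
  refine tsum_congr fun x => ?_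
  rw [phase_smul]; ring

/-- Recovers the covariance form from the values of a near the origin, where the symmetries of D̂
are known. They pass to the covariance without being assumed for D itself. -/
theorem tendsto_a_smul {s : ℝ} (hs0 : 0 < s) (hs1 : s ≤ 1) (hD : ∀ x, 0 ≤ D x)
    (h : fourier D 0 = 1) (hm : Summable fun x => latticeNorm x ^ (2 + 2 * s) * D x)
    (k : Momentum d) :
    Tendsto (fun t : ℝ => a D (t • k) / t ^ 2) (𝓝[>] 0) (𝓝 (covForm D k / 2)) := by
  set M := (∑' x, latticeNorm x ^ (2 + 2 * s) * D x) * ‖k‖ ^ (2 + 2 * s) with hM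
  rw [tendsto_iff_norm_sub_tendsto_zero]
  have h1 : Tendsto (fun t : ℝ => M * t ^ (2 * s)) (𝓝[>] 0) (𝓝 (M * 0)) := by
    refine Tendsto.const_mul _ ?_
    have := (Real.continuousAt_rpow_const 0 (2 * s) (Or.inr (by linarith))).tendsto
    rw [Real.zero_rpow (by linarith)] at this
    exact this.mono_left nhdsWithin_le_nhds
  rw [mul_zero] at h1
  refine squeeze_zero' (Eventually.of_forall fun t => norm_nonneg _) ?_ h1
  filter_upwards [self_mem_nhdsWithin] with t ht
  have ht0 : (0 : ℝ) < t := ht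
  have h2 := abs_a_sub_covForm_le hs0.le hs1 hD h hm (t • k)
  rw [covForm_smul, norm_smul, Real.norm_eq_abs, abs_of_pos ht0,
    Real.mul_rpow ht0.le (norm_nonneg _)] at h2
  have e1 : t ^ (2 + 2 * s) = t ^ 2 * t ^ (2 * s) := by
    rw [Real.rpow_add ht0]; norm_num
  have e2 : a D (t • k) / t ^ 2 - covForm D k / 2 =
      (a D (t • k) - t ^ 2 * covForm D k / 2) / t ^ 2 := by field_simp
  rw [Real.norm_eq_abs, e2, abs_div, abs_of_pos (by positivity : 0 < t ^ 2),
    div_le_iff₀ (by positivity)]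
  refine h2.trans (le_of_eq ?_)
  rw [e1, hM]; ring

theorem smul_eventually_mem_cube (k : Momentum d) : ∀ᶠ t : ℝ in 𝓝[>] 0, t • k ∈ cube d := by
  have h : Tendsto (fun t : ℝ => t • k) (𝓝[>] 0) (𝓝 0) := by
    have : Tendsto (fun t : ℝ => t • k) (𝓝 0) (𝓝 ((0 : ℝ) • k)) :=
      (continuous_id.smul continuous_const).tendsto 0
    rw [zero_smul] at this
    exact this.mono_left nhdsWithin_le_nhds
  exact h.eventually cube_mem_nhds

/-- The matrix entries `∑_x D(x) x_i x_j`. -/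
def covEntry (D : (Fin d → ℤ) → ℝ) (i j : Fin d) : ℝ := ∑' x, D x * ((x i : ℝ) * (x j : ℝ))

theorem covForm_eq (hD : ∀ x, 0 ≤ D x) (h2 : Summable fun x => latticeNorm x ^ (2 : ℝ) * D x)
    (k : Momentum d) : covForm D k = ∑ i, ∑ j, k i * k j * covEntry D i j := by
  have hs : ∀ i j, Summable fun x : Fin d → ℤ => D x * ((x i : ℝ) * (x j : ℝ)) := by
    intro i j
    refine Summable.of_norm_bounded h2 fun x => ?_
    have e : latticeNorm x ^ (2 : ℝ) = latticeNorm x * latticeNorm x := by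
      rw [← pow_two, ← Real.rpow_natCast]; norm_num
    rw [Real.norm_eq_abs, abs_mul, abs_mul, abs_of_nonneg (hD x), mul_comm, e]
    refine mul_le_mul_of_nonneg_right ?_ (hD x)
    exact mul_le_mul (abs_coord_le_latticeNorm x i) (abs_coord_le_latticeNorm x j) (abs_nonneg _)
      (latticeNorm_nonneg x)
  have e1 : ∀ x, D x * phase k x ^ 2 =
      ∑ i, ∑ j, k i * k j * (D x * ((x i : ℝ) * (x j : ℝ))) := by
    intro x
    rw [phase, pow_two, Finset.sum_mul_sum, Finset.mul_sum]
    refine Finset.sum_congr rfl fun i _ => ?_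
    rw [Finset.mul_sum]
    exact Finset.sum_congr rfl fun j _ => by ring
  rw [covForm]
  simp only [e1]
  rw [Summable.tsum_finsetSum fun i _ => summable_sum fun j _ => (hs i j).mul_left _]
  refine Finset.sum_congr rfl fun i _ => ?_
  rw [Summable.tsum_finsetSum fun j _ => (hs i j).mul_left _]
  exact Finset.sum_congr rfl fun j _ => by rw [tsum_mul_left, covEntry]

theorem covForm_congr {s : ℝ} (hs0 : 0 < s) (hs1 : s ≤ 1) (hD : ∀ x, 0 ≤ D x)
    (h : fourier D 0 = 1) (hm : Summable fun x => latticeNorm x ^ (2 + 2 * s) * D x)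
    {k k' : Momentum d} (hkk' : ∀ t : ℝ, t • k ∈ cube d → Dhat D (t • k') = Dhat D (t • k)) :
    covForm D k' = covForm D k := by
  have h1 := tendsto_a_smul hs0 hs1 hD h hm k
  have h2 := tendsto_a_smul hs0 hs1 hD h hm k'
  have := tendsto_nhds_unique_of_eventuallyEq h2 h1 (by
    filter_upwards [smul_eventually_mem_cube k] with t ht
    rw [a, a, hkk' t ht])
  linarith

/-- Reflections remove the off-diagonal covariances and permutations equalise the diagonal ones. -/
theorem covForm_isotropic {s : ℝ} (hs0 : 0 < s) (hs1 : s ≤ 1) (hD : ∀ x, 0 ≤ D x)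
    (h : fourier D 0 = 1) (hm : Summable fun x => latticeNorm x ^ (2 + 2 * s) * D x)
    (hsym : LatticeSymmetric (Dhat D)) (i₀ : Fin d) (k : Momentum d) :
    covForm D k = covForm D (axis i₀ 1) * ‖k‖ ^ 2 := by
  obtain ⟨hs, -⟩ := summable_of_fourier_zero h
  have h2 := summable_moment_of_le (by norm_num) (by linarith : (2 : ℝ) ≤ 2 + 2 * s) hD hs hm
  have hdiag : ∀ i, covForm D (axis i 1) = covEntry D i i := by
    intro i
    rw [covForm_eq hD h2]
    simp [axis_apply]
  have hswap : ∀ i, covForm D (axis i 1) = covForm D (axis i₀ 1) := by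
    intro i
    refine covForm_congr hs0 hs1 hD h hm fun t ht => ?_
    rw [← axis_eq_smul, ← axis_eq_smul]
    refine hsym.axis_swap i₀ i ?_
    have := ht i₀
    simpa [axis_apply] using this
  have hoff : ∀ i j, i ≠ j → covEntry D i j = 0 := by
    intro i j hij
    have hcomm : covEntry D j i = covEntry D i j := by
      rw [covEntry, covEntry]; exact tsum_congr fun x => by ring
    have e1 : ∀ c : ℝ, covForm D (axis i 1 + axis j c) =
        covEntry D i i + 2 * c * covEntry D i j + c ^ 2 * covEntry D j j := by
      intro c
      rw [covForm_eq hD h2]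
      have hij' : j ≠ i := hij.symm
      have e2 : ∀ l, (axis i 1 + axis j c) l =
          (if l = i then 1 else 0) + (if l = j then c else 0) := fun l => by
        rw [PiLp.add_apply, axis_apply, axis_apply]
      simp only [e2, add_mul, mul_add, Finset.sum_add_distrib]
      simp [hcomm]
      ring
    -- Flipping the sign of coordinate j changes only the cross term, which must therefore vanish.
    have e3 : covForm D (axis i 1 + axis j (-1)) = covForm D (axis i 1 + axis j 1) := by
      refine covForm_congr hs0 hs1 hD h hm fun t ht => ?_
      rw [← hsym.1 _ ht j]
      congr 1
      ext l
      simp only [PiLp.smul_apply, PiLp.add_apply, axis_apply, Function.update_apply, smul_eq_mul]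
      by_cases h1 : l = j
      · subst h1; simp [hij.symm]
      · simp [h1]
    rw [e1, e1] at e3
    linarith
  rw [covForm_eq hD h2, EuclideanSpace.norm_sq_eq, Finset.mul_sum]
  refine Finset.sum_congr rfl fun i _ => ?_
  rw [Finset.sum_eq_single i]
  · rw [← hdiag, hswap i, Real.norm_eq_abs, sq_abs]; ring
  · intro j _ hj
    rw [hoff i j hj.symm, mul_zero]
  · intro hi; exact absurd (Finset.mem_univ i) hi

/-- `2d a(t e_1)/t² → σ²`. -/
theorem tendsto_a_axis (hdiff : TwiceDifferentiableAtZero (Dhat D)) (h : fourier D 0 = 1)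
    (hsym : LatticeSymmetric (Dhat D)) (i : Fin d) :
    Tendsto (fun t : ℝ => 2 * d * (a D (axis i t) / t ^ 2)) (𝓝[>] 0) (𝓝 (sigmaSq D)) := by
  have := (tendsto_lap0 hdiff hsym i).neg
  rw [sigmaSq]
  refine this.congr fun t => ?_
  rw [a, Dhat_zero h]; ring

theorem abs_a_sub_sigmaSq_le {s : ℝ} (hs0 : 0 < s) (hs1 : s ≤ 1) (hd : 0 < d) (hD : ∀ x, 0 ≤ D x)
    (h : fourier D 0 = 1) (hm : Summable fun x => latticeNorm x ^ (2 + 2 * s) * D x)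
    (hdiff : TwiceDifferentiableAtZero (Dhat D)) (hsym : LatticeSymmetric (Dhat D))
    (k : Momentum d) :
    |a D k - sigmaSq D * ‖k‖ ^ 2 / (2 * d)| ≤
      (∑' x, latticeNorm x ^ (2 + 2 * s) * D x) * ‖k‖ ^ (2 + 2 * s) := by
  have hd' : (0 : ℝ) < d := by exact_mod_cast hd
  have h1 : sigmaSq D = d * covForm D (axis ⟨0, hd⟩ 1) := by
    have t1 := tendsto_a_axis hdiff h hsym ⟨0, hd⟩
    have t2 := (tendsto_a_smul hs0 hs1 hD h hm (axis ⟨0, hd⟩ 1)).const_mul (2 * d : ℝ)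
    simp only [← axis_eq_smul] at t2
    have := tendsto_nhds_unique t1 t2
    rw [this]; ring
  have h2 := abs_a_sub_covForm_le hs0.le hs1 hD h hm k
  rw [covForm_isotropic hs0 hs1 hD h hm hsym ⟨0, hd⟩ k] at h2
  rw [h1]
  convert h2 using 3
  field_simp

end
end LaceExpansion
end

noncomputable section
namespace LaceExpansion

/-! ### From pointwise bounds to the `L¹` bound -/

section
variable {d : ℕ}

/-- The profile `(1 + c |u|²)^{-d}`. -/
def bulkProfile (d : ℕ) (c : ℝ) (u : Momentum d) : ℝ := ((1 + c * ‖u‖ ^ 2) ^ d)⁻¹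

/-- The profile `(c |u|²)^{-2}` on a ball. -/
def singularProfile (d : ℕ) (c R : ℝ) (u : Momentum d) : ℝ :=
  (Metric.ball (0 : Momentum d) R).indicator (fun u => ((c * ‖u‖ ^ 2) ^ 2)⁻¹) u

theorem integrable_bulkProfile (hd : 0 < d) {c : ℝ} (hc : 0 < c) :
    Integrable (bulkProfile d c) := by
  have hfin : (Module.finrank ℝ (Momentum d) : ℝ) < 2 * d := by
    rw [finrank_euclideanSpace_fin]
    have : (0 : ℝ) < d := by exact_mod_cast hd
    linarith
  have h1 := (integrable_rpow_neg_one_add_norm_sq (μ := (volume : Measure (Momentum d)))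
    hfin).const_mul (((min 1 c) ^ d)⁻¹)
  refine h1.mono' ?_ (Eventually.of_forall fun u => ?_)
  · have : Continuous (bulkProfile d c) := by
      unfold bulkProfile
      refine Continuous.inv₀ (by fun_prop) fun u => ?_
      positivity
    exact this.aestronglyMeasurable
  · have hm : 0 < min 1 c := lt_min one_pos hc
    have e : (1 + ‖u‖ ^ 2) ^ (-(2 * (d : ℝ)) / 2) = ((1 + ‖u‖ ^ 2) ^ d)⁻¹ := by
      rw [show -(2 * (d : ℝ)) / 2 = -(d : ℝ) by ring, Real.rpow_neg (by positivity),
        Real.rpow_natCast]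
    rw [Real.norm_eq_abs, abs_of_nonneg (by unfold bulkProfile; positivity), e, bulkProfile,
      ← mul_inv, ← mul_pow]
    refine inv_anti₀ (by positivity) (pow_le_pow_left₀ (by positivity) ?_ d)
    have h2 : min 1 c * 1 ≤ 1 := by rw [mul_one]; exact min_le_left _ _
    have h3 : min 1 c * ‖u‖ ^ 2 ≤ c * ‖u‖ ^ 2 :=
      mul_le_mul_of_nonneg_right (min_le_right _ _) (sq_nonneg _)
    linarith

/-- In polar coordinates the integrand is a multiple of r^{d-1} r^{-4} = r^{d-5}, integrable at 0
because d > 4. -/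
theorem integrable_singularProfile (hd : 4 < d) (c R : ℝ) :
    Integrable (singularProfile d c R) := by
  have : Nontrivial (Momentum d) := by
    have : Nonempty (Fin d) := ⟨⟨0, by omega⟩⟩
    infer_instance
  unfold singularProfile
  rw [integrable_indicator_iff measurableSet_ball]
  rw [integrableOn_fun_norm_addHaar (volume : Measure (Momentum d))
    (f := fun y => ((c * y ^ 2) ^ 2)⁻¹), finrank_euclideanSpace_fin]
  have h1 : IntegrableOn (fun y : ℝ => y ^ (d - 5) * (c ^ 2)⁻¹) (Set.Ioo 0 R) :=
    (Continuous.integrableOn_Icc (by fun_prop)).mono_set Set.Ioo_subset_Icc_self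
  refine h1.congr_fun (fun y hy => ?_) measurableSet_Ioo
  have hy0 : y ≠ 0 := ne_of_gt hy.1
  have e : y ^ (d - 1) = y ^ (d - 5) * y ^ 4 := by
    rw [← pow_add]; congr 1; omega
  simp only [smul_eq_mul]
  rw [e, mul_pow, mul_inv, ← pow_mul]
  field_simp

theorem norm_le_sqrt_mul_supNorm (k : Momentum d) : ‖k‖ ≤ Real.sqrt d * supNorm k := by
  rw [EuclideanSpace.norm_eq]
  have h : ∑ i, ‖k i‖ ^ 2 ≤ d * supNorm k ^ 2 := by
    calc _ ≤ ∑ _i : Fin d, supNorm k ^ 2 := Finset.sum_le_sum fun i _ =>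
          pow_le_pow_left₀ (norm_nonneg _) (norm_le_pi_norm (WithLp.ofLp k) i) 2
      _ = _ := by simp
  have h0 : 0 ≤ supNorm k := norm_nonneg _
  rw [Real.sqrt_le_left (by positivity), mul_pow, Real.sq_sqrt (by positivity)]
  exact h

theorem psi_le_rpow (r : ℝ) (hr : 0 ≤ r) {n : ℕ} (hn : 1 ≤ n) : psi r n ≤ (n : ℝ) ^ (-r) := by
  have : (0 : ℝ) < n := by exact_mod_cast hn
  exact Real.rpow_le_rpow_of_nonpos this (by linarith) (by linarith)

/-- The `L¹` bound obtained from the pointwise decay. -/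
theorem exists_norm1_bound (hd : 4 < d) {CD η c₁ : ℝ} (hη : 0 < η) (hc₁ : 0 < c₁) :
    ∃ K : ℝ, 0 ≤ K ∧ ∀ (L : ℝ) (D : (Fin d → ℤ) → ℝ), 1 ≤ L → (∀ x, 0 ≤ D x) → fourier D 0 = 1 →
      (∀ x, D x ≤ CD * (L ^ d)⁻¹) →
      (∀ k : Momentum d, supNorm k ≤ L⁻¹ → c₁ * L ^ 2 * ‖k‖ ^ 2 ≤ a D k) →
      (∀ k ∈ cube d, L⁻¹ ≤ supNorm k → η < a D k) →
      ∀ (n : ℕ) (C b : ℝ) (h : Momentum d → ℝ), 1 ≤ n → 0 ≤ C → 0 ≤ b → b ≤ 1 →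
      AEMeasurable h (volume.restrict (cube d)) →
      (∀ k ∈ cube d, |h k| ≤ C * ((1 + a D k * n) ^ d)⁻¹ +
        C * b * (a D k ^ 2)⁻¹ * psi ((d : ℝ) / 2) n) →
      IntegrableOn (fun k => Dhat D k ^ 2 * h k) (cube d) ∧
      norm1 (fun k => Dhat D k ^ 2 * h k) ≤ C * K * beta d L * (n : ℝ) ^ (-(d : ℝ) / 2) := by
  -- If the sup norm of k is at most 1/L, then |Lk| ≤ √d < R, so the open ball of radius R contains
  -- Lk.
  set R : ℝ := Real.sqrt d + 1 with hR
  set I₁ := ∫ u, bulkProfile d c₁ u with hI₁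
  set I₂ := ∫ u, singularProfile d c₁ R u with hI₂
  have hI₁0 : 0 ≤ I₁ := integral_nonneg fun u => by
    simp only [Pi.zero_apply, bulkProfile]; positivity
  have hI₂0 : 0 ≤ I₂ := integral_nonneg fun u => by
    simp only [Pi.zero_apply, singularProfile]
    exact Set.indicator_nonneg (fun u _ => by positivity) u
  set P : ℝ := ((2 * Real.pi) ^ d)⁻¹ with hP
  have hP0 : 0 < P := by have := Real.pi_pos; positivity
  set κ : ℝ := (η ^ d)⁻¹ + (η ^ 2)⁻¹ with hκ
  have hκ0 : 0 ≤ κ := by positivity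
  refine ⟨P * (I₁ + I₂) + κ * |CD|, by positivity, ?_⟩
  intro L D hL hD hD0 hDle hlow hhigh n C b h hn hC hb hb1 hmeas hbound
  have hL0 : 0 < L := by linarith
  have hn0 : (0 : ℝ) < n := by exact_mod_cast hn
  have hn1 : (1 : ℝ) ≤ n := by exact_mod_cast hn
  obtain ⟨hs, -⟩ := summable_of_fourier_zero hD0
  set ν : ℝ := (n : ℝ) ^ (-(d : ℝ) / 2) with hν
  have hν0 : 0 ≤ ν := by positivity
  set s := L * Real.sqrt n with hsdef
  have hs0 : 0 < s := by positivity
  -- The first two terms dominate for sup norm at most 1/L, where D̂² ≤ 1 is discarded. The third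
  -- dominates outside, where a > η; there D̂² is kept, to produce the factor β.
  set maj : Momentum d → ℝ := fun k => C * (bulkProfile d c₁ (s • k) +
    ν * singularProfile d c₁ R (L • k) + κ * ν * Dhat D k ^ 2) with hmaj
  have hb0' : ∀ u : Momentum d, 0 ≤ bulkProfile d c₁ u := fun u => by
    rw [bulkProfile]; positivity
  have hs0' : ∀ u : Momentum d, 0 ≤ singularProfile d c₁ R u := fun u =>
    Set.indicator_nonneg (fun u _ => by positivity) u
  have hψν : psi ((d : ℝ) / 2) n ≤ ν := by
    have := psi_le_rpow ((d : ℝ) / 2) (by positivity) hn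
    rwa [← neg_div] at this
  have hψ0 := psi_nonneg ((d : ℝ) / 2) n
  have hle : ∀ k ∈ cube d, |Dhat D k ^ 2 * h k| ≤ maj k := by
    intro k hk
    have hDk : Dhat D k ^ 2 ≤ 1 := by
      have := abs_Dhat_le_one hD hD0 k
      rw [← sq_abs]; exact pow_le_one₀ (abs_nonneg _) this
    have hDk0 : 0 ≤ Dhat D k ^ 2 := sq_nonneg _
    have ha0 := a_nonneg hD hD0 k
    have hbk := hbound k hk
    rw [abs_mul, abs_of_nonneg hDk0]
    rcases le_total (supNorm k) L⁻¹ with hcase | hcase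
    · have hlk := hlow k hcase
      have t1 : ((1 + a D k * n) ^ d)⁻¹ ≤ bulkProfile d c₁ (s • k) := by
        rw [bulkProfile]
        refine inv_anti₀ (by positivity) (pow_le_pow_left₀ (by positivity) ?_ d)
        rw [norm_smul, Real.norm_eq_abs, abs_of_pos hs0, hsdef, mul_pow, mul_pow,
          Real.sq_sqrt hn0.le]
        have := mul_le_mul_of_nonneg_right hlk hn0.le
        linarith
      have t2 : b * (a D k ^ 2)⁻¹ * psi ((d : ℝ) / 2) n ≤ ν * singularProfile d c₁ R (L • k) := by
        have hball : L • k ∈ Metric.ball (0 : Momentum d) R := by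
          rw [mem_ball_zero_iff, norm_smul, Real.norm_eq_abs, abs_of_pos hL0, hR]
          have h1 := norm_le_sqrt_mul_supNorm k
          have h2 : L * ‖k‖ ≤ L * (Real.sqrt d * L⁻¹) := by
            refine mul_le_mul_of_nonneg_left (h1.trans ?_) hL0.le
            exact mul_le_mul_of_nonneg_left hcase (Real.sqrt_nonneg _)
          have h3 : L * (Real.sqrt d * L⁻¹) = Real.sqrt d := by field_simp
          linarith
        rw [singularProfile, Set.indicator_of_mem hball, norm_smul, Real.norm_eq_abs,
          abs_of_pos hL0]
        have h4 : (a D k ^ 2)⁻¹ ≤ ((c₁ * (L * ‖k‖) ^ 2) ^ 2)⁻¹ := by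
          -- At k = 0 both sides are the inverse of 0, which is 0 by convention.
          rcases eq_or_ne k 0 with hk0 | hk0
          · subst hk0
            rw [a_zero hD0]; simp
          · have hk1 : 0 < ‖k‖ := norm_pos_iff.2 hk0
            refine inv_anti₀ (by positivity) (pow_le_pow_left₀ (by positivity) ?_ 2)
            rw [mul_pow]
            linarith
        calc _ ≤ 1 * ((c₁ * (L * ‖k‖) ^ 2) ^ 2)⁻¹ * ν := by gcongr
          _ = _ := by ring
      have t3 : 0 ≤ κ * ν * Dhat D k ^ 2 := by positivity
      calc _ ≤ 1 * |h k| := mul_le_mul_of_nonneg_right hDk (abs_nonneg _)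
        _ ≤ C * (((1 + a D k * n) ^ d)⁻¹ + b * (a D k ^ 2)⁻¹ * psi ((d : ℝ) / 2) n) := by linarith
        _ ≤ maj k := mul_le_mul_of_nonneg_left (by linarith) hC
    · have hak := hhigh k hk hcase
      have t1 : ((1 + a D k * n) ^ d)⁻¹ ≤ (η ^ d)⁻¹ * ν := by
        have e1 : ((n : ℝ) ^ d)⁻¹ ≤ ν := by
          rw [hν, ← Real.rpow_natCast, ← Real.rpow_neg hn0.le]
          refine Real.rpow_le_rpow_of_exponent_le hn1 ?_
          have : (0 : ℝ) ≤ d := by positivity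
          linarith
        calc _ ≤ ((η * n) ^ d)⁻¹ := by
              refine inv_anti₀ (by positivity) (pow_le_pow_left₀ (by positivity) ?_ d)
              have := mul_le_mul_of_nonneg_right hak.le hn0.le
              linarith
          _ = (η ^ d)⁻¹ * ((n : ℝ) ^ d)⁻¹ := by rw [mul_pow, mul_inv]
          _ ≤ _ := by gcongr
      have t2 : b * (a D k ^ 2)⁻¹ * psi ((d : ℝ) / 2) n ≤ (η ^ 2)⁻¹ * ν := by
        have e1 : (a D k ^ 2)⁻¹ ≤ (η ^ 2)⁻¹ :=
          inv_anti₀ (by positivity) (pow_le_pow_left₀ hη.le hak.le 2)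
        calc _ ≤ 1 * (η ^ 2)⁻¹ * ν := by gcongr
          _ = _ := by ring
      have t3 : |h k| ≤ C * (κ * ν) := by
        have := mul_le_mul_of_nonneg_left (add_le_add t1 t2) hC
        rw [hκ]; linarith
      calc _ ≤ Dhat D k ^ 2 * (C * (κ * ν)) := mul_le_mul_of_nonneg_left t3 hDk0
        _ = C * (κ * ν * Dhat D k ^ 2) := by ring
        _ ≤ maj k := by
            refine mul_le_mul_of_nonneg_left ?_ hC
            have := hb0' (s • k)
            have := mul_nonneg hν0 (hs0' (L • k))
            linarith
  have i1 : Integrable (fun k => bulkProfile d c₁ (s • k)) :=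
    (integrable_bulkProfile (by omega) hc₁).comp_smul hs0.ne'
  have i2 : Integrable (fun k => ν * singularProfile d c₁ R (L • k)) :=
    ((integrable_singularProfile hd c₁ R).comp_smul hL0.ne').const_mul ν
  have i3 : IntegrableOn (fun k => κ * ν * Dhat D k ^ 2) (cube d) := by
    have := continuous_Dhat hD hs
    exact integrableOn_cube_of_continuous (by fun_prop)
  have imaj : IntegrableOn maj (cube d) :=
    ((i1.integrableOn.add i2.integrableOn).add i3).const_mul C
  have hm : AEStronglyMeasurable (fun k => Dhat D k ^ 2 * h k) (volume.restrict (cube d)) := by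
    have := (continuous_Dhat hD hs).measurable
    exact ((this.pow_const 2).aemeasurable.mul hmeas).aestronglyMeasurable
  have hint : IntegrableOn (fun k => Dhat D k ^ 2 * h k) (cube d) := by
    refine imaj.mono' hm ?_
    filter_upwards [ae_restrict_mem measurableSet_cube] with k hk
    exact hle k hk
  refine ⟨hint, ?_⟩
  have hfr : Module.finrank ℝ (Momentum d) = d := finrank_euclideanSpace_fin
  -- The change of variables u = L√n k yields the Jacobian L^{-d} n^{-d/2}.
  have j1 : ∫ k in cube d, bulkProfile d c₁ (s • k) ≤ beta d L * ν * I₁ := by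
    refine (setIntegral_le_integral i1 (Eventually.of_forall fun k => hb0' _)).trans (le_of_eq ?_)
    rw [Measure.integral_comp_smul_of_nonneg volume (bulkProfile d c₁) s (hR := hs0.le), hfr, smul_eq_mul, ← hI₁]
    congr 1
    rw [beta, hsdef, mul_pow, mul_inv, hν]
    congr 1
    rw [Real.sqrt_eq_rpow, ← Real.rpow_mul_natCast hn0.le, ← Real.rpow_neg hn0.le]
    congr 1
    ring
  have j2 : ∫ k in cube d, ν * singularProfile d c₁ R (L • k) ≤ beta d L * ν * I₂ := by
    refine (setIntegral_le_integral i2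
      (Eventually.of_forall fun k => mul_nonneg hν0 (hs0' _))).trans (le_of_eq ?_)
    rw [integral_const_mul, Measure.integral_comp_smul_of_nonneg volume
      (singularProfile d c₁ R) L (hR := hL0.le), hfr, smul_eq_mul, ← hI₂, beta]
    ring
  have hβ0 : 0 < beta d L := by rw [beta]; positivity
  -- Parseval's bound with D ≤ CD L^{-d} gives the factor β.
  have j3 : ∫ k in cube d, κ * ν * Dhat D k ^ 2 ≤ κ * ν * (P⁻¹ * (|CD| * beta d L)) := by
    rw [integral_const_mul]
    refine mul_le_mul_of_nonneg_left ?_ (by positivity)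
    rw [hP, inv_inv]
    refine integral_Dhat_sq_le hD hD0 fun x => (hDle x).trans ?_
    exact mul_le_mul_of_nonneg_right (le_abs_self CD) hβ0.le
  have j4 : ∫ k in cube d, |Dhat D k ^ 2 * h k| ≤ C * (beta d L * ν * I₁ + beta d L * ν * I₂ +
      κ * ν * (P⁻¹ * (|CD| * beta d L))) := by
    calc _ ≤ ∫ k in cube d, maj k :=
          setIntegral_mono_on hint.abs imaj measurableSet_cube hle
      _ = C * ((∫ k in cube d, bulkProfile d c₁ (s • k)) +
            (∫ k in cube d, ν * singularProfile d c₁ R (L • k)) +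
            ∫ k in cube d, κ * ν * Dhat D k ^ 2) := by
          have i12 : IntegrableOn (fun k => bulkProfile d c₁ (s • k) +
              ν * singularProfile d c₁ R (L • k)) (cube d) := i1.integrableOn.add i2.integrableOn
          rw [hmaj, integral_const_mul, integral_add i12 i3,
            integral_add i1.integrableOn i2.integrableOn]
      _ ≤ _ := mul_le_mul_of_nonneg_left (add_le_add (add_le_add j1 j2) j3) hC
  rw [norm1, ← hP]
  calc _ ≤ P * (C * (beta d L * ν * I₁ + beta d L * ν * I₂ +
        κ * ν * (P⁻¹ * (|CD| * beta d L)))) := mul_le_mul_of_nonneg_left j4 hP0.le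
    _ = _ := by field_simp

end
end LaceExpansion
end

noncomputable section
namespace LaceExpansion

/-! ### From bounds on the coefficients to bounds on the renewal functions -/

section
variable {d : ℕ}

/-- A spread-out step distribution at a fixed range `L`. -/
structure Walk (d : ℕ) (L η c₁ CD : ℝ) (D : (Fin d → ℤ) → ℝ) : Prop where
  one_le : 1 ≤ L
  nonneg : ∀ x, 0 ≤ D x
  normalised : fourier D 0 = 1
  spread : ∀ x, D x ≤ CD * (L ^ d)⁻¹
  low : ∀ k : Momentum d, supNorm k ≤ L⁻¹ → c₁ * L ^ 2 * ‖k‖ ^ 2 ≤ a D k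
  high : ∀ k ∈ cube d, L⁻¹ ≤ supNorm k → η < a D k
  lt_two : ∀ k ∈ cube d, a D k < 2 - η
  diff : TwiceDifferentiableAtZero (Dhat D)
  symm : LatticeSymmetric (Dhat D)

/-- The renewal functions `f n` with coefficients `g m` and errors `e m`, at a fixed activity `z`. -/
structure Model (d : ℕ) (D : (Fin d → ℤ) → ℝ) (z : ℝ) (f g e : ℕ → Momentum d → ℝ) : Prop where
  renewal : ∀ k ∈ cube d, RenewalSeq (fun n => f n k) (fun n => g n k) (fun n => e n k)
  meas : ∀ n, AEMeasurable (f n) (volume.restrict (cube d))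
  diff_f : ∀ n, TwiceDifferentiableAtZero (f n)
  diff_g : ∀ n, TwiceDifferentiableAtZero (g n)
  symm_f : ∀ n, LatticeSymmetric (f n)
  symm_g : ∀ n, LatticeSymmetric (g n)
  g_one : ∀ k ∈ cube d, g 1 k = z * Dhat D k
  e_one : ∀ k ∈ cube d, e 1 k = 0

/-- Bounds of order `b` on the coefficients and errors up to `N`. -/
structure CoeffBounds (d : ℕ) (q b : ℝ) (N : ℕ) (D : (Fin d → ℤ) → ℝ)
    (g e : ℕ → Momentum d → ℝ) : Prop where
  g_le : ∀ k ∈ cube d, ∀ m, 2 ≤ m → m ≤ N → |g m k| ≤ b * psi (q + 1) m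
  g_sub : ∀ k ∈ cube d, ∀ m, 2 ≤ m → m ≤ N → |g m k - g m 0| ≤ b * a D k * psi q m
  g_lap : ∀ m, 2 ≤ m → m ≤ N → |lap0 (g m)| ≤ b * sigmaSq D * psi q m
  e_le : ∀ k ∈ cube d, ∀ m, 2 ≤ m → m ≤ N → |e m k| ≤ b * psi (q + 1) m
  e_sub : ∀ k ∈ cube d, ∀ m, 2 ≤ m → m ≤ N → |e m k - e m 0| ≤ b * a D k * psi q m
  tail : |1 - ∑ m ∈ Finset.range (N + 1), g m 0| ≤ b * psi q N

theorem supNorm_le_norm (k : Momentum d) : supNorm k ≤ ‖k‖ := by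
  rw [supNorm, pi_norm_le_iff_of_nonneg (norm_nonneg _)]
  exact fun i => PiLp.norm_apply_le k i

variable {L η c₁ CD : ℝ} {D : (Fin d → ℤ) → ℝ}

/-- The lower bound on a along an axis passes to the limit of its second differences; in particular
σ² > 0. -/
theorem Walk.sigmaSq_ge (w : Walk d L η c₁ CD D) (hd : 0 < d) :
    2 * d * (c₁ * L ^ 2) ≤ sigmaSq D := by
  refine ge_of_tendsto (tendsto_a_axis w.diff w.normalised w.symm ⟨0, hd⟩) ?_
  have hL : 0 < L⁻¹ := inv_pos.2 (by linarith [w.one_le])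
  filter_upwards [Ioc_mem_nhdsGT hL] with t ht
  have h1 := w.low (axis ⟨0, hd⟩ t) ((supNorm_le_norm _).trans (by
    rw [norm_axis, abs_of_pos ht.1]; exact ht.2))
  rw [norm_axis, sq_abs] at h1
  refine mul_le_mul_of_nonneg_left ?_ (by positivity)
  rw [le_div_iff₀ (by have := ht.1; positivity)]
  exact h1

theorem Walk.sigmaSq_pos (w : Walk d L η c₁ CD D) (hd : 0 < d) (hc₁ : 0 < c₁) : 0 < sigmaSq D := by
  have := w.one_le
  refine lt_of_lt_of_le ?_ (w.sigmaSq_ge hd)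
  positivity

theorem Walk.a_nonneg (w : Walk d L η c₁ CD D) (k : Momentum d) : 0 ≤ a D k :=
  LaceExpansion.a_nonneg w.nonneg w.normalised k

theorem Walk.a_pos (w : Walk d L η c₁ CD D) (hη : 0 < η) (hc₁ : 0 < c₁) {k : Momentum d}
    (hk : k ∈ cube d) (hk0 : k ≠ 0) : 0 < a D k := by
  have := w.one_le
  rcases le_total (supNorm k) L⁻¹ with h | h
  · refine lt_of_lt_of_le ?_ (w.low k h)
    have := norm_pos_iff.2 hk0
    positivity
  · exact hη.trans (w.high k hk h)

/-- A function whose increments are controlled by `a` has controlled second differences. -/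
theorem Walk.abs_le_of_tendsto (w : Walk d L η c₁ CD D) {u : Momentum d → ℝ} {c Λ : ℝ} (i : Fin d)
    (hu : ∀ k ∈ cube d, |u k - u 0| ≤ c * a D k)
    (hΛ : Tendsto (fun t : ℝ => 2 * d * ((u (axis i t) - u 0) / t ^ 2)) (𝓝[>] 0) (𝓝 Λ)) :
    |Λ| ≤ c * sigmaSq D := by
  refine le_of_tendsto_of_tendsto hΛ.abs
    ((tendsto_a_axis w.diff w.normalised w.symm i).const_mul c) ?_
  filter_upwards [eventually_abs_le_pi, self_mem_nhdsWithin] with t ht ht0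
  have ht0 : 0 < t := ht0
  have h1 := hu _ (axis_mem_cube i ht)
  rw [abs_mul, abs_div, abs_of_nonneg (by positivity : (0 : ℝ) ≤ 2 * d),
    abs_of_nonneg (by positivity : (0 : ℝ) ≤ t ^ 2)]
  calc _ ≤ 2 * d * (c * a D (axis i t) / t ^ 2) := by gcongr
    _ = _ := by ring

variable {z : ℝ} {f g e : ℕ → Momentum d → ℝ}

theorem twiceDifferentiableAtZero_const (c : ℝ) :
    TwiceDifferentiableAtZero (fun _ : Momentum d => c) :=
  ⟨Eventually.of_forall fun _ => by fun_prop, by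
    have : fderiv ℝ (fun _ : Momentum d => c) = fun _ => 0 := by ext; simp
    rw [this]; fun_prop⟩

theorem lap0_const (hd : 0 < d) (c : ℝ) : lap0 (fun _ : Momentum d => c) = 0 := by
  have h2 := tendsto_lap0 (twiceDifferentiableAtZero_const c) ⟨fun _ _ _ => rfl, fun _ _ _ => rfl⟩ ⟨0, hd⟩
  simp only [sub_self, zero_div, mul_zero] at h2
  exact tendsto_nhds_unique h2 tendsto_const_nhds

theorem TwiceDifferentiableAtZero.tendsto_axis {h : Momentum d → ℝ}
    (hd : TwiceDifferentiableAtZero h) (i : Fin d) :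
    Tendsto (fun t => h (axis i t)) (𝓝[>] 0) (𝓝 (h 0)) := by
  have h1 : ContinuousAt h (axis i 0) := by
    rw [axis_zero]; exact hd.1.self_of_nhds.continuousAt
  have := (h1.comp (continuous_axis i).continuousAt).tendsto
  simp only [Function.comp_def, axis_zero] at this
  exact this.mono_left nhdsWithin_le_nhds

/-- The error term in the recursion for the normalised Laplacians. -/
def momentErr (l γ f g : ℕ → ℝ) (n : ℕ) : ℝ :=
  if n = 0 then 0 else l n - ∑ m ∈ Finset.Icc 1 n, (γ m * f (n - m) + g m * l (n - m))

/-- The normalised Laplacian at the origin. -/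
def nlap (D : (Fin d → ℤ) → ℝ) (h : Momentum d → ℝ) : ℝ := lap0 h / sigmaSq D

/-- The errors e are not assumed differentiable, but the recursion expresses their second
differences through those of f and g, so these converge by the product rule. Symmetry leaves no
first-order cross terms. -/
theorem Model.tendsto_err (h : Model d D z f g e) (i : Fin d) (n : ℕ) :
    Tendsto (fun t : ℝ => 2 * d * ((e (n + 1) (axis i t) - e (n + 1) 0) / t ^ 2)) (𝓝[>] 0)
      (𝓝 (lap0 (f (n + 1)) - ∑ m ∈ Finset.Icc 1 (n + 1),
        (lap0 (g m) * f (n + 1 - m) 0 + g m 0 * lap0 (f (n + 1 - m))))) := by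
  have h1 : Tendsto (fun t : ℝ => 2 * d * ((f (n + 1) (axis i t) - f (n + 1) 0) / t ^ 2) -
      ∑ m ∈ Finset.Icc 1 (n + 1),
        (2 * d * ((g m (axis i t) - g m 0) / t ^ 2) * f (n + 1 - m) (axis i t) +
          g m 0 * (2 * d * ((f (n + 1 - m) (axis i t) - f (n + 1 - m) 0) / t ^ 2)))) (𝓝[>] 0)
      (𝓝 (lap0 (f (n + 1)) - ∑ m ∈ Finset.Icc 1 (n + 1),
        (lap0 (g m) * f (n + 1 - m) 0 + g m 0 * lap0 (f (n + 1 - m))))) := by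
    refine (tendsto_lap0 (h.diff_f _) (h.symm_f _) i).sub (tendsto_finsetSum _ fun m _ => ?_)
    exact ((tendsto_lap0 (h.diff_g _) (h.symm_g _) i).mul ((h.diff_f _).tendsto_axis i)).add
      ((tendsto_lap0 (h.diff_f _) (h.symm_f _) i).const_mul _)
  refine h1.congr' ?_
  filter_upwards [eventually_abs_le_pi] with t ht
  have h2 := (h.renewal _ (axis_mem_cube i ht)).step n
  have h3 := (h.renewal _ zero_mem_cube).step n
  have h4 : e (n + 1) (axis i t) - e (n + 1) 0 = f (n + 1) (axis i t) - f (n + 1) 0 -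
      ∑ m ∈ Finset.Icc 1 (n + 1), ((g m (axis i t) - g m 0) * f (n + 1 - m) (axis i t) +
        g m 0 * (f (n + 1 - m) (axis i t) - f (n + 1 - m) 0)) := by
    have : ∑ m ∈ Finset.Icc 1 (n + 1), ((g m (axis i t) - g m 0) * f (n + 1 - m) (axis i t) +
        g m 0 * (f (n + 1 - m) (axis i t) - f (n + 1 - m) 0)) =
        ∑ m ∈ Finset.Icc 1 (n + 1), g m (axis i t) * f (n + 1 - m) (axis i t) -
        ∑ m ∈ Finset.Icc 1 (n + 1), g m 0 * f (n + 1 - m) 0 := by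
      rw [← Finset.sum_sub_distrib]
      exact Finset.sum_congr rfl fun m _ => by ring
    rw [this, h2, h3]; ring
  rw [h4, sub_div (f (n + 1) (axis i t) - f (n + 1) 0),
    mul_sub (2 * d : ℝ) ((f (n + 1) (axis i t) - f (n + 1) 0) / t ^ 2), Finset.sum_div,
    Finset.mul_sum]
  congr 1
  exact Finset.sum_congr rfl fun m _ => by ring

theorem Model.g_zero (h : Model d D z f g e) {k : Momentum d} (hk : k ∈ cube d) : g 0 k = 0 :=
  (h.renewal k hk).g_zero

theorem Model.momentSeq (h : Model d D z f g e) (hd : 0 < d) :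
    MomentSeq (fun n => nlap D (f n)) (fun m => nlap D (g m))
      (momentErr (fun n => nlap D (f n)) (fun m => nlap D (g m)) (fun n => f n 0) fun m => g m 0)
      (fun n => f n 0) (fun m => g m 0) where
  l_zero := by
    have : lap0 (f 0) = lap0 fun _ => 1 := lap0_congr fun k hk => (h.renewal k hk).f_zero
    simp only [nlap, this, lap0_const hd, zero_div]
  γ_zero := by
    have : lap0 (g 0) = lap0 fun _ => 0 := lap0_congr fun k hk => (h.renewal k hk).g_zero
    simp only [nlap, this, lap0_const hd, zero_div]
  ε_zero := by rw [momentErr, if_pos rfl]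
  step n := by rw [momentErr, if_neg (by omega)]; ring

/-- The error in the Laplacian recursion is the limiting second difference of e divided by σ². The
bound |e(k) - e(0)| ≤ c a(k) controls it, since the second differences of a tend to σ². -/
theorem Model.abs_momentErr_le (h : Model d D z f g e) (w : Walk d L η c₁ CD D) (hd : 0 < d)
    (hc₁ : 0 < c₁) {n : ℕ} {c : ℝ} (hc : 0 ≤ c)
    (hu : 1 ≤ n → ∀ k ∈ cube d, |e n k - e n 0| ≤ c * a D k) :
    |momentErr (fun n => nlap D (f n)) (fun m => nlap D (g m)) (fun n => f n 0)
      (fun m => g m 0) n| ≤ c := by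
  rcases n with _ | n
  · rw [momentErr, if_pos rfl, abs_zero]; exact hc
  · have hσ := w.sigmaSq_pos hd hc₁
    have h1 := w.abs_le_of_tendsto ⟨0, hd⟩ (hu (by omega)) (h.tendsto_err ⟨0, hd⟩ n)
    rw [momentErr, if_neg (by omega)]
    have h2 : nlap D (f (n + 1)) - ∑ m ∈ Finset.Icc 1 (n + 1),
        (nlap D (g m) * f (n + 1 - m) 0 + g m 0 * nlap D (f (n + 1 - m))) =
        (lap0 (f (n + 1)) - ∑ m ∈ Finset.Icc 1 (n + 1),
        (lap0 (g m) * f (n + 1 - m) 0 + g m 0 * lap0 (f (n + 1 - m)))) / sigmaSq D := by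
      rw [sub_div, Finset.sum_div, nlap]
      congr 1
      exact Finset.sum_congr rfl fun m _ => by rw [nlap, nlap]; ring
    rw [h2, abs_div, abs_of_pos hσ, div_le_iff₀ hσ]
    exact h1

theorem Model.nlap_g_one (h : Model d D z f g e) (w : Walk d L η c₁ CD D) (hd : 0 < d)
    (hc₁ : 0 < c₁) : nlap D (g 1) = -z := by
  have hσ := w.sigmaSq_pos hd hc₁
  have h1 := tendsto_lap0 (h.diff_g 1) (h.symm_g 1) ⟨0, hd⟩
  have h2 := (tendsto_lap0 w.diff w.symm ⟨0, hd⟩).const_mul z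
  have h3 : lap0 (g 1) = z * lap0 (Dhat D) := by
    refine tendsto_nhds_unique_of_eventuallyEq h1 h2 ?_
    filter_upwards [eventually_abs_le_pi] with t ht
    rw [h.g_one _ (axis_mem_cube _ ht), h.g_one _ zero_mem_cube]
    ring
  rw [nlap, h3, div_eq_iff hσ.ne', sigmaSq]
  ring

variable {q b : ℝ} {N : ℕ}

/-- The defect of the partial sum at N, propagated back to j through the sum of g_m over (j, N]. -/
theorem CoeffBounds.abs_one_sub_sum_le (hb : CoeffBounds d q b N D g e) (hb0 : 0 ≤ b) (hq : 1 < q)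
    {j : ℕ} (hj : 1 ≤ j) (hjN : j ≤ N) :
    |1 - ∑ m ∈ Finset.range (j + 1), g m 0| ≤ 2 * b * psi q j := by
  have e1 : 1 - ∑ m ∈ Finset.range (j + 1), g m 0 = (1 - ∑ m ∈ Finset.range (N + 1), g m 0) +
      ∑ m ∈ Finset.Ioc j N, g m 0 := by
    have := Finset.sum_range_add_sum_Ico (fun m => g m 0) (show j + 1 ≤ N + 1 by omega)
    rw [← this]
    have h2 : Finset.Ico (j + 1) (N + 1) = Finset.Ioc j N := by
        ext; simp only [Finset.mem_Ico, Finset.mem_Ioc]; omega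
    rw [h2]; ring
  have h1 : |∑ m ∈ Finset.Ioc j N, g m 0| ≤ b * psi q j := by
    calc _ ≤ ∑ m ∈ Finset.Ioc j N, |g m 0| := Finset.abs_sum_le_sum_abs _ _
      _ ≤ ∑ m ∈ Finset.Ioc j N, b * psi (q + 1) m := Finset.sum_le_sum fun m hm => by
          rw [Finset.mem_Ioc] at hm
          exact hb.g_le 0 zero_mem_cube m (by omega) hm.2
      _ ≤ b * (q⁻¹ * psi q j) := by
          rw [← Finset.mul_sum]
          exact mul_le_mul_of_nonneg_left (sum_Ioc_psi_le (by linarith) _ _) hb0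
      _ ≤ b * (1 * psi q j) := by
          have := psi_nonneg q j
          have := inv_le_one_of_one_le₀ hq.le
          gcongr
      _ = _ := by ring
  have h2 : b * psi q N ≤ b * psi q j :=
    mul_le_mul_of_nonneg_left (psi_antitone (by linarith) hjN) hb0
  rw [e1]
  refine (abs_add_le _ _).trans ?_
  linarith [hb.tail]

theorem CoeffBounds.nearCritical (h : Model d D z f g e) (hb : CoeffBounds d q b N D g e)
    (hb0 : 0 ≤ b) (hq : 1 < q) :
    NearCritical q (2 * b) N (fun m => g m 0) (fun m => e m 0) where
  tail j hj hjN := hb.abs_one_sub_sum_le hb0 hq hj hjN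
  err j hj hjN := by
    have := psi_nonneg q j
    rcases hj.eq_or_lt with rfl | hj
    · rw [h.e_one 0 zero_mem_cube, abs_zero]; positivity
    · refine (hb.e_le 0 zero_mem_cube j hj hjN).trans ?_
      have := psi_anti_exp (show q ≤ q + 1 by linarith) j
      nlinarith

theorem CoeffBounds.abs_z_sub_one_le (h : Model d D z f g e) (w : Walk d L η c₁ CD D)
    (hb : CoeffBounds d q b N D g e) (hb0 : 0 ≤ b) (hq : 1 < q) (hN : 1 ≤ N) :
    |1 - z| ≤ 2 * b * psi q 1 := by
  have := hb.abs_one_sub_sum_le hb0 hq le_rfl hN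
  rwa [Finset.sum_range_succ, Finset.sum_range_one, h.g_zero zero_mem_cube,
    h.g_one 0 zero_mem_cube, Dhat_zero w.normalised, mul_one, zero_add] at this

/-- The series X cancels the first coefficient up to 1 - z: the normalised Laplacian of g_1 = zD̂ is
-z. -/
theorem CoeffBounds.bd_gamma (h : Model d D z f g e) (w : Walk d L η c₁ CD D)
    (hb : CoeffBounds d q b N D g e) (hb0 : 0 ≤ b) (hq : 1 < q) (hd : 0 < d) (hc₁ : 0 < c₁) :
    Bd N (psi q) (2 * b) (PowerSeries.mk (fun m => nlap D (g m)) + PowerSeries.X) := by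
  intro n hn
  have hp := psi_nonneg q n
  have hσ := w.sigmaSq_pos hd hc₁
  rw [map_add, PowerSeries.coeff_mk, PowerSeries.coeff_X]
  rcases Nat.lt_trichotomy n 1 with h1 | h1 | h1
  · have : n = 0 := by omega
    subst this
    rw [if_neg (by omega), (h.momentSeq hd).γ_zero, add_zero, abs_zero]; positivity
  · subst h1
    rw [if_pos rfl, h.nlap_g_one w hd hc₁, neg_add_eq_sub]
    exact hb.abs_z_sub_one_le h w hb0 hq hn
  · rw [if_neg (by omega), add_zero, nlap, abs_div, abs_of_pos hσ, div_le_iff₀ hσ]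
    refine (hb.g_lap n h1 hn).trans ?_
    nlinarith [mul_nonneg (mul_nonneg hb0 hσ.le) hp]

theorem CoeffBounds.bd_eps (h : Model d D z f g e) (w : Walk d L η c₁ CD D)
    (hb : CoeffBounds d q b N D g e) (hb0 : 0 ≤ b) (hd : 0 < d) (hc₁ : 0 < c₁) :
    Bd N (psi q) (2 * b) (PowerSeries.mk (momentErr (fun n => nlap D (f n))
      (fun m => nlap D (g m)) (fun n => f n 0) fun m => g m 0)) := by
  intro n hn
  have hp := psi_nonneg q n
  rw [PowerSeries.coeff_mk]
  have h0 : 0 ≤ b * psi q n := by positivity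
  refine (h.abs_momentErr_le w hd hc₁ h0 fun h1 k hk => ?_).trans (by nlinarith)
  rcases h1.eq_or_lt with rfl | h1
  · rw [h.e_one k hk, h.e_one 0 zero_mem_cube, sub_zero, abs_zero]
    have := w.a_nonneg k
    positivity
  · exact (hb.e_sub k hk n h1 hn).trans (le_of_eq (by ring))

/-- The mass lost at k relative to 0 is a(k) to leading order: m = 1 contributes z a(k), and the
increments with m ≥ 2 are O(b a(k)) in total. -/
theorem CoeffBounds.abs_sum_sub_le (h : Model d D z f g e) (w : Walk d L η c₁ CD D)
    (hB : CoeffBounds d q b N D g e) (hb0 : 0 ≤ b) (hq1 : 1 < q) (hN : 1 ≤ N) {k : Momentum d}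
    (hk : k ∈ cube d) :
    |∑ m ∈ Finset.range (N + 1), (g m 0 - g m k) - a D k| ≤ (2 + psiSum q) * b * a D k := by
  have ha0 := w.a_nonneg k
  have hz : |1 - z| ≤ 2 * b := by
    refine (hB.abs_z_sub_one_le h w hb0 hq1 hN).trans ?_
    have := psi_le_one (show 0 ≤ q by linarith) 1
    nlinarith
  have hN1 : N + 1 = 2 + (N - 1) := by omega
  have e1 : ∑ m ∈ Finset.range (N + 1), (g m 0 - g m k) - a D k = (z - 1) * a D k +
      ∑ i ∈ Finset.range (N - 1), (g (2 + i) 0 - g (2 + i) k) := by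
    rw [hN1, Finset.sum_range_add, Finset.sum_range_succ, Finset.sum_range_one,
      h.g_zero zero_mem_cube, h.g_zero hk, h.g_one 0 zero_mem_cube, h.g_one k hk,
      Dhat_zero w.normalised, a]
    ring
  have h2 : |∑ i ∈ Finset.range (N - 1), (g (2 + i) 0 - g (2 + i) k)| ≤ b * a D k * psiSum q := by
    calc _ ≤ ∑ i ∈ Finset.range (N - 1), |g (2 + i) 0 - g (2 + i) k| :=
          Finset.abs_sum_le_sum_abs _ _
      _ ≤ ∑ i ∈ Finset.range (N - 1), b * a D k * psi q i := Finset.sum_le_sum fun i hi => by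
          rw [Finset.mem_range] at hi
          rw [abs_sub_comm]
          refine (hB.g_sub k hk (2 + i) (by omega) (by omega)).trans ?_
          exact mul_le_mul_of_nonneg_left (psi_antitone (by linarith) (by omega)) (by positivity)
      _ ≤ _ := by
          rw [← Finset.mul_sum]
          exact mul_le_mul_of_nonneg_left (sum_psi_le hq1 _) (by positivity)
  rw [e1]
  refine (abs_add_le _ _).trans ?_
  rw [abs_mul, abs_of_nonneg ha0, abs_sub_comm]
  have := mul_le_mul_of_nonneg_right hz ha0
  linarith

/-- Partial sums of g(k), compared with the effective mass ρ = 1 - Σ_{m ≤ N}(g_m(0) - g_m(k)). The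
definition of ρ uses only indices up to N, as the induction requires. -/
theorem CoeffBounds.abs_partial_le (hB : CoeffBounds d q b N D g e) (hb0 : 0 ≤ b) (hq1 : 1 < q)
    {k : Momentum d} (hk : k ∈ cube d) {j : ℕ} (hj : 1 ≤ j) (hjN : j ≤ N) :
    |1 - ∑ m ∈ Finset.range (N + 1), (g m 0 - g m k) - ∑ m ∈ Finset.range (j + 1), g m k| ≤
      4 * b * psi q j := by
  have e2 : 1 - ∑ m ∈ Finset.range (N + 1), (g m 0 - g m k) -
      ∑ m ∈ Finset.range (j + 1), g m k = (1 - ∑ m ∈ Finset.range (j + 1), g m 0) -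
      ∑ m ∈ Finset.Ioc j N, (g m 0 - g m k) := by
    have := Finset.sum_range_add_sum_Ico (fun m => g m 0 - g m k) (show j + 1 ≤ N + 1 by omega)
    rw [← this]
    have h2 : Finset.Ico (j + 1) (N + 1) = Finset.Ioc j N := by
      ext; simp only [Finset.mem_Ico, Finset.mem_Ioc]; omega
    rw [h2, Finset.sum_sub_distrib (s := Finset.range (j + 1))]; ring
  have h7 : |∑ m ∈ Finset.Ioc j N, (g m 0 - g m k)| ≤ 2 * b * psi q j := by
    calc _ ≤ ∑ m ∈ Finset.Ioc j N, |g m 0 - g m k| := Finset.abs_sum_le_sum_abs _ _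
      _ ≤ ∑ m ∈ Finset.Ioc j N, 2 * b * psi (q + 1) m := Finset.sum_le_sum fun m hm => by
          rw [Finset.mem_Ioc] at hm
          refine (abs_sub _ _).trans ?_
          linarith [hB.g_le 0 zero_mem_cube m (by omega) hm.2, hB.g_le k hk m (by omega) hm.2]
      _ ≤ 2 * b * (q⁻¹ * psi q j) := by
          rw [← Finset.mul_sum]
          exact mul_le_mul_of_nonneg_left (sum_Ioc_psi_le (by linarith) _ _) (by linarith)
      _ ≤ 2 * b * (1 * psi q j) := by
          have := psi_nonneg q j
          have := inv_le_one_of_one_le₀ hq1.le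
          gcongr
      _ = _ := by ring
  rw [e2]
  refine (abs_sub _ _).trans ?_
  linarith [hB.abs_one_sub_sum_le hb0 hq1 hj hjN]

theorem CoeffBounds.abs_f_zero_le (h : Model d D z f g e) (hB : CoeffBounds d q b N D g e)
    (hb0 : 0 ≤ b) (hq1 : 1 < q) (hb3 : 8 * psiSum q * b ≤ 1) (hb4 : 4 * convC q * b ≤ 1) {n : ℕ}
    (hnN : n ≤ N) : |f n 0| ≤ 2 := by
  have h1 := abs_le.1 ((hB.nearCritical h hb0 hq1).abs_sub_one_le hq1 (by linarith) (by linarith)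
    (h.renewal 0 zero_mem_cube) hnN)
  rw [abs_le]
  constructor <;> linarith

/-- Away from the origin the renewal functions decay. -/
theorem exists_decay (hη : 0 < η) (hc₁ : 0 < c₁) (hd : 4 < d) :
    ∃ C b₀ : ℝ, 1 ≤ C ∧ 0 < b₀ ∧ ∀ (L CD b z : ℝ) (D : (Fin d → ℤ) → ℝ) (N : ℕ)
      (f g e : ℕ → Momentum d → ℝ),
      Walk d L η c₁ CD D → Model d D z f g e → 0 ≤ b → b ≤ b₀ →
      CoeffBounds d (((d : ℝ) - 2) / 2) b N D g e →
      ∀ n, 1 ≤ n → n ≤ N → ∀ k ∈ cube d, |f n k| ≤ C * ((1 + a D k * n) ^ d)⁻¹ +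
        C * (4 * b) * (a D k ^ 2)⁻¹ * psi ((d : ℝ) / 2) n := by
  have hd' : (5 : ℝ) ≤ d := by exact_mod_cast hd
  set q : ℝ := ((d : ℝ) - 2) / 2 with hq
  have hq1 : 1 < q := by rw [hq]; linarith
  have hqd : q + 1 = (d : ℝ) / 2 := by rw [hq]; ring
  -- For |ρ| ≤ 1 - ca one needs (1 + 2c)a ≤ 2. This follows from a < 2 - η and c ≤ η/4, as (1 +
  -- η/2)(2 - η) ≤ 2; it rules out mass near -1.
  set c := min (η / 4) (1 / 2) with hc
  have hc0 : 0 < c := lt_min (by linarith) (by norm_num)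
  have hcη : c ≤ η / 4 := min_le_left _ _
  have hch : c ≤ 1 / 2 := min_le_right _ _
  obtain ⟨C, b₁, hC, hb₁, H⟩ := renewal_decay (p := d) hq1 (by omega) hc0 (by linarith)
  set S := psiSum q with hS
  have hS0 : 0 ≤ S := psiSum_nonneg q
  have hS1 : 1 ≤ S := one_le_psiSum hq1
  have hcC : 1 ≤ convC q := one_le_convC hq1
  refine ⟨2 * C, min (b₁ / 4) (min (c / (2 + S)) (min (1 / (8 * S)) (1 / (4 * convC q)))),
    by linarith, by positivity, ?_⟩
  intro L CD b z D N f g e w h hb0 hbb hB n hn hnN k hk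
  have hb1 : 4 * b ≤ b₁ := by
    have := hbb.trans (min_le_left _ _)
    linarith
  have hb2 : (2 + S) * b ≤ c := by
    have := (hbb.trans (min_le_right _ _)).trans (min_le_left _ _)
    rw [le_div_iff₀ (by linarith)] at this
    linarith
  have hb3 : 8 * S * b ≤ 1 := by
    have := ((hbb.trans (min_le_right _ _)).trans (min_le_right _ _)).trans (min_le_left _ _)
    rw [le_div_iff₀ (by linarith)] at this
    linarith
  have hb4 : 4 * convC q * b ≤ 1 := by
    have := ((hbb.trans (min_le_right _ _)).trans (min_le_right _ _)).trans (min_le_right _ _)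
    rw [le_div_iff₀ (by linarith)] at this
    linarith
  rw [← hqd]
  -- At k = 0 the claimed bound is just 2C, since 1/a² is 0 by convention; it is settled by |f_n(0)|
  -- ≤ 2.
  by_cases hk0 : k = 0
  · have h2 := hB.abs_f_zero_le h hb0 hq1 hb3 hb4 hnN
    rw [hk0, a_zero w.normalised]
    refine h2.trans ?_
    simp
    linarith
  have ha0 := w.a_pos hη hc₁ hk hk0
  have haη := w.lt_two k hk
  have hsum := hB.abs_sum_sub_le h w hb0 hq1 (hn.trans hnN) hk
  set α := a D k with hα
  set ρ := 1 - ∑ m ∈ Finset.range (N + 1), (g m 0 - g m k) with hρ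
  have hsum2 : |∑ m ∈ Finset.range (N + 1), (g m 0 - g m k) - α| ≤ c * α :=
    hsum.trans (mul_le_mul_of_nonneg_right hb2 ha0.le)
  obtain ⟨hs1, hs2⟩ := abs_le.1 hsum2
  have hρ1 : |ρ| ≤ 1 - c * α := by
    rw [abs_le, hρ]
    constructor
    · have h3 : (1 + 2 * c) * α ≤ 2 := by
        have : (1 + 2 * c) * α ≤ (1 + η / 2) * (2 - η) := by
          apply mul_le_mul <;> linarith
        nlinarith [sq_nonneg η]
      nlinarith
    · nlinarith
  have hρ2 : |1 - ρ| ≤ 2 * α := by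
    rw [hρ, abs_le]
    constructor <;> nlinarith
  have hα2 : α ≤ 2 := by linarith
  have hmain := H N α (4 * b) ρ (fun n => f n k) (fun n => g n k) (fun n => e n k) ha0 hα2
    (by linarith) hb1 hρ1 hρ2 (h.renewal k hk) ?_ ?_ ?_ n hnN
  · refine hmain.trans ?_
    have h5 : 0 ≤ C * ((1 + α * n) ^ d)⁻¹ := by positivity
    have h6 : 0 ≤ C * (4 * b) * (α ^ 2)⁻¹ * psi (q + 1) n := by
      have := psi_nonneg (q + 1) n
      positivity
    linarith
  · exact fun j hj hjN => hB.abs_partial_le hb0 hq1 hk hj hjN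
  · intro j hj hjN
    refine (hB.g_le k hk j hj hjN).trans ?_
    have := psi_nonneg (q + 1) j
    nlinarith
  · intro j hj hjN
    have := psi_nonneg (q + 1) j
    rcases hj.eq_or_lt with rfl | hj
    · rw [h.e_one k hk, abs_zero]; positivity
    · refine (hB.e_le k hk j hj hjN).trans ?_
      nlinarith

/-- The bootstrap step. K is chosen before the coefficient bound b enters, and so is independent of
the constants C_e and C_g that K will later determine; all that is asked of b is smallness. -/
theorem exists_fBounds (hη : 0 < η) (hc₁ : 0 < c₁) (hd : 4 < d) :
    ∃ K b₀ : ℝ, 1 < K ∧ 0 < b₀ ∧ ∀ (L b z : ℝ) (D : (Fin d → ℤ) → ℝ) (N : ℕ)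
      (f g e : ℕ → Momentum d → ℝ),
      Walk d L η c₁ CD D → Model d D z f g e → 0 ≤ b → b ≤ b₀ →
      CoeffBounds d (((d : ℝ) - 2) / 2) b N D g e →
      ∀ n, 1 ≤ n → n ≤ N → FBounds d L K D n (f n) := by
  have hd' : (5 : ℝ) ≤ d := by exact_mod_cast hd
  obtain ⟨C, b₁, hC, hb₁, H⟩ := exists_decay hη hc₁ hd
  obtain ⟨K₁, hK₁, H'⟩ := exists_norm1_bound (CD := CD) hd hη hc₁
  set q : ℝ := ((d : ℝ) - 2) / 2 with hq
  have hq1 : 1 < q := by rw [hq]; linarith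
  set S := psiSum q with hS
  have hS1 : 1 ≤ S := one_le_psiSum hq1
  have hcC : 1 ≤ convC q := one_le_convC hq1
  have hm : 0 < momentC q := by rw [momentC]; positivity
  -- C K₁ serves the integral bound. The summand 4 leaves room for |f_n(0)| ≤ 2, for the Laplacian
  -- bound n + (n + 1) ≤ 3n, and for K > 1.
  refine ⟨C * K₁ + 4, min b₁ (min (1 / 4) (min (1 / (2 * momentC q * S))
    (min (1 / (8 * S)) (1 / (4 * convC q))))),
    by nlinarith, by positivity, ?_⟩
  intro L b z D N f g e w h hb0 hbb hB n hn hnN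
  have hb1 := hbb.trans (min_le_left _ _)
  have hbb := hbb.trans (min_le_right _ _)
  have hb5 := hbb.trans (min_le_left _ _)
  have hbb := hbb.trans (min_le_right _ _)
  have hb2 := hbb.trans (min_le_left _ _)
  have hbb := hbb.trans (min_le_right _ _)
  have hb3 := hbb.trans (min_le_left _ _)
  have hb4 := hbb.trans (min_le_right _ _)
  rw [le_div_iff₀ (by positivity)] at hb2 hb3 hb4
  have hσ := w.sigmaSq_pos (by omega) hc₁
  have hβ : 0 < beta d L := by
    have := w.one_le
    rw [beta]; positivity
  have hCK : 0 ≤ C * K₁ := by positivity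
  obtain ⟨i1, i2⟩ := H' L D w.one_le w.nonneg w.normalised w.spread w.low w.high n C (4 * b) (f n)
    hn (by linarith) (by linarith) (by linarith) (h.meas n) (H L CD b z D N f g e w h hb0 hb1 hB n hn hnN)
  refine ⟨i1, i2.trans ?_, ?_, ?_⟩
  · have : 0 ≤ (n : ℝ) ^ (-(d : ℝ) / 2) := by positivity
    gcongr
    linarith
  · have := hB.abs_f_zero_le h hb0 hq1 (by linarith) (by linarith) hnN
    linarith
  · have h1 := (h.momentSeq (by omega)).abs_le (h.renewal 0 zero_mem_cube)
      (hB.nearCritical h hb0 hq1) hq1 (by linarith) (by linarith)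
      (hB.bd_gamma h w hb0 hq1 (by omega) hc₁) (hB.bd_eps h w hb0 (by omega) hc₁) hnN
    simp only [nlap] at h1
    rw [abs_div, abs_of_pos hσ, div_le_iff₀ hσ] at h1
    refine h1.trans ?_
    have hn' : (1 : ℝ) ≤ n := by exact_mod_cast hn
    have h2 : momentC q * (2 * b) * S ≤ 1 := by linarith
    have h3 : (n + (n + 1) * (momentC q * (2 * b) * S) : ℝ) ≤ (C * K₁ + 4) * n := by nlinarith
    calc _ ≤ (C * K₁ + 4) * n * sigmaSq D := mul_le_mul_of_nonneg_right h3 hσ.le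
      _ = _ := by ring

end
end LaceExpansion
end

noncomputable section
namespace LaceExpansion

/-! ### The critical point -/

/-- The interval `[s, t]` is mapped by `P` onto the window of half-width `w` around `1`. -/
structure CriticalWindow (P : ℝ → ℝ) (w s t : ℝ) : Prop where
  lt : s < t
  left : P s = 1 - w
  right : P t = 1 + w
  near : ∀ z ∈ Set.Icc s t, |1 - P z| ≤ w

/-- A monotone perturbation of `P` has a smaller window inside a given one. -/
theorem CriticalWindow.shrink {P P' : ℝ → ℝ} {w w' s t : ℝ} (h : CriticalWindow P w s t)
    (hw' : 0 < w') (hc : ContinuousOn P' (Set.Icc s t)) (hm : MonotoneOn P' (Set.Icc s t))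
    (hs : |P' s - P s| ≤ w - w') (ht : |P' t - P t| ≤ w - w') :
    ∃ s' t', CriticalWindow P' w' s' t' ∧ Set.Icc s' t' ⊆ Set.Icc s t := by
  have h1 : P' s ≤ 1 - w' := by
    have := (abs_le.1 hs).2
    rw [h.left] at this; linarith
  have h2 : 1 + w' ≤ P' t := by
    have := (abs_le.1 ht).1
    rw [h.right] at this; linarith
  obtain ⟨s', hs', hs1⟩ := intermediate_value_Icc h.lt.le hc ⟨h1, by linarith⟩
  have hc' : ContinuousOn P' (Set.Icc s' t) := hc.mono (Set.Icc_subset_Icc_left hs'.1)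
  obtain ⟨t', ht', ht1⟩ := intermediate_value_Icc hs'.2 hc'
    (⟨by rw [hs1]; linarith, h2⟩ : (1 + w') ∈ Set.Icc (P' s') (P' t))
  have hsub : Set.Icc s' t' ⊆ Set.Icc s t := Set.Icc_subset_Icc hs'.1 ht'.2
  have hlt : s' < t' := by
    refine lt_of_le_of_ne ht'.1 fun h => ?_
    rw [h, ht1] at hs1
    linarith
  refine ⟨s', t', ⟨hlt, hs1, ht1, fun z hz => ?_⟩, hsub⟩
  have h3 := hm hs' (hsub hz) hz.1
  have h4 := hm (hsub hz) (hsub (Set.right_mem_Icc.2 hlt.le)) hz.2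
  rw [hs1] at h3
  rw [ht1] at h4
  rw [abs_le]
  constructor <;> linarith

theorem exists_mem_nested_Icc {s t : ℕ → ℝ} (hst : ∀ n, s n ≤ t n)
    (hsub : ∀ n, Set.Icc (s (n + 1)) (t (n + 1)) ⊆ Set.Icc (s n) (t n)) :
    ∃ z, ∀ n, z ∈ Set.Icc (s n) (t n) := by
  have := IsCompact.nonempty_iInter_of_sequence_nonempty_isCompact_isClosed
    (fun n => Set.Icc (s n) (t n)) hsub (fun n => Set.nonempty_Icc.2 (hst n)) isCompact_Icc
    fun n => isClosed_Icc
  obtain ⟨z, hz⟩ := this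
  exact ⟨z, fun n => Set.mem_iInter.1 hz n⟩

/-- The partial sums `z + ∑_{2 ≤ m ≤ n} γ_m(z)`. -/
def partialSum (γ : ℕ → ℝ → ℝ) (n : ℕ) (z : ℝ) : ℝ := z + ∑ m ∈ Finset.Ico 2 (n + 1), γ m z

theorem partialSum_succ (γ : ℕ → ℝ → ℝ) {n : ℕ} (hn : 1 ≤ n) (z : ℝ) :
    partialSum γ (n + 1) z = partialSum γ n z + γ (n + 1) z := by
  rw [partialSum, partialSum, Finset.sum_Ico_succ_top (by omega)]; ring

/-- At stage n there is an interval of z mapped onto the window of half-width B psi q n around 1.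
There `hstep` supplies the bounds on γ_{n+1}, and the new partial sum is monotone, so a subinterval
maps onto the next smaller window. A point common to all the intervals has every bound and full sum
1. -/
theorem exists_critical {q B α : ℝ} (hq : 1 < q) (hB : 0 < B) (hBα : B ≤ α)
    (hsmall : B * psiSum q ≤ 1) {γ : ℕ → ℝ → ℝ} {P : ℕ → ℝ → Prop}
    (hP : ∀ m z, P m z → |γ m z| ≤ B * psi (q + 1) m ∧ DifferentiableAt ℝ (γ m) z ∧
      |deriv (γ m) z| ≤ B * psi q m)
    (hstep : ∀ n, 1 ≤ n → ∀ s t, s < t → Set.Icc s t ⊆ Set.Icc (1 - α) (1 + α) →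
      (∀ z ∈ Set.Icc s t, (∀ m, 2 ≤ m → m ≤ n → P m z) ∧
        |1 - partialSum γ n z| ≤ B * psi q n) → ∀ z ∈ Set.Icc s t, P (n + 1) z) :
    ∃ zc ∈ Set.Icc (1 - B) (1 + B), (∀ m, 2 ≤ m → P m zc) ∧
      ∀ n, 1 ≤ n → |1 - partialSum γ n zc| ≤ B * psi q n := by
  set Good : ℕ → ℝ × ℝ → Prop := fun n p =>
    CriticalWindow (partialSum γ n) (B * psi q n) p.1 p.2 ∧
    Set.Icc p.1 p.2 ⊆ Set.Icc (1 - B) (1 + B) ∧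
    ∀ z ∈ Set.Icc p.1 p.2, ∀ m, 2 ≤ m → m ≤ n → P m z with hGood
  have hps : ∀ z, partialSum γ 1 z = z := fun z => by simp [partialSum]
  have hψ1 := psi_pos q 1
  have base : Good 1 (1 - B * psi q 1, 1 + B * psi q 1) := by
    have h0 : 0 < B * psi q 1 := by positivity
    have h1 : B * psi q 1 ≤ B := by
      have := psi_le_one (show 0 ≤ q by linarith) 1
      nlinarith
    refine ⟨⟨by simp only; linarith, hps _, hps _, fun z hz => ?_⟩, ?_, fun z _ m h2 h1 => by omega⟩
    · rw [hps, abs_le]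
      constructor <;> linarith [hz.1, hz.2]
    · exact Set.Icc_subset_Icc (by simp only; linarith) (by simp only; linarith)
  have ind : ∀ n, 1 ≤ n → ∀ p, Good n p → ∃ p', Good (n + 1) p' ∧
      Set.Icc p'.1 p'.2 ⊆ Set.Icc p.1 p.2 := by
    intro n hn p hp
    obtain ⟨hw, hsub, hall⟩ := hp
    have hnew : ∀ z ∈ Set.Icc p.1 p.2, P (n + 1) z := by
      refine hstep n hn p.1 p.2 hw.lt
        (hsub.trans (Set.Icc_subset_Icc (by linarith) (by linarith))) fun z hz => ⟨hall z hz, ?_⟩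
      exact hw.near z hz
    have hall' : ∀ z ∈ Set.Icc p.1 p.2, ∀ m, 2 ≤ m → m ≤ n + 1 → P m z := by
      intro z hz m h2 h1
      rcases Nat.le_succ_iff.1 h1 with h | h
      · exact hall z hz m h2 h
      · rw [h]; exact hnew z hz
    have hder : ∀ z ∈ Set.Icc p.1 p.2, HasDerivAt (partialSum γ (n + 1))
        (1 + ∑ m ∈ Finset.Ico 2 (n + 1 + 1), deriv (γ m) z) z := by
      intro z hz
      refine (hasDerivAt_id z).add (HasDerivAt.fun_sum fun m hm => ?_)
      rw [Finset.mem_Ico] at hm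
      exact (hP m z (hall' z hz m hm.1 (by omega))).2.1.hasDerivAt
    -- The new coefficient is at most the decrease of the window width, by the telescoping bound for
    -- `psi`; this makes the windows nest.
    have hinc : ∀ z ∈ Set.Icc p.1 p.2, |partialSum γ (n + 1) z - partialSum γ n z| ≤
        B * psi q n - B * psi q (n + 1) := by
      intro z hz
      rw [partialSum_succ γ hn, add_sub_cancel_left]
      refine (hP _ z (hnew z hz)).1.trans ?_
      rw [← mul_sub]
      refine mul_le_mul_of_nonneg_left ?_ hB.le
      refine (psi_le_telescope (by linarith) n).trans ?_
      have h1 := inv_le_one_of_one_le₀ hq.le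
      have h2 := psi_antitone (show 0 ≤ q by linarith) (Nat.le_succ n)
      have h2 : 0 ≤ psi q n - psi q (n + 1) := sub_nonneg.2 h2
      nlinarith
    have hl : p.1 ∈ Set.Icc p.1 p.2 := Set.left_mem_Icc.2 hw.lt.le
    have hr : p.2 ∈ Set.Icc p.1 p.2 := Set.right_mem_Icc.2 hw.lt.le
    have hcont : ContinuousOn (partialSum γ (n + 1)) (Set.Icc p.1 p.2) :=
      fun z hz => (hder z hz).continuousAt.continuousWithinAt
    -- The derivative is 1 plus a sum of size at most B Σ psi q m ≤ 1.
    have hmono : MonotoneOn (partialSum γ (n + 1)) (Set.Icc p.1 p.2) := by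
      refine monotoneOn_of_deriv_nonneg (convex_Icc _ _) hcont
        (fun z hz => (hder z (interior_subset hz)).differentiableAt.differentiableWithinAt)
        fun z hz => ?_
      have hz := interior_subset hz
      rw [(hder z hz).deriv]
      have h1 : |∑ m ∈ Finset.Ico 2 (n + 1 + 1), deriv (γ m) z| ≤ B * psiSum q := by
        calc _ ≤ ∑ m ∈ Finset.Ico 2 (n + 1 + 1), |deriv (γ m) z| := Finset.abs_sum_le_sum_abs _ _
          _ ≤ ∑ m ∈ Finset.Ico 2 (n + 1 + 1), B * psi q m := Finset.sum_le_sum fun m hm => by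
              rw [Finset.mem_Ico] at hm
              exact (hP m z (hall' z hz m hm.1 (by omega))).2.2
          _ ≤ _ := by
              rw [← Finset.mul_sum]
              exact mul_le_mul_of_nonneg_left (sum_psi_le hq _) hB.le
      linarith [(abs_le.1 h1).1]
    obtain ⟨s', t', h1, h2⟩ := hw.shrink (mul_pos hB (psi_pos q (n + 1))) hcont hmono
      (hinc _ hl) (hinc _ hr)
    exact ⟨(s', t'), ⟨h1, h2.trans hsub, fun z hz => hall' z (h2 hz)⟩, h2⟩
  -- The intervals are indexed from 0, so `sq n` is good at stage n + 1.
  choose! nxt hnxt using ind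
  let sq : (n : ℕ) → ℝ × ℝ := fun n => Nat.rec (1 - B * psi q 1, 1 + B * psi q 1)
    (fun n p => nxt (n + 1) p) n
  have hsq : ∀ n, Good (n + 1) (sq n) := by
    intro n
    induction n with
    | zero => exact base
    | succ n ih => exact (hnxt (n + 1) (by omega) _ ih).1
  have hsub : ∀ n, Set.Icc (sq (n + 1)).1 (sq (n + 1)).2 ⊆ Set.Icc (sq n).1 (sq n).2 := fun n =>
    (hnxt (n + 1) (by omega) _ (hsq n)).2
  obtain ⟨zc, hzc⟩ := exists_mem_nested_Icc (s := fun n => (sq n).1) (t := fun n => (sq n).2)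
    (fun n => (hsq n).1.lt.le) hsub
  refine ⟨zc, (hsq 0).2.1 (hzc 0), fun m hm => (hsq m).2.2 zc (hzc m) m hm (by omega),
    fun n hn => ?_⟩
  obtain ⟨n, rfl⟩ := Nat.exists_eq_add_of_le' hn
  exact (hsq n).1.near zc (hzc n)

end LaceExpansion
end

/-! ### Assumptions E and G in terms of the weights, and the critical point at large L -/

noncomputable section
namespace LaceExpansion

section
variable {d : ℕ}

/-- The bounds of Assumptions E and G at a single `m` and `z`, in terms of the weights `psi`. -/
structure CoeffAt (d : ℕ) (q b ε : ℝ) (D : (Fin d → ℤ) → ℝ) (g e : ℕ → Momentum d → ℝ → ℝ)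
    (m : ℕ) (z : ℝ) : Prop where
  g_le : ∀ k ∈ cube d, |g m k z| ≤ b * psi (q + 1) m
  g_sub : ∀ k ∈ cube d, |g m k z - g m 0 z| ≤ b * a D k * psi q m
  g_lap : |lap0 (fun k => g m k z)| ≤ b * sigmaSq D * psi q m
  e_le : ∀ k ∈ cube d, |e m k z| ≤ b * psi (q + 1) m
  e_sub : ∀ k ∈ cube d, |e m k z - e m 0 z| ≤ b * a D k * psi q m
  g_diff : DifferentiableAt ℝ (fun w => g m 0 w) z
  g_deriv : |deriv (fun w => g m 0 w) z| ≤ b * psi q m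
  g_taylor : ∀ k ∈ cube d, ∀ ε', 0 ≤ ε' → ε' ≤ ε →
    |g m k z - g m 0 z - a D k * ((sigmaSq D)⁻¹ * lap0 (fun k => g m k z))| ≤
      b * a D k ^ (1 + ε') * psi (q - ε') m

/-- One constant 2^R serves all exponents r ≤ R, negative ones included: q - ε' may be negative. -/
theorem rpow_neg_le_psi {r R : ℝ} (hrR : r ≤ R) (hR : 0 ≤ R) {m : ℕ} (hm : 1 ≤ m) :
    (m : ℝ) ^ (-r) ≤ 2 ^ R * psi r m := by
  have hm' : (1 : ℝ) ≤ m := by exact_mod_cast hm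
  have h2 : (1 : ℝ) ≤ 2 ^ R := Real.one_le_rpow (by norm_num) hR
  have hψ := psi_pos r m
  rcases le_total r 0 with h | h
  · have h1 : (m : ℝ) ^ (-r) ≤ psi r m :=
      Real.rpow_le_rpow (by positivity) (by linarith) (by linarith)
    nlinarith
  · have h1 : (2 * (m : ℝ)) ^ (-r) ≤ psi r m :=
      Real.rpow_le_rpow_of_nonpos (by positivity) (by linarith) (by linarith)
    rw [Real.mul_rpow (by norm_num) (by positivity)] at h1
    have h3 : (2 : ℝ) ^ r ≤ 2 ^ R := Real.rpow_le_rpow_of_exponent_le (by norm_num) hrR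
    have h4 : (2 : ℝ) ^ r * 2 ^ (-r) = 1 := by
      rw [← Real.rpow_add (by norm_num), add_neg_cancel, Real.rpow_zero]
    calc (m : ℝ) ^ (-r) = 2 ^ r * (2 ^ (-r) * (m : ℝ) ^ (-r)) := by rw [← mul_assoc, h4, one_mul]
      _ ≤ 2 ^ R * psi r m := by gcongr

theorem beta_pos {L : ℝ} (hL : 1 ≤ L) : 0 < beta d L := by rw [beta]; positivity

theorem beta_le_inv {L : ℝ} (hd : d ≠ 0) (hL : 1 ≤ L) : beta d L ≤ L⁻¹ := by
  rw [beta]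
  exact inv_anti₀ (by linarith) (le_self_pow₀ hL hd)

theorem coeffAt_of_bounds {Ce Cg L ε z : ℝ} (hd : 4 < d) (hL : 1 ≤ L) (hε : 0 ≤ ε)
    {D : (Fin d → ℤ) → ℝ} (hσ : 0 < sigmaSq D) (ha : ∀ k, 0 ≤ a D k)
    {g e : ℕ → Momentum d → ℝ → ℝ} {m : ℕ} (hm : 2 ≤ m)
    (hE : ∀ k ∈ cube d, |e m k z| ≤ Ce * beta d L * (m : ℝ) ^ (-(d : ℝ) / 2) ∧
      |e m k z - e m 0 z| ≤ Ce * a D k * beta d L * (m : ℝ) ^ (-((d : ℝ) - 2) / 2))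
    (hG : ∀ k ∈ cube d, |g m k z| ≤ Cg * beta d L * (m : ℝ) ^ (-(d : ℝ) / 2) ∧
      |lap0 (fun q => g m q z)| ≤
        Cg * sigmaSq D * beta d L * (m : ℝ) ^ (-((d : ℝ) - 2) / 2) ∧
      DifferentiableAt ℝ (fun w => g m 0 w) z ∧
      |deriv (fun w => g m 0 w) z| ≤ Cg * beta d L * (m : ℝ) ^ (-((d : ℝ) - 2) / 2) ∧
      ∀ ε' : ℝ, 0 ≤ ε' → ε' ≤ ε →
        |g m k z - g m 0 z - a D k * (sigmaSq D)⁻¹ * lap0 (fun q => g m q z)| ≤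
          Cg * beta d L * a D k ^ (1 + ε') * (m : ℝ) ^ (-((d : ℝ) - 2 - 2 * ε') / 2)) :
    CoeffAt d (((d : ℝ) - 2) / 2) (2 * (2 ^ ((d : ℝ) / 2) * (|Ce| + |Cg| + 1)) * beta d L) ε
      D g e m z := by
  have hd' : (5 : ℝ) ≤ d := by exact_mod_cast hd
  set q : ℝ := ((d : ℝ) - 2) / 2 with hq
  have hq1 : q + 1 = (d : ℝ) / 2 := by rw [hq]; ring
  set W : ℝ := 2 ^ ((d : ℝ) / 2) with hW
  have hW0 : 0 < W := by rw [hW]; positivity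
  set β := beta d L with hβ
  have hβ0 : 0 < β := beta_pos hL
  set M := |Ce| + |Cg| + 1 with hM
  have hM0 : 0 < M := by positivity
  have hCe : Ce ≤ M := by rw [hM]; linarith [le_abs_self Ce, abs_nonneg Cg]
  have hCg : Cg ≤ M := by rw [hM]; linarith [le_abs_self Cg, abs_nonneg Ce]
  have key : ∀ {C X r : ℝ}, C ≤ M → 0 ≤ X → r ≤ (d : ℝ) / 2 →
      C * X * (m : ℝ) ^ (-r) ≤ W * M * X * psi r m := by
    intro C X r hC hX hr
    have h1 := rpow_neg_le_psi hr (by positivity) (show 1 ≤ m by omega)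
    have h2 : 0 ≤ (m : ℝ) ^ (-r) := by positivity
    calc C * X * (m : ℝ) ^ (-r) ≤ M * X * (m : ℝ) ^ (-r) := by gcongr
      _ ≤ M * X * (W * psi r m) := by gcongr
      _ = _ := by ring
  have two : ∀ {X r : ℝ}, 0 ≤ X → W * M * X * psi r m ≤ 2 * (W * M) * X * psi r m := by
    intro X r hX
    have := psi_pos r m
    have : 0 ≤ W * M * X * psi r m := by positivity
    linarith
  have x1 : -(d : ℝ) / 2 = -(q + 1) := by rw [hq1]; ring
  have x2 : -((d : ℝ) - 2) / 2 = -q := by rw [hq]; ring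
  have x3 : ∀ ε' : ℝ, -((d : ℝ) - 2 - 2 * ε') / 2 = -(q - ε') := fun ε' => by rw [hq]; ring
  have hqd : q ≤ (d : ℝ) / 2 := by linarith
  simp only [x1, x2, x3] at hE hG
  have hlap : |lap0 (fun q => g m q z)| ≤ W * M * (sigmaSq D * β) * psi q m := by
    refine (hG 0 zero_mem_cube).2.1.trans ?_
    rw [mul_assoc Cg]
    exact key hCg (by positivity) hqd
  refine ⟨fun k hk => ?_, fun k hk => ?_, ?_, fun k hk => ?_, fun k hk => ?_,
    (hG 0 zero_mem_cube).2.2.1, ?_, fun k hk ε' h0 h1 => ?_⟩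
  · exact ((hG k hk).1.trans (key hCg hβ0.le hq1.le)).trans (two hβ0.le)
  -- The case ε' = 0, combined with the Laplacian bound, gives the Lipschitz bound in a; adding the
  -- two is the origin of the factor 2 in the constant.
  · have h1 := (hG k hk).2.2.2.2 0 le_rfl hε
    rw [add_zero, Real.rpow_one, sub_zero, mul_assoc Cg] at h1
    have hak := ha k
    have h1 := h1.trans (key hCg (by positivity) hqd)
    have h2 : |a D k * (sigmaSq D)⁻¹ * lap0 (fun q => g m q z)| ≤
        W * M * (β * a D k) * psi q m := by
      rw [abs_mul, abs_of_nonneg (by positivity)]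
      calc _ ≤ a D k * (sigmaSq D)⁻¹ * (W * M * (sigmaSq D * β) * psi q m) := by gcongr
        _ = _ := by field_simp
    have h3 := abs_add_le (g m k z - g m 0 z - a D k * (sigmaSq D)⁻¹ * lap0 (fun q => g m q z))
      (a D k * (sigmaSq D)⁻¹ * lap0 (fun q => g m q z))
    rw [sub_add_cancel] at h3
    linarith
  · refine (hlap.trans (two (by positivity))).trans (le_of_eq (by ring))
  · exact ((hE k hk).1.trans (key hCe hβ0.le hq1.le)).trans (two hβ0.le)
  · have hak := ha k
    have h1 := (hE k hk).2
    rw [mul_assoc Ce] at h1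
    refine (h1.trans (key hCe (by positivity) hqd)).trans ((two (by positivity)).trans
      (le_of_eq (by ring)))
  · exact ((hG 0 zero_mem_cube).2.2.2.1.trans (key hCg hβ0.le hqd)).trans (two hβ0.le)
  · have hak := ha k
    have h2 := (hG k hk).2.2.2.2 ε' h0 h1
    rw [mul_assoc Cg] at h2
    rw [← mul_assoc (a D k)]
    refine (h2.trans (key hCg (by positivity) (by linarith))).trans ((two (by positivity)).trans
      (le_of_eq (by ring)))

/-- Replace the value at `n = 0` of a family of functions by the constant `c`. -/
def atZero (c : ℝ) (u : ℕ → Momentum d → ℝ → ℝ) (z : ℝ) (n : ℕ) (k : Momentum d) : ℝ :=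
  if n = 0 then c else u n k z

theorem atZero_of_ne (c : ℝ) (u : ℕ → Momentum d → ℝ → ℝ) (z : ℝ) {n : ℕ} (hn : n ≠ 0) :
    atZero c u z n = fun k => u n k z := by
  ext k; rw [atZero, if_neg hn]

theorem atZero_zero (c : ℝ) (u : ℕ → Momentum d → ℝ → ℝ) (z : ℝ) :
    atZero c u z 0 = fun _ => c := by
  ext k; rw [atZero, if_pos rfl]

theorem LatticeSymmetric.congr {h h' : Momentum d → ℝ} (hs : LatticeSymmetric h)
    (hh : ∀ k ∈ cube d, h k = h' k) : LatticeSymmetric h' := by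
  refine ⟨fun k hk i => ?_, fun k hk p => ?_⟩
  · rw [← hh k hk, ← hs.1 k hk i, hh]
    intro j
    simp only [Function.update_apply]
    split_ifs with hj
    · rw [abs_neg]; exact hk i
    · exact hk j
  · rw [← hh k hk, ← hs.2 k hk p, hh]
    exact fun j => hk (p j)

variable {ε : ℝ} {D : ℝ → (Fin d → ℤ) → ℝ} {f g e : ℝ → ℕ → Momentum d → ℝ → ℝ}

theorem AssumptionD.f_one_eq (hD : AssumptionD d ε D f e) {L : ℝ} (hL : 1 ≤ L) {k : Momentum d}
    (hk : k ∈ cube d) {z : ℝ} (hz : 0 < z) : f L 1 k z = z * Dhat (D L) k := by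
  have := congrArg Complex.re (hD.f_one L hL k hk z hz)
  simpa [Dhat] using this

theorem AssumptionD.walk (hD : AssumptionD d ε D f e) (hreg : Regularity d f g)
    (hS : AssumptionS d f g e) :
    ∃ η c₁ CD : ℝ, 0 < η ∧ 0 < c₁ ∧ ∀ L, 1 ≤ L → Walk d L η c₁ CD (D L) := by
  obtain ⟨η, c₁, c₂, hη, hc₁, -, hb⟩ := hD.fourier_bounds
  obtain ⟨CD, hCD⟩ := hD.spread
  refine ⟨η, c₁, CD, hη, hc₁, fun L hL => ?_⟩
  have h1 : ∀ k ∈ cube d, f L 1 k 1 = Dhat (D L) k := fun k hk => by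
    rw [hD.f_one_eq hL hk one_pos, one_mul]
  exact ⟨hL, hD.nonneg L hL, hD.normalised L hL, (hCD L hL).1, fun k hk => ((hb L hL).1 k hk).1,
    (hb L hL).2.1, (hb L hL).2.2, (hreg L hL 1 le_rfl 1 one_pos).2.1.congr h1,
    ((hS L hL 1 le_rfl).1 1 one_pos).1.congr h1⟩

theorem model_of_assumptions (hrec : Recursion d f g e) (hreg : Regularity d f g)
    (hS : AssumptionS d f g e) (hD : AssumptionD d ε D f e) {L z : ℝ} (hL : 1 ≤ L) (hz : 0 < z) :
    Model d (D L) z (atZero 1 (f L) z) (atZero 0 (g L) z) (atZero 0 (e L) z) := by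
  have hstep : ∀ k ∈ cube d, ∀ n, atZero 1 (f L) z n k = f L n k z := by
    intro k hk n
    rcases eq_or_ne n 0 with rfl | hn
    · rw [atZero_zero, (hrec L hL k hk z hz).1]
    · rw [atZero_of_ne _ _ _ hn]
  have he : ∀ n k, atZero 0 (e L) z (n + 1) k = e L (n + 1) k z := fun n k => by
    rw [atZero_of_ne _ _ _ (by omega)]
  refine ⟨fun k hk => ⟨?_, ?_, ?_, fun n => ?_⟩, fun n => ?_, fun n => ?_, fun n => ?_,
    fun n => ?_, fun n => ?_, fun k hk => ?_, fun k hk => ?_⟩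
  · simp only [atZero_zero]
  · simp only [atZero_zero]
  · simp only [atZero_zero]
  · rw [hstep k hk, he, (hrec L hL k hk z hz).2 n]
    congr 1
    refine Finset.sum_congr rfl fun m hm => ?_
    rw [Finset.mem_Icc] at hm
    rw [hstep k hk, atZero_of_ne _ _ _ (by omega)]
  · rcases eq_or_ne n 0 with rfl | hn
    · rw [atZero_zero]; exact aemeasurable_const
    · rw [atZero_of_ne _ _ _ hn]; exact (hreg L hL n (by omega) z hz).1
  · rcases eq_or_ne n 0 with rfl | hn
    · rw [atZero_zero]; exact twiceDifferentiableAtZero_const 1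
    · rw [atZero_of_ne _ _ _ hn]; exact (hreg L hL n (by omega) z hz).2.1
  · rcases eq_or_ne n 0 with rfl | hn
    · rw [atZero_zero]; exact twiceDifferentiableAtZero_const 0
    · rw [atZero_of_ne _ _ _ hn]; exact (hreg L hL n (by omega) z hz).2.2
  · rcases eq_or_ne n 0 with rfl | hn
    · rw [atZero_zero]; exact ⟨fun _ _ _ => rfl, fun _ _ _ => rfl⟩
    · rw [atZero_of_ne _ _ _ hn]; exact ((hS L hL n (by omega)).1 z hz).1
  · rcases eq_or_ne n 0 with rfl | hn
    · rw [atZero_zero]; exact ⟨fun _ _ _ => rfl, fun _ _ _ => rfl⟩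
    · rw [atZero_of_ne _ _ _ hn]; exact ((hS L hL n (by omega)).1 z hz).2.1
  -- g_1 is not prescribed; the first step of the recursion, with f_0 = 1 and e_1 = 0, identifies it
  -- with f_1.
  · have h1 := (hrec L hL k hk z hz).2 0
    rw [zero_add, Finset.Icc_self, Finset.sum_singleton, hD.e_one L hL k hk z hz, Nat.sub_self,
      (hrec L hL k hk z hz).1, hD.f_one_eq hL hk hz] at h1
    rw [atZero_of_ne _ _ _ one_ne_zero, h1]
    ring
  · rw [atZero_of_ne _ _ _ one_ne_zero]
    exact hD.e_one L hL k hk z hz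

theorem coeffBounds_of_coeffAt {q b ε z : ℝ} {N : ℕ} {D : (Fin d → ℤ) → ℝ}
    {f g e : ℕ → Momentum d → ℝ → ℝ}
    (hmod : Model d D z (atZero 1 f z) (atZero 0 g z) (atZero 0 e z)) (hD0 : Dhat D 0 = 1)
    (h : ∀ m, 2 ≤ m → m ≤ N → CoeffAt d q b ε D g e m z)
    (ht : |1 - partialSum (fun m w => g m 0 w) N z| ≤ b * psi q N) (hN : 1 ≤ N) :
    CoeffBounds d q b N D (atZero 0 g z) (atZero 0 e z) := by
  refine ⟨fun k hk m h2 hm => ?_, fun k hk m h2 hm => ?_, fun m h2 hm => ?_, fun k hk m h2 hm => ?_,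
    fun k hk m h2 hm => ?_, ?_⟩
  · rw [atZero_of_ne _ _ _ (by omega)]; exact (h m h2 hm).g_le k hk
  · rw [atZero_of_ne _ _ _ (by omega)]; exact (h m h2 hm).g_sub k hk
  · rw [atZero_of_ne _ _ _ (by omega)]; exact (h m h2 hm).g_lap
  · rw [atZero_of_ne _ _ _ (by omega)]; exact (h m h2 hm).e_le k hk
  · rw [atZero_of_ne _ _ _ (by omega)]; exact (h m h2 hm).e_sub k hk
  · have : ∑ m ∈ Finset.range (N + 1), atZero 0 g z m 0 =
        partialSum (fun m w => g m 0 w) N z := by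
      rw [Finset.range_eq_Ico, Finset.sum_eq_sum_Ico_succ_bot (by omega),
        Finset.sum_eq_sum_Ico_succ_bot (by omega), hmod.g_zero zero_mem_cube,
        hmod.g_one 0 zero_mem_cube, hD0, partialSum]
      rw [zero_add, mul_one]
      congr 1
      refine Finset.sum_congr rfl fun m hm => ?_
      rw [Finset.mem_Ico] at hm
      rw [atZero_of_ne _ _ _ (by omega)]
    rw [this]
    exact ht

/-- For large `L` there is a critical point, at which all bounds hold for all `m`. -/
theorem exists_critical_point (hd : 4 < d) (hε : 0 ≤ ε) (hrec : Recursion d f g e)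
    (hreg : Regularity d f g) (hS : AssumptionS d f g e) (hD : AssumptionD d ε D f e)
    (hE : AssumptionE d D f e) (hG : AssumptionG d ε D f g) {η c₁ CD : ℝ} (hη : 0 < η)
    (hc₁ : 0 < c₁) (hW : ∀ L, 1 ≤ L → Walk d L η c₁ CD (D L)) :
    ∃ M K : ℝ, 0 < M ∧ 1 < K ∧ ∀ b₁ > 0, ∃ L₀ ≥ 1, ∀ L ≥ L₀, M * beta d L ≤ b₁ ∧
      ∃ zc, 0 < zc ∧ |zc - 1| ≤ M * beta d L ∧
        Model d (D L) zc (atZero 1 (f L) zc) (atZero 0 (g L) zc) (atZero 0 (e L) zc) ∧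
        (∀ N ≥ 1, CoeffBounds d (((d : ℝ) - 2) / 2) (M * beta d L) N (D L) (atZero 0 (g L) zc)
          (atZero 0 (e L) zc)) ∧
        (∀ m ≥ 2, CoeffAt d (((d : ℝ) - 2) / 2) (M * beta d L) ε (D L) (g L) (e L) m zc) ∧
        ∀ n ≥ 1, FBounds d L K (D L) n (fun k => f L n k zc) := by
  have hd' : (5 : ℝ) ≤ d := by exact_mod_cast hd
  -- The order of choice avoids circularity: K first, then α, C_e and C_g for this K, then M, and
  -- only then L so large that Mβ is below every threshold.
  obtain ⟨K, b₀, hK, hb₀, HF⟩ := exists_fBounds (CD := CD) hη hc₁ hd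
  obtain ⟨α₁, hα₁, hα₁', Ce, L₁, -, HE⟩ := hE K hK
  obtain ⟨α₂, hα₂, hα₂', Cg, L₂, -, HG⟩ := hG K hK
  set q : ℝ := ((d : ℝ) - 2) / 2 with hq
  have hq1 : 1 < q := by rw [hq]; linarith
  set M := 2 * (2 ^ ((d : ℝ) / 2) * (|Ce| + |Cg| + 1)) with hM
  have hM0 : 0 < M := by rw [hM]; positivity
  have hSp : 1 ≤ psiSum q := one_le_psiSum hq1
  set α := min α₁ α₂ with hα
  have hα0 : 0 < α := lt_min hα₁ hα₂
  have hα1 : α < 1 := (min_le_left _ _).trans_lt hα₁'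
  refine ⟨M, K, hM0, hK, fun b₁ hb₁ => ?_⟩
  set b₂ := min (min b₁ b₀) (min α (1 / psiSum q)) with hb₂
  have hb₂0 : 0 < b₂ := by positivity
  refine ⟨max (max 1 (M / b₂)) (max L₁ L₂), (le_max_left _ _).trans (le_max_left _ _), ?_⟩
  intro L hL
  have hL1 : 1 ≤ L := ((le_max_left _ _).trans (le_max_left _ _)).trans hL
  have hLM : M / b₂ ≤ L := ((le_max_right _ _).trans (le_max_left _ _)).trans hL
  have hLL₁ : L₁ ≤ L := ((le_max_left _ _).trans (le_max_right _ _)).trans hL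
  have hLL₂ : L₂ ≤ L := ((le_max_right _ _).trans (le_max_right _ _)).trans hL
  have hβ0 : 0 < beta d L := beta_pos hL1
  set B := M * beta d L with hB
  have hB0 : 0 < B := by positivity
  have hBb : B ≤ b₂ := by
    have h1 : B ≤ M * L⁻¹ := mul_le_mul_of_nonneg_left (beta_le_inv (by omega) hL1) hM0.le
    rw [div_le_iff₀ hb₂0] at hLM
    rw [← div_eq_mul_inv] at h1
    refine h1.trans ?_
    rw [div_le_iff₀ (by linarith)]
    linarith
  have hBb₁ : B ≤ b₁ := hBb.trans ((min_le_left _ _).trans (min_le_left _ _))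
  have hBb₀ : B ≤ b₀ := hBb.trans ((min_le_left _ _).trans (min_le_right _ _))
  have hBα : B ≤ α := hBb.trans ((min_le_right _ _).trans (min_le_left _ _))
  have hBS : B * psiSum q ≤ 1 := by
    have := hBb.trans ((min_le_right _ _).trans (min_le_right _ _))
    rwa [le_div_iff₀ (by linarith)] at this
  have w := hW L hL1
  have hσ := w.sigmaSq_pos (by omega) hc₁
  have hD0 := Dhat_zero w.normalised
  -- Coefficient bounds up to n imply the bounds on f up to n with the same K, which are the
  -- hypotheses of Assumptions E and G for the coefficients at n + 1.
  have hFB : ∀ n z, 0 < z → (∀ m, 2 ≤ m → m ≤ n → CoeffAt d q B ε (D L) (g L) (e L) m z) →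
      |1 - partialSum (fun m w => g L m 0 w) n z| ≤ B * psi q n →
      ∀ m, 1 ≤ m → m ≤ n → FBounds d L K (D L) m (fun k => f L m k z) := by
    intro n z hz hc ht m hm hmn
    have hmod := model_of_assumptions hrec hreg hS hD hL1 hz
    have := HF L B z (D L) n _ _ _ w hmod hB0.le hBb₀
      (coeffBounds_of_coeffAt hmod hD0 hc ht (by omega)) m hm hmn
    rwa [atZero_of_ne _ _ _ (by omega)] at this
  obtain ⟨zc, hzc, hc, ht⟩ := exists_critical (γ := fun m w => g L m 0 w)
    (P := fun m z => CoeffAt d q B ε (D L) (g L) (e L) m z) hq1 hB0 hBα hBS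
    (fun m z h => ⟨h.g_le 0 zero_mem_cube, h.g_diff, h.g_deriv⟩) (by
      intro n hn s t hst hsub hall z hz
      have hpos : ∀ z ∈ Set.Icc s t, 0 < z := fun z hz => by linarith [(hsub hz).1]
      have hsub₁ : Set.Icc s t ⊆ Set.Icc (1 - α₁) (1 + α₁) := hsub.trans
        (Set.Icc_subset_Icc (by linarith [min_le_left α₁ α₂]) (by linarith [min_le_left α₁ α₂]))
      have hsub₂ : Set.Icc s t ⊆ Set.Icc (1 - α₂) (1 + α₂) := hsub.trans
        (Set.Icc_subset_Icc (by linarith [min_le_right α₁ α₂]) (by linarith [min_le_right α₁ α₂]))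
      have hF : ∀ z ∈ Set.Icc s t, ∀ m : ℕ, 1 ≤ m → m ≤ n →
          FBounds d L K (D L) m (fun k => f L m k z) := fun z hz =>
        hFB n z (hpos z hz) (hall z hz).1 (hall z hz).2
      exact coeffAt_of_bounds hd hL1 hε hσ w.a_nonneg (by omega)
        (fun k hk => HE L hL1 hLL₁ s t hst hsub₁ n hF z hz k hk (n + 1) (by omega) le_rfl)
        (fun k hk => HG L hL1 hLL₂ s t hst hsub₂ n hF z hz k hk (n + 1) (by omega) le_rfl))
  have hzpos : 0 < zc := by linarith [hzc.1]
  have hmod := model_of_assumptions hrec hreg hS hD hL1 hzpos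
  refine ⟨hBb₁, zc, hzpos, by rw [abs_le]; constructor <;> linarith [hzc.1, hzc.2], hmod,
    fun N hN => coeffBounds_of_coeffAt hmod hD0 (fun m hm _ => hc m hm) (ht N hN) hN, hc,
    fun n hn => hFB n zc hzpos (fun m hm _ => hc m hm) (ht n hn) n hn le_rfl⟩

end
end LaceExpansion
end

noncomputable section
namespace LaceExpansion

/-! ### The constants at the critical point -/

section
variable {d : ℕ}

/-- A model at its critical point, with small coefficients. -/
structure Critical (d : ℕ) (L η c₁ CD q b : ℝ) (D : (Fin d → ℤ) → ℝ) (z : ℝ)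
    (f g e : ℕ → Momentum d → ℝ) : Prop where
  walk : Walk d L η c₁ CD D
  model : Model d D z f g e
  bounds : ∀ N ≥ 1, CoeffBounds d q b N D g e
  dim_pos : 0 < d
  c₁_pos : 0 < c₁
  b_nonneg : 0 ≤ b
  one_lt : 1 < q
  small_conv : 4 * convC q * b ≤ 1
  small_sum : 16 * psiSum q * b ≤ 1

/-- The mean `∑ m g_m(0)`. -/
def meanStep (g : ℕ → Momentum d → ℝ) : ℝ := ∑' m : ℕ, (m : ℝ) * g m 0

/-- The amplitude `A`. -/
def amplitude (g e : ℕ → Momentum d → ℝ) : ℝ := (1 + ∑' m, e m 0) / meanStep g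

/-- The diffusion constant `v`. -/
def diffusion (D : (Fin d → ℤ) → ℝ) (g : ℕ → Momentum d → ℝ) : ℝ :=
  -(∑' m, nlap D (g m)) / meanStep g

/-- If `u` differs from `c` times the unit mass at `1` by a small sequence, then its sum is
close to `c`. -/
theorem summable_near_unit {r B c : ℝ} (hr : 1 < r) {u : ℕ → ℝ}
    (hu : ∀ i, |u i - (if i = 1 then c else 0)| ≤ B * psi r i) :
    Summable u ∧ |∑' i, u i - c| ≤ B * psiSum r := by
  have h1 : HasSum (fun i : ℕ => if i = 1 then c else 0) c := hasSum_ite_eq 1 c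
  have h2 := summable_of_le_psi hr hu
  have h3 := abs_tsum_le_psiSum hr hu
  have h4 : Summable u := by
    have := h2.add h1.summable
    simpa using this
  refine ⟨h4, ?_⟩
  rwa [h4.tsum_sub h1.summable, h1.tsum_eq] at h3

variable {L η c₁ CD q b z : ℝ} {D : (Fin d → ℤ) → ℝ} {f g e : ℕ → Momentum d → ℝ}

namespace Critical

theorem nearCritical (h : Critical d L η c₁ CD q b D z f g e) (N : ℕ) :
    NearCritical q (2 * b) N (fun m => g m 0) (fun m => e m 0) := by
  have := (h.bounds (N + 1) (by omega)).nearCritical h.model h.b_nonneg h.one_lt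
  exact ⟨fun j h1 h2 => this.tail j h1 (by omega), fun j h1 h2 => this.err j h1 (by omega)⟩

theorem bd_gamma (h : Critical d L η c₁ CD q b D z f g e) (N : ℕ) :
    Bd N (psi q) (2 * b) (PowerSeries.mk (fun m => nlap D (g m)) + PowerSeries.X) := fun n hn =>
  (h.bounds (N + 1) (by omega)).bd_gamma h.model h.walk h.b_nonneg h.one_lt h.dim_pos h.c₁_pos n
    (by omega)

theorem bd_eps (h : Critical d L η c₁ CD q b D z f g e) (N : ℕ) :
    Bd N (psi q) (2 * b) (PowerSeries.mk (momentErr (fun n => nlap D (f n))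
      (fun m => nlap D (g m)) (fun n => f n 0) fun m => g m 0)) := fun n hn =>
  (h.bounds (N + 1) (by omega)).bd_eps h.model h.walk h.b_nonneg h.dim_pos h.c₁_pos n (by omega)

theorem abs_z_sub_one_le (h : Critical d L η c₁ CD q b D z f g e) : |1 - z| ≤ 2 * b * psi q 1 :=
  (h.bounds 1 le_rfl).abs_z_sub_one_le h.model h.walk h.b_nonneg h.one_lt le_rfl

theorem abs_mul_g_sub_le (h : Critical d L η c₁ CD q b D z f g e) (m : ℕ) :
    |(m : ℝ) * g m 0 - (if m = 1 then 1 else 0)| ≤ 2 * b * psi q m := by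
  have hb := h.b_nonneg
  have hp := psi_nonneg q m
  rcases Nat.lt_trichotomy m 1 with h1 | h1 | h1
  · have : m = 0 := by omega
    subst this
    simp only [Nat.cast_zero, zero_mul, zero_ne_one, if_false, sub_self, abs_zero]
    positivity
  · subst h1
    rw [if_pos rfl, h.model.g_one 0 zero_mem_cube, Dhat_zero h.walk.normalised, Nat.cast_one,
      one_mul, mul_one, abs_sub_comm]
    exact h.abs_z_sub_one_le
  · rw [if_neg (by omega), sub_zero, abs_mul, Nat.abs_cast]
    have h2 := (h.bounds m (by omega)).g_le 0 zero_mem_cube m h1 le_rfl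
    have h3 := succ_mul_psi (q + 1) m
    rw [add_sub_cancel_right] at h3
    have h4 := psi_nonneg (q + 1) m
    calc (m : ℝ) * |g m 0| ≤ m * (b * psi (q + 1) m) := by gcongr
      _ ≤ b * ((m + 1) * psi (q + 1) m) := by nlinarith
      _ ≤ _ := by rw [h3]; nlinarith

theorem abs_nlap_add_le (h : Critical d L η c₁ CD q b D z f g e) (m : ℕ) :
    |nlap D (g m) - (if m = 1 then -1 else 0)| ≤ 2 * b * psi q m := by
  have := h.bd_gamma m m le_rfl
  rw [map_add, PowerSeries.coeff_mk, PowerSeries.coeff_X] at this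
  convert this using 2
  split_ifs <;> ring

theorem abs_e_le (h : Critical d L η c₁ CD q b D z f g e) {k : Momentum d} (hk : k ∈ cube d)
    (m : ℕ) : |e m k| ≤ b * psi (q + 1) m := by
  have hb := h.b_nonneg
  have hp := psi_nonneg (q + 1) m
  rcases Nat.lt_trichotomy m 1 with h1 | h1 | h1
  · have : m = 0 := by omega
    subst this
    rw [(h.model.renewal k hk).e_zero, abs_zero]; positivity
  · subst h1
    rw [h.model.e_one k hk, abs_zero]; positivity
  · exact (h.bounds m (by omega)).e_le k hk m h1 le_rfl

theorem summable_mul_g (h : Critical d L η c₁ CD q b D z f g e) :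
    Summable fun m : ℕ => (m : ℝ) * g m 0 :=
  (summable_near_unit h.one_lt h.abs_mul_g_sub_le).1

theorem summable_nlap (h : Critical d L η c₁ CD q b D z f g e) :
    Summable fun m : ℕ => nlap D (g m) :=
  (summable_near_unit h.one_lt h.abs_nlap_add_le).1

theorem summable_e (h : Critical d L η c₁ CD q b D z f g e) : Summable fun m : ℕ => e m 0 :=
  summable_of_le_psi (by linarith [h.one_lt]) (h.abs_e_le zero_mem_cube)

theorem abs_meanStep_sub_one_le (h : Critical d L η c₁ CD q b D z f g e) :
    |meanStep g - 1| ≤ 2 * b * psiSum q :=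
  (summable_near_unit h.one_lt h.abs_mul_g_sub_le).2

theorem half_le_meanStep (h : Critical d L η c₁ CD q b D z f g e) : 1 / 2 ≤ meanStep g := by
  have := (abs_le.1 h.abs_meanStep_sub_one_le).1
  linarith [h.small_sum]

/-- Summability follows from that of m g_m. The sum is 1 because the defects 1 - Σ_{m ≤ j} g_m are
O(psi q j). -/
theorem hasSum_g (h : Critical d L η c₁ CD q b D z f g e) : HasSum (fun m => g m 0) 1 := by
  have h1 : Summable fun m => g m 0 := by
    refine ((summable_nat_add_iff 1).1 ?_)
    refine Summable.of_norm_bounded ((summable_nat_add_iff 1).2 h.summable_mul_g.norm) fun m => ?_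
    rw [norm_mul]
    refine le_mul_of_one_le_left (norm_nonneg _) ?_
    rw [Real.norm_eq_abs, Nat.abs_cast]
    exact_mod_cast Nat.succ_le_succ (Nat.zero_le m)
  have h2 : Tendsto (fun j => 1 - ∑ m ∈ Finset.range (j + 1), g m 0) atTop (𝓝 0) := by
    have h3 : Tendsto (fun j => 2 * b * psi q j) atTop (𝓝 0) := by
      have := (tendsto_psi (show 0 < q by linarith [h.one_lt])).const_mul (2 * b)
      rwa [mul_zero] at this
    refine squeeze_zero_norm' ?_ h3
    filter_upwards [eventually_ge_atTop 1] with j hj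
    exact (h.nearCritical j).tail j hj le_rfl
  have h4 : Tendsto (fun j => ∑ m ∈ Finset.range (j + 1), g m 0) atTop (𝓝 1) := by
    have := h2.const_sub 1
    simpa using this
  have h5 := (tendsto_add_atTop_iff_nat 1).2 h1.hasSum.tendsto_sum_nat
  rw [← tendsto_nhds_unique h5 h4]
  exact h1.hasSum

theorem diffusion_mul (h : Critical d L η c₁ CD q b D z f g e) :
    ∑' m, nlap D (g m) = -(diffusion D g * meanStep g) := by
  have := h.half_le_meanStep
  rw [diffusion, div_mul_cancel₀ _ (by linarith), neg_neg]

theorem abs_diffusion_sub_one_le (h : Critical d L η c₁ CD q b D z f g e) :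
    |diffusion D g - 1| ≤ 8 * b * psiSum q := by
  have hT := h.half_le_meanStep
  have h1 := h.abs_meanStep_sub_one_le
  have h2 := (summable_near_unit h.one_lt h.abs_nlap_add_le).2
  have hT0 : 0 < meanStep g := by linarith
  -- Both -Σγ and Σ m g_m are within 2b psiSum q of 1, and the denominator is at least 1/2.
  have e1 : diffusion D g - 1 =
      -((∑' m, nlap D (g m) - -1) + (meanStep g - 1)) / meanStep g := by
    rw [diffusion]; field_simp; ring
  rw [e1, abs_div, abs_neg, abs_of_pos hT0, div_le_iff₀ hT0]
  have h3 := abs_add_le (∑' m, nlap D (g m) - -1) (meanStep g - 1)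
  have h4 : 0 ≤ 8 * b * psiSum q := by
    have := h.b_nonneg
    have := psiSum_nonneg q
    positivity
  nlinarith

theorem half_le_diffusion (h : Critical d L η c₁ CD q b D z f g e) : 1 / 2 ≤ diffusion D g := by
  have := (abs_le.1 h.abs_diffusion_sub_one_le).1
  linarith [h.small_sum]

theorem diffusion_le_two (h : Critical d L η c₁ CD q b D z f g e) : diffusion D g ≤ 2 := by
  have := (abs_le.1 h.abs_diffusion_sub_one_le).2
  linarith [h.small_sum]

theorem amplitude_mul (h : Critical d L η c₁ CD q b D z f g e) :
    amplitude g e * meanStep g = 1 + ∑' m, e m 0 := by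
  have := h.half_le_meanStep
  rw [amplitude, div_mul_cancel₀ _ (by linarith)]

theorem amplitude_spec (h : Critical d L η c₁ CD q b D z f g e) :
    |amplitude g e - 1| ≤ 8 * b * psiSum q ∧
      (∀ n, |f n 0 - amplitude g e| ≤ 8 * b * (q - 1)⁻¹ * psi (q - 1) n) ∧
      amplitude g e = evalOne (renewalSeries (fun m => g m 0) fun m => e m 0) ∧
      AbsSummable (renewalSeries (fun m => g m 0) fun m => e m 0) := by
  obtain ⟨A, h1, h2, h3, h4, h5⟩ := renewal_asymptotics h.one_lt h.nearCritical
    (by linarith [h.b_nonneg]) (by linarith [h.small_conv]) (h.model.renewal 0 zero_mem_cube)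
    h.summable_mul_g
  have hA : amplitude g e = A := by
    have := h.half_le_meanStep
    rw [amplitude, div_eq_iff (by linarith), ← h2, meanStep]
  rw [hA]
  refine ⟨h1.trans (le_of_eq (by ring)), fun n => (h3 n).trans (le_of_eq (by ring)), h4, h5⟩

theorem half_le_amplitude (h : Critical d L η c₁ CD q b D z f g e) : 1 / 2 ≤ amplitude g e := by
  have := (abs_le.1 h.amplitude_spec.1).1
  linarith [h.small_sum]

theorem half_le_f_zero (h : Critical d L η c₁ CD q b D z f g e) (n : ℕ) : 1 / 2 ≤ f n 0 := by
  have := (abs_le.1 ((h.nearCritical n).abs_sub_one_le h.one_lt (by linarith [h.b_nonneg])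
    (by linarith [h.small_conv]) (h.model.renewal 0 zero_mem_cube) le_rfl)).1
  linarith [h.small_sum]

/-- The constant in the asymptotics of the second moment. -/
def lapC (q δ : ℝ) : ℝ := 2 * momentC q * (psiSum q + (q - 1)⁻¹ * (2 * psiSum (q - δ)))

theorem lapC_nonneg {q δ : ℝ} (hq : 1 < q) : 0 ≤ lapC q δ := by
  have h1 : 0 ≤ momentC q := by
    have := one_le_convC hq
    rw [momentC]; positivity
  have := psiSum_nonneg q
  have := psiSum_nonneg (q - δ)
  have : 0 ≤ (q - 1)⁻¹ := inv_nonneg.2 (by linarith)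
  rw [lapC]; positivity

theorem abs_nlap_f_le (h : Critical d L η c₁ CD q b D z f g e) {δ : ℝ} (hδ0 : 0 ≤ δ) (hδ1 : δ ≤ 1)
    (hqδ : 1 < q - δ) {n : ℕ} (hn : 1 ≤ n) :
    |nlap D (f n) + n * (amplitude g e * diffusion D g)| ≤ lapC q δ * b * (n : ℝ) ^ (1 - δ) := by
  obtain ⟨-, -, hA, hU⟩ := h.amplitude_spec
  have hq := h.one_lt
  obtain ⟨V, hV, hl⟩ := (h.model.momentSeq h.dim_pos).asymptotics hδ1 hqδ
    (h.model.renewal 0 zero_mem_cube) h.nearCritical h.one_lt (by linarith [h.b_nonneg])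
    (by linarith [h.small_conv]) h.summable_mul_g h.bd_gamma h.bd_eps hA hU
  have hT := h.half_le_meanStep
  -- From V T = A Σγ and Σγ = -vT.
  have hV' : V = -(amplitude g e * diffusion D g) := by
    have h1 : V * meanStep g = -(amplitude g e * diffusion D g) * meanStep g := by
      rw [meanStep, hV, h.diffusion_mul, meanStep]; ring
    exact mul_right_cancel₀ (by linarith) h1
  have h1 := hl n
  rw [hV'] at h1
  have e1 : nlap D (f n) + n * (amplitude g e * diffusion D g) =
      nlap D (f n) - n * -(amplitude g e * diffusion D g) := by ring
  rw [e1]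
  refine h1.trans ?_
  have hn' : (1 : ℝ) ≤ n := by exact_mod_cast hn
  have h2 : (1 : ℝ) ≤ (n : ℝ) ^ (1 - δ) := Real.one_le_rpow hn' (by linarith)
  have h3 : ((n : ℝ) + 1) ^ (1 - δ) ≤ 2 * (n : ℝ) ^ (1 - δ) := by
    calc ((n : ℝ) + 1) ^ (1 - δ) ≤ (2 * (n : ℝ)) ^ (1 - δ) :=
          Real.rpow_le_rpow (by positivity) (by linarith) (by linarith)
      _ = 2 ^ (1 - δ) * (n : ℝ) ^ (1 - δ) := Real.mul_rpow (by norm_num) (by positivity)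
      _ ≤ 2 * (n : ℝ) ^ (1 - δ) := by
          gcongr
          calc (2 : ℝ) ^ (1 - δ) ≤ 2 ^ (1 : ℝ) :=
                Real.rpow_le_rpow_of_exponent_le (by norm_num) (by linarith)
            _ = 2 := Real.rpow_one 2
  have hS := psiSum_nonneg q
  have hS' := psiSum_nonneg (q - δ)
  have hq' : 0 ≤ (q - 1)⁻¹ := inv_nonneg.2 (by linarith)
  have hm : 0 ≤ momentC q * (2 * b) := by
    have := one_le_convC hq
    have := h.b_nonneg
    rw [momentC]; positivity
  calc _ ≤ momentC q * (2 * b) * (psiSum q * (n : ℝ) ^ (1 - δ) +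
        (q - 1)⁻¹ * (2 * (n : ℝ) ^ (1 - δ) * psiSum (q - δ))) := by
        gcongr
        exact le_mul_of_one_le_right hS h2
    _ = _ := by rw [lapC]; ring

/-- The constant in the diffusive behaviour. -/
def diffusiveC (q δ : ℝ) : ℝ := 4 * lapC q δ + 16 * (q - 1)⁻¹

theorem diffusive (h : Critical d L η c₁ CD q b D z f g e) {δ : ℝ} (hδ0 : 0 ≤ δ) (hδ1 : δ ≤ 1)
    (hqδ : 1 < q - δ) {n : ℕ} (hn : 1 ≤ n) :
    |-(lap0 (f n)) / f n 0 - diffusion D g * sigmaSq D * n| ≤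
      diffusion D g * sigmaSq D * n * (diffusiveC q δ * b * (n : ℝ) ^ (-δ)) := by
  have hq := h.one_lt
  have hσ := h.walk.sigmaSq_pos h.dim_pos h.c₁_pos
  have hf := h.half_le_f_zero n
  have hf0 : 0 < f n 0 := by linarith
  have hv := h.half_le_diffusion
  have hb := h.b_nonneg
  have hn' : (1 : ℝ) ≤ n := by exact_mod_cast hn
  have hq' : 0 ≤ (q - 1)⁻¹ := inv_nonneg.2 (by linarith)
  set v := diffusion D g with hvdef
  set A := amplitude g e with hAdef
  set X : ℝ := (n : ℝ) ^ (-δ) with hX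
  have hX0 : 0 ≤ X := by rw [hX]; positivity
  have hlap : lap0 (f n) = sigmaSq D * nlap D (f n) := by rw [nlap]; field_simp
  have h1 := h.abs_nlap_f_le hδ0 hδ1 hqδ hn
  have h1' : (n : ℝ) ^ (1 - δ) = n * X := by
    rw [sub_eq_add_neg, Real.rpow_add (by linarith), Real.rpow_one]
  rw [← hvdef, ← hAdef, h1'] at h1
  have h2 : |f n 0 - A| ≤ 8 * b * (q - 1)⁻¹ * X := by
    refine (h.amplitude_spec.2.1 n).trans ?_
    have : psi (q - 1) n ≤ X := (psi_anti_exp (by linarith) n).trans (psi_le_rpow δ hδ0 hn)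
    gcongr
  -- The deviation splits into the error of the Laplacian about -nAv and the error of f_n(0) about
  -- A.
  have e1 : -(lap0 (f n)) / f n 0 - v * sigmaSq D * n =
      sigmaSq D * (-(nlap D (f n) + n * (A * v)) - n * v * (f n 0 - A)) / f n 0 := by
    rw [hlap]; field_simp; ring
  have h3 : |-(nlap D (f n) + n * (A * v)) - n * v * (f n 0 - A)| ≤
      lapC q δ * b * (n * X) + n * v * (8 * b * (q - 1)⁻¹ * X) := by
    refine (abs_sub _ _).trans ?_
    rw [abs_neg, abs_mul, abs_of_nonneg (show 0 ≤ (n : ℝ) * v by positivity)]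
    gcongr
  rw [e1, abs_div, abs_mul, abs_of_pos hσ, abs_of_pos hf0, div_le_iff₀ hf0]
  have hl0 : 0 ≤ lapC q δ := lapC_nonneg hq
  have h4 : lapC q δ * b * (n * X) ≤ 2 * v * (lapC q δ * b * (n * X)) := by
    have : 0 ≤ lapC q δ * b * (n * X) := by positivity
    nlinarith
  have h5 : 0 ≤ v * sigmaSq D * n * (diffusiveC q δ * b * X) := by
    rw [diffusiveC]; positivity
  calc _ ≤ sigmaSq D * (lapC q δ * b * (n * X) + n * v * (8 * b * (q - 1)⁻¹ * X)) := by gcongr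
    _ ≤ sigmaSq D * (2 * v * (lapC q δ * b * (n * X)) + n * v * (8 * b * (q - 1)⁻¹ * X)) := by
        gcongr
    _ = v * sigmaSq D * n * (diffusiveC q δ * b * X) * (1 / 2) := by rw [diffusiveC]; ring
    _ ≤ _ := by gcongr

end Critical

end
end LaceExpansion
end

noncomputable section
namespace LaceExpansion

/-! ### Gaussian asymptotics at the critical point -/

section
variable {d : ℕ} {L η c₁ CD q b z : ℝ} {D : (Fin d → ℤ) → ℝ} {f g e : ℕ → Momentum d → ℝ}

theorem norm_sq_le_of_mem_cube {k : Momentum d} (hk : k ∈ cube d) : ‖k‖ ^ 2 ≤ d * Real.pi ^ 2 := by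
  rw [EuclideanSpace.norm_sq_eq]
  calc _ ≤ ∑ _i : Fin d, Real.pi ^ 2 := Finset.sum_le_sum fun i _ => by
        rw [Real.norm_eq_abs]
        exact pow_le_pow_left₀ (abs_nonneg _) (hk i) 2
    _ = _ := by simp

theorem Walk.exists_quadratic_lower (w : Walk d L η c₁ CD D) (hη : 0 < η) (hc₁ : 0 < c₁)
    (hd : 0 < d) : ∃ c > 0, ∀ k ∈ cube d, c * ‖k‖ ^ 2 ≤ a D k := by
  have hL := w.one_le
  have hd' : (0 : ℝ) < d := by exact_mod_cast hd
  have hπ := Real.pi_pos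
  refine ⟨min (c₁ * L ^ 2) (η / (d * Real.pi ^ 2)), by positivity, fun k hk => ?_⟩
  rcases le_total (supNorm k) L⁻¹ with h | h
  · exact (mul_le_mul_of_nonneg_right (min_le_left _ _) (by positivity)).trans (w.low k h)
  · refine le_trans ?_ (w.high k hk h).le
    calc _ ≤ η / (d * Real.pi ^ 2) * (d * Real.pi ^ 2) :=
          mul_le_mul (min_le_right _ _) (norm_sq_le_of_mem_cube hk) (by positivity) (by positivity)
      _ = η := by field_simp

theorem le_two_rpow_mul_psi_one {r R : ℝ} (h : r ≤ R) : 1 ≤ (2 : ℝ) ^ R * psi r 1 := by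
  have h1 : psi r 1 = (2 : ℝ) ^ (-r) := by rw [psi]; norm_num
  rw [h1, ← Real.rpow_add (by norm_num)]
  exact Real.one_le_rpow (by norm_num) (by linarith)

namespace Critical

/-- The uniform constant for the kernels `g_m(k)`. -/
def kernelC (q b : ℝ) : ℝ := 2 * 2 ^ (q + 1) + 2 * b

theorem two_mul_le_kernelC (q b : ℝ) : 2 * b ≤ kernelC q b := by
  have : (0 : ℝ) < 2 ^ (q + 1) := by positivity
  rw [kernelC]; linarith

/-- The coefficient at m = 1 is of order one rather than of order b; the first summand of `kernelC`
exists to cover it. -/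
theorem kernelC_one (h : Critical d L η c₁ CD q b D z f g e) {x r : ℝ} (hx : x ≤ 2)
    (hr : r ≤ q + 1) : x ≤ kernelC q b * psi r 1 := by
  have h1 := le_two_rpow_mul_psi_one hr
  have h2 := mul_nonneg h.b_nonneg (psi_nonneg r 1)
  rw [kernelC]
  nlinarith

theorem abs_z_le (h : Critical d L η c₁ CD q b D z f g e) : |z| ≤ 2 := by
  have h1 := h.abs_z_sub_one_le
  have h2 := psi_le_one (show 0 ≤ q by linarith [h.one_lt]) 1
  have h3 := one_le_psiSum h.one_lt
  have hb := h.b_nonneg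
  have h5 : 2 * b ≤ 1 := by nlinarith [h.small_sum]
  have h6 : |1 - z| ≤ 1 := h1.trans (by nlinarith)
  have := abs_le.1 h6
  rw [abs_le]
  constructor <;> linarith

theorem abs_g_le (h : Critical d L η c₁ CD q b D z f g e) {k : Momentum d} (hk : k ∈ cube d)
    (m : ℕ) : |g m k| ≤ kernelC q b * psi (q + 1) m := by
  have hb := h.b_nonneg
  have hp := psi_nonneg (q + 1) m
  have hB := two_mul_le_kernelC q b
  rcases Nat.lt_trichotomy m 1 with h1 | h1 | h1
  · have : m = 0 := by omega
    subst this
    rw [h.model.g_zero hk, abs_zero]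
    exact mul_nonneg (by linarith) hp
  · subst h1
    refine h.kernelC_one ?_ le_rfl
    rw [h.model.g_one k hk, abs_mul]
    have := abs_Dhat_le_one h.walk.nonneg h.walk.normalised k
    have := h.abs_z_le
    nlinarith [abs_nonneg z, abs_nonneg (Dhat D k)]
  · refine ((h.bounds m (by omega)).g_le k hk m h1 le_rfl).trans ?_
    exact mul_le_mul_of_nonneg_right (by linarith) hp

theorem limitData (h : Critical d L η c₁ CD q b D z f g e) :
    LimitData q (kernelC q b) (fun m => g m 0) (fun m => e m 0) (fun m => nlap D (g m))
      (meanStep g) (amplitude g e) (diffusion D g) where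
  e_zero := (h.model.renewal 0 zero_mem_cube).e_zero
  g_le := h.abs_g_le zero_mem_cube
  e_le m := (h.abs_e_le zero_mem_cube m).trans (mul_le_mul_of_nonneg_right
    (by linarith [two_mul_le_kernelC q b, h.b_nonneg]) (psi_nonneg _ _))
  γ_le m := by
    rcases eq_or_ne m 1 with rfl | hm
    · refine h.kernelC_one ?_ (by linarith)
      rw [h.model.nlap_g_one h.walk h.dim_pos h.c₁_pos, abs_neg]
      exact h.abs_z_le
    · have := h.abs_nlap_add_le m
      rw [if_neg hm, sub_zero] at this
      exact this.trans (mul_le_mul_of_nonneg_right (two_mul_le_kernelC q b) (psi_nonneg _ _))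
  sum_g := h.hasSum_g
  T_eq := rfl
  A_eq := h.amplitude_mul
  v_eq := h.diffusion_mul

theorem localData (h : Critical d L η c₁ CD q b D z f g e) {δ' : ℝ}
    {k : Momentum d} (hk : k ∈ cube d)
    (ht : ∀ m ≥ 2, |g m k - g m 0 - a D k * nlap D (g m)| ≤
      b * a D k ^ (1 + δ') * psi (q - δ') m) :
    LocalData q δ' (kernelC q b) b (a D k) (fun m => g m 0) (fun m => e m 0)
      (fun m => nlap D (g m)) (fun n => f n k) (fun m => g m k) (fun m => e m k) where
  renewal := h.model.renewal k hk
  g_le := h.abs_g_le hk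
  g_small m hm := (h.bounds m (by omega)).g_le k hk m hm le_rfl
  e_small := h.abs_e_le hk
  g_sub m := by
    have hb := h.b_nonneg
    have ha := h.walk.a_nonneg k
    have hp := psi_nonneg q m
    have hB := two_mul_le_kernelC q b
    have hB0 : 0 ≤ kernelC q b := by linarith
    rcases Nat.lt_trichotomy m 1 with h1 | h1 | h1
    · have : m = 0 := by omega
      subst this
      rw [h.model.g_zero hk, h.model.g_zero zero_mem_cube, sub_zero, abs_zero]; positivity
    · subst h1
      have e1 : g 1 k - g 1 0 = -(z * a D k) := by
        rw [h.model.g_one k hk, h.model.g_one 0 zero_mem_cube, Dhat_zero h.walk.normalised, a]; ring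
      rw [e1, abs_neg, abs_mul, abs_of_nonneg ha]
      have := mul_le_mul_of_nonneg_right (h.kernelC_one h.abs_z_le (show q ≤ q + 1 by linarith)) ha
      linarith
    · refine ((h.bounds m (by omega)).g_sub k hk m h1 le_rfl).trans ?_
      gcongr
      linarith
  e_sub m := by
    have hb := h.b_nonneg
    have ha := h.walk.a_nonneg k
    have hp := psi_nonneg q m
    have hB := two_mul_le_kernelC q b
    have hB0 : 0 ≤ kernelC q b := by linarith
    rcases Nat.lt_trichotomy m 1 with h1 | h1 | h1
    · have : m = 0 := by omega
      subst this
      rw [(h.model.renewal k hk).e_zero, (h.model.renewal 0 zero_mem_cube).e_zero, sub_zero,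
        abs_zero]
      positivity
    · subst h1
      rw [h.model.e_one k hk, h.model.e_one 0 zero_mem_cube, sub_zero, abs_zero]; positivity
    · refine ((h.bounds m (by omega)).e_sub k hk m h1 le_rfl).trans ?_
      gcongr
      linarith
  g_taylor m := by
    have hb := h.b_nonneg
    have ha := h.walk.a_nonneg k
    have hp := psi_nonneg (q - δ') m
    have hB := two_mul_le_kernelC q b
    have hB0 : 0 ≤ kernelC q b := by linarith
    have ha' : 0 ≤ a D k ^ (1 + δ') := by positivity
    rcases Nat.lt_trichotomy m 1 with h1 | h1 | h1
    · have : m = 0 := by omega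
      subst this
      rw [h.model.g_zero hk, h.model.g_zero zero_mem_cube, (h.model.momentSeq h.dim_pos).γ_zero,
        mul_zero, sub_zero, sub_zero, abs_zero]
      positivity
    · subst h1
      -- g_1 = zD̂ is exactly affine in a, so it has no Taylor remainder.
      have e1 : g 1 k - g 1 0 - a D k * nlap D (g 1) = 0 := by
        rw [h.model.g_one k hk, h.model.g_one 0 zero_mem_cube, Dhat_zero h.walk.normalised,
          h.model.nlap_g_one h.walk h.dim_pos h.c₁_pos, a]
        ring
      rw [e1, abs_zero]; positivity
    · refine (ht m h1).trans ?_
      gcongr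
      linarith

/-- A crude bound by iterating the recursion, needed only for the finitely many n below the
threshold of the local asymptotics. -/
theorem exists_bound (h : Critical d L η c₁ CD q b D z f g e) (n : ℕ) :
    ∃ M, 0 ≤ M ∧ ∀ m ≤ n, ∀ k ∈ cube d, |f m k| ≤ M := by
  have hB0 : 0 ≤ kernelC q b := by linarith [two_mul_le_kernelC q b, h.b_nonneg]
  have hq := h.one_lt
  induction n with
  | zero =>
    refine ⟨1, one_pos.le, fun m hm k hk => ?_⟩
    rw [Nat.le_zero.1 hm, (h.model.renewal k hk).f_zero, abs_one]
  | succ n ih =>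
    obtain ⟨M, hM, hfM⟩ := ih
    refine ⟨M + ((n + 1) * (kernelC q b * M) + b), by
      have := h.b_nonneg
      positivity, fun m hm k hk => ?_⟩
    have hb := h.b_nonneg
    rcases Nat.le_succ_iff.1 hm with h1 | h1
    · refine (hfM m h1 k hk).trans ?_
      have : 0 ≤ (n + 1) * (kernelC q b * M) + b := by positivity
      linarith
    · have h2 := (h.model.renewal k hk).step n
      rw [h1, h2]
      have h3 : |∑ m ∈ Finset.Icc 1 (n + 1), g m k * f (n + 1 - m) k| ≤
          (n + 1) * (kernelC q b * M) := by
        calc _ ≤ ∑ m ∈ Finset.Icc 1 (n + 1), |g m k * f (n + 1 - m) k| :=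
              Finset.abs_sum_le_sum_abs _ _
          _ ≤ ∑ _m ∈ Finset.Icc 1 (n + 1), kernelC q b * M := Finset.sum_le_sum fun m hm => by
              rw [Finset.mem_Icc] at hm
              rw [abs_mul]
              refine mul_le_mul ((h.abs_g_le hk m).trans ?_) (hfM _ (by omega) k hk)
                (abs_nonneg _) hB0
              exact mul_le_of_le_one_right hB0 (psi_le_one (by linarith) m)
          _ = _ := by simp
      have h4 : |e (n + 1) k| ≤ b := (h.abs_e_le hk _).trans
        (mul_le_of_le_one_right hb (psi_le_one (by linarith) _))
      refine (abs_add_le _ _).trans ?_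
      linarith

end Critical

/-- Comparison of two exponentials with nearby exponents. -/
theorem abs_exp_compare {F A C x y E X Y P Q : ℝ} (hA : 1 / 2 ≤ A) (hC : 0 ≤ C)
    (hX : 0 ≤ X) (hY : 0 ≤ Y) (hQ : 0 ≤ Q) (hP : 0 ≤ P)
    (hF : |F - A * Real.exp (-x)| ≤ C * Real.exp (-x) * (Q * X + Y)) (hxy : |x - y| ≤ P * X)
    (hE : |x - y| ≤ E) :
    |F - A * Real.exp (-y)| ≤ A * Real.exp (-y) *
      (2 * (C * Real.exp E * (Q + 1) + A * P * Real.exp E) * (X + Y)) := by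
  have hy := Real.exp_pos (-y)
  have hEp := Real.exp_pos E
  have h1 : Real.exp (-x) ≤ Real.exp (-y) * Real.exp E := by
    rw [← Real.exp_add]
    exact Real.exp_le_exp.2 (by linarith [(abs_le.1 hE).1])
  have h2 : |Real.exp (-x) - Real.exp (-y)| ≤ Real.exp (-y) * (P * X * Real.exp E) := by
    have e1 : Real.exp (-x) - Real.exp (-y) = Real.exp (-y) * (Real.exp (y - x) - 1) := by
      rw [mul_sub, ← Real.exp_add, mul_one]; congr 2; ring
    rw [e1, abs_mul, abs_of_pos hy]
    refine mul_le_mul_of_nonneg_left ((abs_exp_sub_one_le _).trans ?_) hy.le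
    rw [abs_sub_comm] at hxy hE
    exact mul_le_mul hxy (Real.exp_le_exp.2 hE) (Real.exp_pos _).le (by positivity)
  have h3 : |F - A * Real.exp (-y)| ≤ C * Real.exp (-x) * (Q * X + Y) +
      A * |Real.exp (-x) - Real.exp (-y)| := by
    have e2 : F - A * Real.exp (-y) = (F - A * Real.exp (-x)) +
        A * (Real.exp (-x) - Real.exp (-y)) := by ring
    rw [e2]
    refine (abs_add_le _ _).trans ?_
    rw [abs_mul A, abs_of_nonneg (show 0 ≤ A by linarith)]
    linarith
  have hA0 : 0 ≤ A := by linarith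
  refine h3.trans ?_
  have h4 : Q * X + Y ≤ (Q + 1) * (X + Y) := by nlinarith [mul_nonneg hQ hY]
  calc _ ≤ C * (Real.exp (-y) * Real.exp E) * ((Q + 1) * (X + Y)) +
        A * (Real.exp (-y) * (P * (X + Y) * Real.exp E)) := by
        gcongr
        refine h2.trans ?_
        gcongr
        linarith
    _ = 1 * Real.exp (-y) * ((C * Real.exp E * (Q + 1) + A * P * Real.exp E) * (X + Y)) := by ring
    _ ≤ (2 * A) * Real.exp (-y) *
        ((C * Real.exp E * (Q + 1) + A * P * Real.exp E) * (X + Y)) := by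
        gcongr
        linarith
    _ = _ := by ring

/-- The exponent `n v a(p)` compared with the Gaussian exponent. -/
theorem Walk.exists_exponent_bound (w : Walk d L η c₁ CD D) (hη : 0 < η) (hc₁ : 0 < c₁)
    (hd : 0 < d) {δ s v θ : ℝ} (hδ : 0 < δ) (hδs : δ < s) (hs1 : s ≤ 1) (hv : 0 < v) (hθ : 0 ≤ θ)
    (hm : Summable fun x => latticeNorm x ^ (2 + 2 * s) * D x) :
    ∃ P Q E : ℝ, 0 ≤ P ∧ 0 ≤ Q ∧ ∀ n : ℕ, 1 ≤ n → ∀ p ∈ cube d,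
      a D p ≤ θ * ((n : ℝ)⁻¹ * Real.log n) →
      n * a D p ≤ Q * (v * sigmaSq D * n * ‖p‖ ^ 2) ∧
      |v * a D p * n - v * sigmaSq D * n * ‖p‖ ^ 2 / (2 * d)| ≤
        P * (v * sigmaSq D * n * ‖p‖ ^ 2 * psi δ n) ∧
      |v * a D p * n - v * sigmaSq D * n * ‖p‖ ^ 2 / (2 * d)| ≤ E := by
  obtain ⟨c, hc, hlow⟩ := w.exists_quadratic_lower hη hc₁ hd
  have hs0 : 0 < s := hδ.trans hδs
  have hd' : (0 : ℝ) < d := by exact_mod_cast hd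
  have hσ := w.sigmaSq_pos hd hc₁
  set σ := sigmaSq D with hσdef
  set H := ∑' x, latticeNorm x ^ (2 + 2 * s) * D x with hH
  have hH0 : 0 ≤ H := tsum_nonneg fun x =>
    mul_nonneg (Real.rpow_nonneg (Real.sqrt_nonneg _) _) (w.nonneg x)
  have hmom := abs_a_sub_sigmaSq_le hs0 hs1 hd w.nonneg w.normalised hm w.diff w.symm
  rw [← hσdef, ← hH] at hmom
  set R : ℝ := d * Real.pi ^ 2 with hR
  have hR0 : 0 ≤ R := by positivity
  -- In the window |p|² is O(log n / n), so its power s is O(n^{-δ}) because δ < s.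
  set P₁ : ℝ := (θ / c) ^ s * (2 * (1 - δ / s)⁻¹) ^ s with hP₁
  have hδs' : 0 < 1 - δ / s := sub_pos.2 ((div_lt_one hs0).2 hδs)
  have hP₁0 : 0 ≤ P₁ := by positivity
  set P := H * P₁ / σ with hP
  have hP0 : 0 ≤ P := by positivity
  refine ⟨P, (σ / (2 * d) + H * R ^ s) / (v * σ), P * (v * σ * (θ / c) * δ⁻¹), hP0,
    by positivity, ?_⟩
  intro n hn p hp hap
  have hn' : (1 : ℝ) ≤ n := by exact_mod_cast hn
  have hlog : 0 ≤ Real.log n := Real.log_nonneg hn'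
  set y := ‖p‖ ^ 2 with hy
  have hy0 : 0 ≤ y := by positivity
  have hsplit : ‖p‖ ^ (2 + 2 * s) = y * y ^ s := by
    rw [Real.rpow_add_of_nonneg (norm_nonneg p) (by norm_num) (by positivity),
      Real.rpow_mul (norm_nonneg p), Real.rpow_two]
  have hap' : |a D p - σ * y / (2 * d)| ≤ H * (y * y ^ s) := by
    rw [← hsplit]; exact hmom p
  have hyR : y ≤ R := norm_sq_le_of_mem_cube hp
  have hyc : y ≤ θ / c * ((n : ℝ)⁻¹ * Real.log n) := by
    have := (hlow p hp).trans hap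
    rw [div_mul_eq_mul_div, le_div_iff₀ hc]
    linarith
  have hys : y ^ s ≤ P₁ * psi δ n := by
    calc y ^ s ≤ (θ / c * ((n : ℝ)⁻¹ * Real.log n)) ^ s := Real.rpow_le_rpow hy0 hyc hs0.le
      _ = (θ / c) ^ s * ((n : ℝ)⁻¹ * Real.log n) ^ s :=
          Real.mul_rpow (by positivity) (by positivity)
      _ ≤ (θ / c) ^ s * ((2 * (1 - δ / s)⁻¹) ^ s * psi δ n) := by
          have := inv_log_rpow_le hδ hδs hn
          gcongr
      _ = _ := by rw [hP₁]; ring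
  have hψ := psi_nonneg δ n
  have hdiff : |v * a D p * n - v * σ * n * y / (2 * d)| ≤ P * (v * σ * n * y * psi δ n) := by
    have e1 : v * a D p * n - v * σ * n * y / (2 * d) = v * n * (a D p - σ * y / (2 * d)) := by
      ring
    rw [e1, abs_mul, abs_of_nonneg (by positivity)]
    calc _ ≤ v * n * (H * (y * (P₁ * psi δ n))) := by
          gcongr
          exact hap'.trans (by gcongr)
      _ = _ := by rw [hP]; field_simp
  refine ⟨?_, hdiff, hdiff.trans ?_⟩
  · have h1 : a D p ≤ (σ / (2 * d) + H * R ^ s) * y := by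
      have h2 := (abs_le.1 hap').2
      have h3 : y ^ s ≤ R ^ s := Real.rpow_le_rpow hy0 hyR hs0.le
      have h4 : H * (y * y ^ s) ≤ H * (y * R ^ s) := by gcongr
      calc a D p ≤ σ * y / (2 * d) + H * (y * R ^ s) := by linarith
        _ = _ := by ring
    calc n * a D p ≤ n * ((σ / (2 * d) + H * R ^ s) * y) := by gcongr
      _ = _ := by field_simp
  · refine mul_le_mul_of_nonneg_left ?_ hP0
    have h5 := log_mul_psi_le hδ n
    rw [sub_zero] at h5
    have h6 : psi 0 n = 1 := by simp [psi]
    rw [h6, mul_one] at h5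
    calc v * σ * n * y * psi δ n ≤ v * σ * n * (θ / c * ((n : ℝ)⁻¹ * Real.log n)) * psi δ n := by
          gcongr
      _ = v * σ * (θ / c) * (Real.log n * psi δ n) := by field_simp
      _ ≤ _ := by gcongr

/-- For n ≥ n₀ the local asymptotics apply with a = a(p), and `abs_exp_compare` changes e^{-v a(p)
n} into the Gaussian. For smaller n the bound is trivial with a constant depending on n₀, hence on
L, which the theorem permits. -/
theorem Critical.gaussian (h : Critical d L η c₁ CD q b D z f g e) (hη : 0 < η)
    {δ δ' κ s : ℝ} (hδ : 0 < δ) (hδδ' : δ < δ') (hδ'1 : δ' ≤ 1) (hκ : 0 < κ) (hκ1 : κ ≤ 1)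
    (hqκ : 1 < q - κ - δ') (hs1 : 2 * convC q * (60 * b) ≤ 1)
    (hs2 : 2 * convC (q - κ) * (60 * b) ≤ 1) (hδs : δ < s) (hs : s ≤ 1)
    (hm : Summable fun x => latticeNorm x ^ (2 + 2 * s) * D x)
    (ht : ∀ k ∈ cube d, ∀ m ≥ 2, |g m k - g m 0 - a D k * nlap D (g m)| ≤
      b * a D k ^ (1 + δ') * psi (q - δ') m) :
    ∃ C : ℝ, ∀ n : ℕ, 1 ≤ n → ∀ k p : Momentum d,
      p = (Real.sqrt (diffusion D g * sigmaSq D * n))⁻¹ • k → p ∈ cube d →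
      a D p ≤ κ / 5 * (n : ℝ)⁻¹ * Real.log n →
      |f n p - amplitude g e * Real.exp (-‖k‖ ^ 2 / (2 * d))| ≤
        amplitude g e * Real.exp (-‖k‖ ^ 2 / (2 * d)) *
          (C * ‖k‖ ^ 2 * (n : ℝ) ^ (-δ) + C * (n : ℝ) ^ (-(q - 1))) := by
  have hb := h.b_nonneg
  have hq := h.one_lt
  have hv := h.half_le_diffusion
  have hA := h.half_le_amplitude
  have hσ := h.walk.sigmaSq_pos h.dim_pos h.c₁_pos
  have hd' : (0 : ℝ) < d := by exact_mod_cast h.dim_pos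
  obtain ⟨C, hC, n₀, hmain⟩ := local_asymptotics hδ hδδ' hδ'1 hκ hκ1 hqκ hb
    (by linarith [Critical.two_mul_le_kernelC q b]) hs1 hs2 (by linarith [h.half_le_meanStep]) (by linarith)
    h.diffusion_le_two h.limitData
  obtain ⟨P, Q, E, hP, hQ, hexp⟩ := h.walk.exists_exponent_bound hη h.c₁_pos h.dim_pos
    (v := diffusion D g) (θ := κ / 5) hδ hδs hs (by linarith) (by linarith) hm
  obtain ⟨M, hM, hfM⟩ := h.exists_bound n₀
  set v := diffusion D g with hvdef
  set A := amplitude g e with hAdef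
  set σ := sigmaSq D with hσdef
  have hA0 : 0 < A := by linarith
  have hv0 : 0 < v := by linarith
  set C₁ := 2 * (C * Real.exp E * (Q + 1) + A * P * Real.exp E) with hC₁
  have hC₁0 : 0 ≤ C₁ := by positivity
  set Y := v * σ * n₀ * (d * Real.pi ^ 2) / (2 * d) with hY
  -- For n ≤ n₀ the crude error M + A is divided by lower bounds for A, for the Gaussian factor (at
  -- least e^{-Y}) and for n^{-(q-1)}.
  set C₂ := (M + A) / A * Real.exp Y * (n₀ + 1 : ℝ) ^ (q - 1) with hC₂
  have hC₂0 : 0 ≤ C₂ := by positivity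
  refine ⟨C₁ + C₂, fun n hn k p hpk hp hap => ?_⟩
  have hn' : (1 : ℝ) ≤ n := by exact_mod_cast hn
  have hvσn : 0 < v * σ * n := by positivity
  have hk : ‖k‖ ^ 2 = v * σ * n * ‖p‖ ^ 2 := by
    rw [hpk, norm_smul, mul_pow, norm_inv, Real.norm_eq_abs, abs_of_nonneg (Real.sqrt_nonneg _),
      inv_pow, Real.sq_sqrt hvσn.le]
    field_simp
  have hX0 : 0 ≤ ‖k‖ ^ 2 * (n : ℝ) ^ (-δ) := by positivity
  have hY0 : 0 ≤ (n : ℝ) ^ (-(q - 1)) := by positivity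
  have hpos : 0 < A * Real.exp (-‖k‖ ^ 2 / (2 * d)) := by positivity
  rw [mul_assoc] at hap
  suffices |f n p - A * Real.exp (-‖k‖ ^ 2 / (2 * d))| ≤
      A * Real.exp (-‖k‖ ^ 2 / (2 * d)) * (C₁ * (‖k‖ ^ 2 * (n : ℝ) ^ (-δ) + (n : ℝ) ^ (-(q - 1)))) ∨
      |f n p - A * Real.exp (-‖k‖ ^ 2 / (2 * d))| ≤
      A * Real.exp (-‖k‖ ^ 2 / (2 * d)) * (C₂ * (n : ℝ) ^ (-(q - 1))) by
    have h1 : 0 ≤ C₂ * (‖k‖ ^ 2 * (n : ℝ) ^ (-δ)) := by positivity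
    have h2 : 0 ≤ C₂ * (n : ℝ) ^ (-(q - 1)) := by positivity
    have h3 : 0 ≤ C₁ * (‖k‖ ^ 2 * (n : ℝ) ^ (-δ)) := by positivity
    have h4 : 0 ≤ C₁ * (n : ℝ) ^ (-(q - 1)) := by positivity
    rcases this with h5 | h5
    · refine h5.trans (mul_le_mul_of_nonneg_left ?_ hpos.le)
      linarith
    · refine h5.trans (mul_le_mul_of_nonneg_left ?_ hpos.le)
      linarith
  rcases le_total n₀ n with hnn | hnn
  · left
    obtain ⟨x1, x2, x3⟩ := hexp n hn p hp hap
    have x0 := hmain n hnn (a D p) (h.walk.a_nonneg p) hap _ _ _ (h.localData hp (ht p hp))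
    rw [← hk] at x1 x2 x3
    have y1 : psi δ n ≤ (n : ℝ) ^ (-δ) := psi_le_rpow δ hδ.le hn
    have y2 : psi (q - 1) n ≤ (n : ℝ) ^ (-(q - 1)) := psi_le_rpow (q - 1) (by linarith) hn
    have hψ := psi_nonneg δ n
    rw [neg_div]
    refine abs_exp_compare (x := v * a D p * n) hA hC hX0 hY0 hQ hP (x0.trans ?_) (x2.trans ?_) x3
    · refine mul_le_mul_of_nonneg_left ?_ (by positivity)
      refine add_le_add ?_ y2
      calc n * a D p * psi δ n ≤ Q * ‖k‖ ^ 2 * (n : ℝ) ^ (-δ) := by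
            gcongr
        _ = _ := by ring
    · gcongr
  · right
    have hnn' : (n : ℝ) ≤ n₀ := by exact_mod_cast hnn
    have z1 := hfM n hnn p hp
    have z2 : ‖k‖ ^ 2 / (2 * d) ≤ Y := by
      rw [hk, hY]
      have := norm_sq_le_of_mem_cube hp
      gcongr
    have z3 : Real.exp (-‖k‖ ^ 2 / (2 * d)) ≤ 1 := by
      rw [Real.exp_le_one_iff, neg_div, neg_nonpos]; positivity
    have z4 : |f n p - A * Real.exp (-‖k‖ ^ 2 / (2 * d))| ≤ M + A := by
      refine (abs_sub _ _).trans ?_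
      rw [abs_of_pos hpos]
      nlinarith
    refine z4.trans ?_
    have z5 : 1 ≤ Real.exp (-‖k‖ ^ 2 / (2 * d)) * Real.exp Y := by
      rw [← Real.exp_add]
      refine Real.one_le_exp ?_
      rw [neg_div]; linarith
    have z6 : 1 ≤ (n₀ + 1 : ℝ) ^ (q - 1) * (n : ℝ) ^ (-(q - 1)) := by
      rw [Real.rpow_neg (by linarith), ← div_eq_mul_inv, one_le_div (by positivity)]
      exact Real.rpow_le_rpow (by linarith) (by linarith) (by linarith)
    have e2 : A * Real.exp (-‖k‖ ^ 2 / (2 * d)) * (C₂ * (n : ℝ) ^ (-(q - 1))) =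
        (M + A) * ((Real.exp (-‖k‖ ^ 2 / (2 * d)) * Real.exp Y) *
          ((n₀ + 1 : ℝ) ^ (q - 1) * (n : ℝ) ^ (-(q - 1)))) := by
      rw [hC₂]; field_simp
    rw [e2]
    refine le_mul_of_one_le_right (by positivity) ?_
    exact one_le_mul_of_one_le_of_one_le z5 z6

end
end LaceExpansion
end

/-! ### Assembly of the main theorem -/

noncomputable section
namespace LaceExpansion

theorem atZero_succ {d : ℕ} (c : ℝ) (u : ℕ → Momentum d → ℝ → ℝ) (z : ℝ) (n : ℕ) :
    atZero c u z (n + 1) = fun k => u (n + 1) k z :=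
  atZero_of_ne c u z (Nat.succ_ne_zero n)

theorem tsum_succ_of_zero {u : ℕ → ℝ} (hs : Summable u) (h0 : u 0 = 0) :
    ∑' m, u (m + 1) = ∑' m, u m := by
  rw [hs.tsum_eq_zero_add, h0, zero_add]

end LaceExpansion
end

open LaceExpansion

theorem mainTheorem2 (d : ℕ) (hd : 4 < d) (δ ε : ℝ) (hδ : 0 < δ)
    (hδ' : δ < min 1 (((d : ℝ) - 4) / 4)) (hε : δ < ε)
    (D : ℝ → (Fin d → ℤ) → ℝ)
    (f g e : ℝ → ℕ → LaceExpansion.Momentum d → ℝ → ℝ)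
    (hrec : LaceExpansion.Recursion d f g e)
    (hreg : LaceExpansion.Regularity d f g)
    (hS : LaceExpansion.AssumptionS d f g e)
    (hD : LaceExpansion.AssumptionD d ε D f e)
    (hE : LaceExpansion.AssumptionE d D f e)
    (hG : LaceExpansion.AssumptionG d ε D f g) :
    ∃ L₀ γ C : ℝ, 1 ≤ L₀ ∧ 0 < γ ∧ 0 < C ∧ ∀ L : ℝ, L₀ ≤ L →
      ∃ zc A v : ℝ, 0 < zc ∧ 0 < A ∧ 0 < v ∧
        -- `zc`, `A`, `v` are the constants of the Gaussian limit theorem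
        LaceExpansion.GaussianAsymptotics d δ γ (D L) (f L) zc A v ∧
        LaceExpansion.DiffusiveBehaviour d δ L C (D L) (f L) zc v ∧
        LaceExpansion.L1Decay d L C (D L) (f L) zc ∧
        -- all series below, over `m ≥ 1`, converge absolutely, with nonzero denominators
        Summable (fun m : ℕ => e L (m + 1) 0 zc) ∧
        Summable (fun m : ℕ => ((m : ℝ) + 1) * g L (m + 1) 0 zc) ∧
        Summable (fun m : ℕ => LaceExpansion.lap0 (fun k => g L (m + 1) k zc)) ∧
        0 < LaceExpansion.sigmaSq (D L) ∧
        0 < ∑' m : ℕ, ((m : ℝ) + 1) * g L (m + 1) 0 zc ∧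
        -- the three identities
        HasSum (fun m : ℕ => g L (m + 1) 0 zc) 1 ∧
        A = (1 + ∑' m : ℕ, e L (m + 1) 0 zc) /
              (∑' m : ℕ, ((m : ℝ) + 1) * g L (m + 1) 0 zc) ∧
        v = -(∑' m : ℕ, LaceExpansion.lap0 (fun k => g L (m + 1) k zc)) /
              (LaceExpansion.sigmaSq (D L) *
                ∑' m : ℕ, ((m : ℝ) + 1) * g L (m + 1) 0 zc) ∧
        -- the consequence
        |zc - 1| ≤ C * LaceExpansion.beta d L ∧
        |A - 1| ≤ C * LaceExpansion.beta d L ∧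
        |v - 1| ≤ C * LaceExpansion.beta d L := by
  have hd5 : (5 : ℝ) ≤ d := by exact_mod_cast hd
  have hδ1 : δ < 1 := hδ'.trans_le (min_le_left _ _)
  have hδ4 : δ < ((d : ℝ) - 4) / 4 := hδ'.trans_le (min_le_right _ _)
  set q : ℝ := ((d : ℝ) - 2) / 2 with hq
  have hq1 : 1 < q := by rw [hq]; linarith
  have hδq : δ < q - 1 := by rw [hq]; linarith
  -- An exponent δ₁ strictly between δ and min(1, ε, q - 1): the Taylor bound holds with ε' = δ₁,
  -- and the gap δ₁ - δ absorbs logarithms.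
  set μ := min (min 1 ε) (q - 1) with hμ
  have hμδ : δ < μ := lt_min (lt_min hδ1 hε) hδq
  have hμ1 : μ ≤ 1 := (min_le_left _ _).trans (min_le_left _ _)
  have hμε : μ ≤ ε := (min_le_left _ _).trans (min_le_right _ _)
  have hμq : μ ≤ q - 1 := min_le_right _ _
  set δ₁ := (δ + μ) / 2 with hδ₁
  have hδδ₁ : δ < δ₁ := by rw [hδ₁]; linarith
  have hδ₁μ : δ₁ < μ := by rw [hδ₁]; linarith
  -- Half of the spare room in 1 < q - δ₁ is given to the tilt.
  set κ := min 1 ((q - 1 - δ₁) / 2) with hκ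
  have hκ0 : 0 < κ := lt_min one_pos (by linarith)
  have hκ1 : κ ≤ 1 := min_le_left _ _
  have hκ2 : κ ≤ (q - 1 - δ₁) / 2 := min_le_right _ _
  have hqκ : 1 < q - κ - δ₁ := by linarith
  obtain ⟨η, c₁, CD, hη, hc₁, hW⟩ := hD.walk hreg hS
  obtain ⟨M, K, hM, hK, hcrit⟩ := exists_critical_point hd (by linarith) hrec hreg hS hD hE hG hη
    hc₁ hW
  have hS1 := one_le_psiSum hq1
  have hc1 := one_le_convC hq1
  have hc2 := one_le_convC (show 1 < q - κ by linarith)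
  -- The thresholds 120 = 2 · 60 meet the smallness conditions of the tilted sequences, with and
  -- without loss of κ; 16 keeps A, v and the mean within 1/2 of 1.
  obtain ⟨L₀, hL₀, hcrit⟩ := hcrit (min (1 / (16 * psiSum q))
    (min (1 / (120 * convC q)) (1 / (120 * convC (q - κ))))) (by positivity)
  have hdC : 0 ≤ Critical.diffusiveC q δ := by
    have := Critical.lapC_nonneg (δ := δ) hq1
    have : 0 ≤ (q - 1)⁻¹ := inv_nonneg.2 (by linarith)
    rw [Critical.diffusiveC]; positivity
  set C := M + 8 * M * psiSum q + Critical.diffusiveC q δ * M + K with hC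
  have hCM : M ≤ C := by
    have : 0 ≤ 8 * M * psiSum q := by positivity
    have : 0 ≤ Critical.diffusiveC q δ * M := by positivity
    linarith
  have hCS : 8 * M * psiSum q ≤ C := by
    have : 0 ≤ Critical.diffusiveC q δ * M := by positivity
    linarith
  have hCd : Critical.diffusiveC q δ * M ≤ C := by
    have : 0 ≤ 8 * M * psiSum q := by positivity
    linarith
  have hCK : K ≤ C := by
    have : 0 ≤ 8 * M * psiSum q := by positivity
    have : 0 ≤ Critical.diffusiveC q δ * M := by positivity
    linarith
  refine ⟨L₀, κ / 5, C, hL₀, by linarith, by linarith, fun L hL => ?_⟩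
  obtain ⟨hb, zc, hzc, hzc1, hmod, hbd, hat, hF⟩ := hcrit L hL
  have hL1 : 1 ≤ L := le_trans hL₀ hL
  have hβ : 0 < beta d L := beta_pos hL1
  set b := M * beta d L with hbdef
  have hb0 : 0 ≤ b := by positivity
  have hb1 := hb.trans (min_le_left _ _)
  have hb2 := (hb.trans (min_le_right _ _)).trans (min_le_left _ _)
  have hb3 := (hb.trans (min_le_right _ _)).trans (min_le_right _ _)
  rw [le_div_iff₀ (by positivity)] at hb1 hb2 hb3
  have hcb : 0 ≤ convC q * b := by positivity
  have h : Critical d L η c₁ CD q b (D L) zc (atZero 1 (f L) zc) (atZero 0 (g L) zc)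
      (atZero 0 (e L) zc) :=
    ⟨hW L hL1, hmod, hbd, by omega, hc₁, hb0, hq1, by linarith, by linarith⟩
  have hσ := h.walk.sigmaSq_pos h.dim_pos h.c₁_pos
  have hA := h.half_le_amplitude
  have hv := h.half_le_diffusion
  have hT := h.half_le_meanStep
  have hfn : ∀ n, 1 ≤ n → atZero 1 (f L) zc n = fun k => f L n k zc := fun n hn =>
    atZero_of_ne _ _ _ (by omega)
  have sum_e := tsum_succ_of_zero h.summable_e (hmod.renewal 0 zero_mem_cube).e_zero
  have sum_g := tsum_succ_of_zero h.summable_mul_g (by simp)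
  have sum_γ := tsum_succ_of_zero h.summable_nlap (hmod.momentSeq h.dim_pos).γ_zero
  have sg := (summable_nat_add_iff 1).2 h.summable_mul_g
  have se := (summable_nat_add_iff 1).2 h.summable_e
  have sγ := (summable_nat_add_iff 1).2 h.summable_nlap
  have hg1 := (hasSum_nat_add_iff 1).2 (show HasSum (fun m => atZero 0 (g L) zc m 0)
    (1 + ∑ i ∈ Finset.range 1, atZero 0 (g L) zc i 0) by
      simpa [atZero_zero] using h.hasSum_g)
  have hlap : ∀ m, lap0 (fun k => g L (m + 1) k zc) =
      sigmaSq (D L) * nlap (D L) (atZero 0 (g L) zc (m + 1)) := fun m => by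
    rw [atZero_succ, nlap]; field_simp
  simp only [atZero_succ, Nat.cast_add, Nat.cast_one] at sum_e sum_g sg se hg1
  refine ⟨zc, amplitude (atZero 0 (g L) zc) (atZero 0 (e L) zc),
    diffusion (D L) (atZero 0 (g L) zc), hzc, by linarith, by linarith, ?_, ?_, ?_, se, sg, ?_, hσ,
    ?_, hg1, ?_, ?_, ?_, ?_, ?_⟩
  -- The cosine expansion needs a moment exponent s ≤ 1, hence the truncation of ε at 1.
  · have hs : δ < min 1 ε := lt_min hδ1 hε
    have hsε : min 1 ε ≤ ε := min_le_right _ _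
    have hmom : Summable fun x => latticeNorm x ^ (2 + 2 * min 1 ε) * D L x :=
      summable_moment_of_le (r := 2 + 2 * ε) (by linarith) (by linarith) h.walk.nonneg
        (summable_of_fourier_zero h.walk.normalised).1 (hD.moments L hL1)
    obtain ⟨C', hC'⟩ := h.gaussian hη hδ hδδ₁ (by linarith) hκ0 hκ1 hqκ (by linarith) (by linarith)
      hs (min_le_left _ _) hmom (fun k hk m hm => by
        have := (hat m hm).g_taylor k hk δ₁ (by linarith) (by linarith)
        rwa [atZero_of_ne _ _ _ (show m ≠ 0 by omega), nlap, div_eq_inv_mul])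
    refine ⟨C', fun n hn k p hpk hp hap => ?_⟩
    have := hC' n hn k p hpk hp hap
    rw [hfn n hn] at this
    -- The exponents match since q - 1 = (d - 4)/2.
    convert this using 5
    rw [hq]; ring
  · intro n hn
    have h1 := h.half_le_f_zero n
    have h2 := h.diffusive hδ.le hδ1.le (by linarith) hn
    rw [hfn n hn] at h1 h2
    refine ⟨by linarith, h2.trans ?_⟩
    have hn0 : 0 ≤ (n : ℝ) ^ (-δ) := by positivity
    refine mul_le_mul_of_nonneg_left ?_ (by positivity)
    rw [hbdef, ← mul_assoc]
    gcongr
  · intro n hn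
    refine ⟨(hF n hn).1, (hF n hn).2.1.trans ?_⟩
    have : 0 ≤ (n : ℝ) ^ (-(d : ℝ) / 2) := by positivity
    gcongr
  · simp only [hlap]
    exact sγ.mul_left _
  · rw [sum_g]
    exact lt_of_lt_of_le (by norm_num) hT
  · rw [sum_e, sum_g, amplitude, meanStep]
  · simp only [hlap]
    rw [tsum_mul_left, sum_γ, sum_g, diffusion, ← meanStep]
    field_simp
  · exact hzc1.trans (mul_le_mul_of_nonneg_right hCM hβ.le)
  · refine h.amplitude_spec.1.trans ?_
    calc 8 * b * psiSum q = 8 * M * psiSum q * beta d L := by rw [hbdef]; ring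
      _ ≤ _ := by gcongr
  · refine h.abs_diffusion_sub_one_le.trans ?_
    calc 8 * b * psiSum q = 8 * M * psiSum q * beta d L := by rw [hbdef]; ring
      _ ≤ _ := by gcongr
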